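/- Let $M$ be a smooth $2$-manifold, $U$ a smooth $1$-manifold, and $\dot q=f(q,u)$, $q\in M$, $u\in U$, a smooth control system satisfying the regularity assumptions $f\wedge\partial_uf\neq0$ and $\partial_uf\wedge\partial_u^2f\ne 0$, both bivectors having the same sign (the curves $f(q,\cdot)$ are strictly convex around the origin; this condition does not depend on coordinates). *Invariants.* Let $h(\lambda)=\max_u\langle\lambda,f(q,u)\rangle$, $\lambda\in T_q^*M$, be the maximized Hamiltonian of the time-optimal problem (the maximum being taken over controls near a given one), $\mathcal H=h^{-1}(1)$, $s$ the restriction to $\mathcal H$ of the Liouville form $p\,dq$, and $\vec h$ the Hamiltonian field, $\sigma(\cdot,\vec h)=dh$, $\sigma=dp\wedge dq$. The pairs $(q,u)$ are coordinates on $\mathcal H$: $(q,u)$ corresponds to the covector $\lambda\in\mathcal H\cap T^*_qM$ at which the maximum is attained at $u$. The invariants are a smooth vertical vector field $v$ on $\mathcal H$ (determined up to sign) and smooth functions $b$, $\kappa$ on $\mathcal H$ with $$L_v^2s=-s+b\,L_vs,\qquad [\vec h,[v,\vec h]]=\kappa v .$$ A control is called *natural* if $v=\partial/\partial u$ in the coordinates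 $(q,u)$. A *local feedback transformation* near $(q_0,u_0)$ is a diffeomorphism $\Theta(q,u)=(\phi(q),\psi(q,u))$ of a neighbourhood of $(q_0,u_0)$ onto a product $O\times V$ of open sets $O\subset\mathbb R^2$, $V\subset\mathbb R$, where $\phi$ is a diffeomorphism onto $O$; it carries $f$ to the system $\tilde f$ on $O\times V$ with $T_q\phi(f(q,u))=\tilde f(\phi(q),\psi(q,u))$. **Theorem.** Such $v,b,\kappa$ exist, and the following hold (for every choice of them). 1. $\kappa$ and $L_{\vec h}b$ vanish identically if and only if near every $(q_0,u_0)\in M\times U$ there is a local feedback transformation to a system $\tilde f(q,w)$ with natural control $w$ such that $$\Big[\tilde f(\cdot,w),\tfrac{\partial\tilde f(\cdot,w)}{\partial w}\Big]=0\quad\text{for all }w .$$ If near every point there is a local feedback transformation to a system with this commutation property in a control $w$ that is not assumed to be natural, then still $\kappa\equiv0$. 2. These systems are parametrized by families of diffeomorphisms generated by the time-dependent vector fields $$X_w=(a_1(w)+q_2)\,\partial_{q_1}+(a_2(w,q_2)-q_1)\,\partial_{q_2},\qquad a_1,a_2\ \text{smooth},$$ in the following sense. (a) $\kappa$ and $L_{\vec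 h}b$ vanish identically if and only if near every $(q_0,u_0)$ there is a local feedback transformation to a system $\tilde f$ on $O\times V$ for which there is a smooth family of diffeomorphisms $P_w$, $w\in V$, of $O$ onto open subsets of $\mathbb R^2$ with $$\frac{d}{dw}P_w=X_w\circ P_w,\qquad P_{w_0}=\mathrm{Id}\ \ (w_0=\psi(q_0,u_0)),\qquad P_{w*}\Big(\tilde f(\cdot,w),\tfrac{\partial\tilde f(\cdot,w)}{\partial w}\Big)=\Big(\tbinom10,\tbinom01\Big)$$ for some smooth $a_1,a_2$. (b) In any local coordinates, if the control $w$ of $\tilde f$ is natural and $\tilde f(\cdot,w)$, $\partial_w\tilde f(\cdot,w)$ commute for every $w$, then near every point $(q_0,w_0)$ there is such a family $P_w$ (without the condition $P_{w_0}=\mathrm{Id}$, which can be added if $\tilde f(\cdot,w_0)=\partial_{q_1}$ and $\partial_w\tilde f(\cdot,w_0)=\partial_{q_2}$). (c) Conversely, for every smooth family of diffeomorphisms $P_w$ of an open set $O$ onto open sets with $\frac{d}{dw}P_w=X_w\circ P_w$, the system $\tilde f$ defined by $P_{w*}\tilde f(\cdot,w)=\binom10$ is smooth, has natural control $w$, satisfies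 $P_{w*}\partial_w\tilde f(\cdot,w)=\binom01$, and its fields $\tilde f(\cdot,w)$, $\partial_w\tilde f(\cdot,w)$ commute. -/

import Mathlib

open Set Filter Topology
open scoped Manifold ContDiff

/-- The coordinate plane of the state space. -/
abbrev Plane : Type := EuclideanSpace ℝ (Fin 2)

/-- Covectors of the coordinate plane. -/
abbrev Coplane : Type := Plane →L[ℝ] ℝ

/-- The coordinate vector field `∂/∂q₁`. -/
noncomputable def e₁ : Plane := !₂[1, 0]

/-- The coordinate vector field `∂/∂q₂`. -/
noncomputable def e₂ : Plane := !₂[0, 1]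

/-- The wedge product `a ∧ b` of two plane vectors (as a determinant). -/
def wedge (a b : Plane) : ℝ := a 0 * b 1 - a 1 * b 0

/-- The partial derivative `∂F/∂u` of a map of `(q, u)`. -/
noncomputable def dU (F : Plane × ℝ → Plane) (x : Plane × ℝ) : Plane :=
  deriv (fun t => F (x.1, t)) x.2

/-- The control `u` of the system `q' = F (q, u)` is such that, for every fixed value of `u`,
the vector fields `F (·, u)` and `∂F/∂u (·, u)` commute. -/
def Commuting (F : Plane × ℝ → Plane) (O : Set Plane) (V : Set ℝ) : Prop :=
  ∀ q ∈ O, ∀ u ∈ V,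
    VectorField.lieBracket ℝ (fun y => F (y, u)) (fun y => dU F (y, u)) q = 0

/-! ### The maximized Hamiltonian and the invariant moving frame, in coordinates

A system `q' = F (q, u)` with `(q, u) ∈ O × V`, `O` open in the plane and `V` open in the line.
The level surface `ℋ = {h = 1}` of the maximized Hamiltonian in the cotangent bundle is
parametrized by `(q, u)`, through `(q, u) ↦ (q, p (q, u))`, where `p (q, u)` is the covector of
`ℋ_q` at which the maximum is attained at the control `u`. -/

/-- The symplectic form `σ = dp ∧ dq` of the cotangent bundle; a tangent vector is
`(δq, δp)`. -/
def symplectic (ξ η : Plane × Coplane) : ℝ := ξ.2 η.1 - η.2 ξ.1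

/-- `w` is the value at `lam` of the Hamiltonian vector field of `h`:
`σ(·, w) = dh` at `lam`. -/
def IsHamiltonianVector (h : Plane × Coplane → ℝ) (lam w : Plane × Coplane) : Prop :=
  ∀ ξ, symplectic ξ w = fderiv ℝ h lam ξ

/-- `h` is, near the point `(q, p)` of the cotangent bundle, the maximized Hamiltonian
`h (q', p') = max ⟨p', F (q', w)⟩`, the maximum being taken over the controls `w` in a
neighbourhood `N` of `u` (`N` may be all of `V`). -/
def IsMaximizedHamiltonian (F : Plane × ℝ → Plane) (V : Set ℝ) (q : Plane) (u : ℝ)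
    (p : Coplane) (h : Plane × Coplane → ℝ) : Prop :=
  ∃ N ⊆ V, N ∈ 𝓝 u ∧
    ∀ᶠ lam : Plane × Coplane in 𝓝 (q, p),
      IsGreatest ((fun w => lam.2 (F (lam.1, w))) '' N) (h lam)

/-- The Lie derivative `L_X η` of a one-form `η` along a vector field `X`. -/
noncomputable def lieDerivForm (X : Plane × ℝ → Plane × ℝ)
    (η : Plane × ℝ → (Plane × ℝ →L[ℝ] ℝ)) (x : Plane × ℝ) : Plane × ℝ →L[ℝ] ℝ :=
  fderiv ℝ η x (X x) + (η x).comp (fderiv ℝ X x)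

/-- The restriction to `ℋ` of the Liouville one-form `p dq`, in the coordinates `(q, u)`. -/
noncomputable def liouville (p : Plane × ℝ → Coplane) (x : Plane × ℝ) : Plane × ℝ →L[ℝ] ℝ :=
  (p x).comp (ContinuousLinearMap.fst ℝ Plane ℝ)

/-- The feedback-invariant objects of the system `q' = F (q, u)`, `(q, u) ∈ O × V`, as objects on
the level surface `ℋ` in the coordinates `(q, u)`: the covector `p`, the Hamiltonian vector field
`H`, the vertical vector field `v`, the function `b` and the curvature `k`. -/
structure IsMovingFrame (F : Plane × ℝ → Plane) (O : Set Plane) (V : Set ℝ)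
    (p : Plane × ℝ → Coplane) (H v : Plane × ℝ → Plane × ℝ) (b k : Plane × ℝ → ℝ) : Prop where
  smooth_p : ContDiffOn ℝ ∞ p (O ×ˢ V)
  smooth_H : ContDiffOn ℝ ∞ H (O ×ˢ V)
  smooth_v : ContDiffOn ℝ ∞ v (O ×ˢ V)
  smooth_b : ContDiffOn ℝ ∞ b (O ×ˢ V)
  smooth_k : ContDiffOn ℝ ∞ k (O ×ˢ V)
  /-- `(q, p (q, u))` lies on the level `h = 1` of the maximized Hamiltonian, the maximum is
  attained at `u`, and `H`, carried to the cotangent bundle, is the Hamiltonian field of `h`. -/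
  hamiltonian : ∀ x ∈ O ×ˢ V, ∃ h : Plane × Coplane → ℝ,
    IsMaximizedHamiltonian F V x.1 x.2 (p x) h ∧
    ContDiffAt ℝ ∞ h (x.1, p x) ∧
    h (x.1, p x) = 1 ∧ p x (F x) = 1 ∧
    IsHamiltonianVector h (x.1, p x)
      (fderiv ℝ (fun y : Plane × ℝ => (y.1, p y)) x (H x))
  /-- `v` is tangent to the fibres `ℋ_q`. -/
  vertical : ∀ x ∈ O ×ˢ V, (v x).1 = 0
  /-- `L_v² s = -s + b L_v s`. -/
  natural : ∀ x ∈ O ×ˢ V,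
    lieDerivForm v (lieDerivForm v (liouville p)) x
      = - liouville p x + b x • lieDerivForm v (liouville p) x
  /-- `[H, [v, H]] = k v`. -/
  curvature : ∀ x ∈ O ×ˢ V,
    VectorField.lieBracket ℝ H (VectorField.lieBracket ℝ v H) x = k x • v x

/-- The control `u` is a natural parameter of the fibres `ℋ_q`: the invariant vertical field `v`
is `∂/∂u`. -/
def IsNaturalControl (F : Plane × ℝ → Plane) (O : Set Plane) (V : Set ℝ) : Prop :=
  ∃ p H b k, IsMovingFrame F O V p H (fun _ => (0, 1)) b k

/-! ### Families of diffeomorphisms generated by the fields `X_u` -/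

/-- The field `X_u = (a₁(u) + q₂) ∂/∂q₁ + (a₂(u, q₂) - q₁) ∂/∂q₂`. -/
noncomputable def fieldX (a₁ : ℝ → ℝ) (a₂ : ℝ × ℝ → ℝ) (u : ℝ) (q : Plane) : Plane :=
  !₂[a₁ u + q 1, a₂ (u, q 1) - q 0]

/-- `P u`, `u ∈ V`, is a smooth family of diffeomorphisms from `O` onto open subsets of the plane
that is generated by a time-dependent vector field of the form `fieldX a₁ a₂`, with smooth `a₁`
and `a₂` (`a₂` being defined on an open set that contains all the values at which it is used):
`dP_u/du = X_u ∘ P_u`. -/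
structure IsGeneratedFamily (a₁ : ℝ → ℝ) (a₂ : ℝ × ℝ → ℝ) (P : ℝ → Plane → Plane)
    (O : Set Plane) (V : Set ℝ) : Prop where
  isOpen_O : IsOpen O
  isOpen_V : IsOpen V
  smooth_a₁ : ContDiffOn ℝ ∞ a₁ V
  smooth_a₂ : ∃ D : Set (ℝ × ℝ), IsOpen D ∧ ContDiffOn ℝ ∞ a₂ D ∧
    ∀ q ∈ O, ∀ u ∈ V, (u, P u q 1) ∈ D
  smooth_P : ContDiffOn ℝ ∞ (fun x : Plane × ℝ => P x.2 x.1) (O ×ˢ V)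
  injOn : ∀ u ∈ V, InjOn (P u) O
  bijective : ∀ q ∈ O, ∀ u ∈ V, Function.Bijective (fderiv ℝ (P u) q)
  generated : ∀ q ∈ O, ∀ u ∈ V, HasDerivAt (fun t => P t q) (fieldX a₁ a₂ u (P u q)) u

/-- `P_{u*} (F (·, u), ∂F/∂u (·, u)) = (∂/∂q₁, ∂/∂q₂)`. -/
def Straightens (P : ℝ → Plane → Plane) (F : Plane × ℝ → Plane)
    (O : Set Plane) (V : Set ℝ) : Prop :=
  ∀ q ∈ O, ∀ u ∈ V, fderiv ℝ (P u) q (F (q, u)) = e₁ ∧ fderiv ℝ (P u) q (dU F (q, u)) = e₂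

/-! ### Control systems on manifolds -/

section Manifolds

variable {M : Type*} [TopologicalSpace M] [ChartedSpace Plane M]
variable {U : Type*} [TopologicalSpace U] [ChartedSpace ℝ U]

/-- The right-hand side of the control system `q' = f (q, u)` is smooth. -/
def IsSmoothSystem [IsManifold (𝓡 2) ∞ M]
    (f : (q : M) → U → TangentSpace (𝓡 2) q) : Prop :=
  ContMDiff ((𝓡 2).prod 𝓘(ℝ, ℝ)) (𝓡 2).tangent ∞
    (fun x : M × U => (⟨x.1, f x.1 x.2⟩ : TangentBundle (𝓡 2) M))

/-- The right-hand side of the system in a chart `e` of the state space and a chart `e'` of the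
control set; it is meaningful on `e.target ×ˢ e'.target`. -/
noncomputable def localRep (f : (q : M) → U → TangentSpace (𝓡 2) q)
    (e : OpenPartialHomeomorph M Plane) (e' : OpenPartialHomeomorph U ℝ)
    (x : Plane × ℝ) : Plane :=
  mfderiv (𝓡 2) 𝓘(ℝ, Plane) e (e.symm x.1) (f (e.symm x.1) (e'.symm x.2))

/-- The regularity assumptions: `f ∧ ∂f/∂u ≠ 0`, and `∂f/∂u ∧ ∂²f/∂u²` is nonzero and of the same
sign, that is, the curves `f (q, ·)` are strictly convex around the origin. The condition does
not depend on the charts nor on orientations. -/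
def IsRegularSystem (f : (q : M) → U → TangentSpace (𝓡 2) q) : Prop :=
  ∀ e ∈ IsManifold.maximalAtlas (𝓡 2) ∞ M, ∀ e' ∈ IsManifold.maximalAtlas 𝓘(ℝ, ℝ) ∞ U,
    ∀ x ∈ e.target ×ˢ e'.target,
      0 < wedge (localRep f e e' x) (dU (localRep f e e') x)
        * wedge (dU (localRep f e e') x) (dU (dU (localRep f e e')) x)

/-- In all charts the moving frame with its invariants `b` and `k` exists. -/
def HasInvariants (f : (q : M) → U → TangentSpace (𝓡 2) q) : Prop :=
  ∀ e ∈ IsManifold.maximalAtlas (𝓡 2) ∞ M, ∀ e' ∈ IsManifold.maximalAtlas 𝓘(ℝ, ℝ) ∞ U,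
    ∃ p H v b k, IsMovingFrame (localRep f e e') e.target e'.target p H v b k

/-- The curvature vanishes identically. -/
def CurvatureVanishes (f : (q : M) → U → TangentSpace (𝓡 2) q) : Prop :=
  ∀ e ∈ IsManifold.maximalAtlas (𝓡 2) ∞ M, ∀ e' ∈ IsManifold.maximalAtlas 𝓘(ℝ, ℝ) ∞ U,
    ∀ p H v b k, IsMovingFrame (localRep f e e') e.target e'.target p H v b k →
      ∀ x ∈ e.target ×ˢ e'.target, k x = 0

/-- The derivative of the invariant `b` along the Hamiltonian field vanishes identically. -/
def DerivBVanishes (f : (q : M) → U → TangentSpace (𝓡 2) q) : Prop :=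
  ∀ e ∈ IsManifold.maximalAtlas (𝓡 2) ∞ M, ∀ e' ∈ IsManifold.maximalAtlas 𝓘(ℝ, ℝ) ∞ U,
    ∀ p H v b k, IsMovingFrame (localRep f e e') e.target e'.target p H v b k →
      ∀ x ∈ e.target ×ˢ e'.target, fderiv ℝ b x (H x) = 0

/-- `Θ (q, u) = (φ q, ψ (q, u))` is a feedback transformation, defined near `(q₀, u₀)`, from the
system `q' = f (q, u)` to the system `q' = G (q, w)`, `(q, w) ∈ O × V`: `Θ` is a diffeomorphism
of its source onto `O × V`, `φ` is a diffeomorphism onto `O` (a chart of the state space), and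
`T_q φ (f (q, u)) = G (φ q, ψ (q, u))`. -/
structure IsLocalFeedback (f : (q : M) → U → TangentSpace (𝓡 2) q) (q₀ : M) (u₀ : U)
    (Θ : OpenPartialHomeomorph (M × U) (Plane × ℝ)) (φ : OpenPartialHomeomorph M Plane)
    (O : Set Plane) (V : Set ℝ) (G : Plane × ℝ → Plane) : Prop where
  mem_source : (q₀, u₀) ∈ Θ.source
  target_eq : Θ.target = O ×ˢ V
  smooth : ContMDiffOn ((𝓡 2).prod 𝓘(ℝ, ℝ)) 𝓘(ℝ, Plane × ℝ) ∞ Θ Θ.source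
  smooth_symm : ContMDiffOn 𝓘(ℝ, Plane × ℝ) ((𝓡 2).prod 𝓘(ℝ, ℝ)) ∞ Θ.symm Θ.target
  chart : φ ∈ IsManifold.maximalAtlas (𝓡 2) ∞ M
  chart_target : φ.target = O
  triangular : ∀ x ∈ Θ.source, x.1 ∈ φ.source ∧ (Θ x).1 = φ x.1
  transforms : ∀ x ∈ Θ.source,
    mfderiv (𝓡 2) 𝓘(ℝ, Plane) φ x.1 (f x.1 x.2) = G (Θ x)

end Manifolds

/-!
After the normalization of the control, the system is a frame `f`, `∂ᵤf` of plane fields with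
`∂ᵤ²f = -f + b ∂ᵤf`, and its invariants are read off from brackets on the space of pairs `(q, u)`:
the projections of `v`, `h⃗` and `[v, h⃗]` to the plane are `0`, `f` and `D_v f`. Expanding
`[h⃗, [v, [v, h⃗]]]` by the Jacobi identity gives `[v, [v, h⃗]] = -h⃗ - b [v, h⃗]` up to a vertical
field with coefficient `L_h⃗ b`. Hence, if `κ` and `L_h⃗ b` vanish, the form dual to `v` that
annihilates `h⃗` and `[v, h⃗]` is closed. Its primitive `w` is a natural control in which `h⃗` and
`[v, h⃗]` become the horizontal fields `f` and `∂_w f`, so that these commute.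

Commuting fields are straightened simultaneously by diffeomorphisms `P_w`. Naturality of `w` says
that the generator `X_w` of this family satisfies `∂X_w/∂q₁ = -e₂` and that `∂X_w/∂q₂ - e₁` is a
multiple of `e₂`, which integrates to the stated form of `X_w`. The same computation read
backwards gives the converse.
-/

open VectorField (lieBracket)

/-! ### Calculus on open sets -/

section Calculus

variable {E F G : Type*} [NormedAddCommGroup E] [NormedSpace ℝ E]
  [NormedAddCommGroup F] [NormedSpace ℝ F] [NormedAddCommGroup G] [NormedSpace ℝ G]
  {Ω : Set E}

/-- The derivative `D_X f` of a vector-valued function `f` along a vector field `X`. -/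
noncomputable def derivAlong (X : E → E) (f : E → F) (x : E) : F :=
  fderiv ℝ f x (X x)

theorem minSmoothness_two_le_infty : minSmoothness ℝ 2 ≤ ∞ := by
  rw [minSmoothness_of_isRCLikeNormedField]
  exact WithTop.coe_le_coe.2 le_top

theorem differentiableAt_of_contDiffOn (hΩ : IsOpen Ω) {f : E → F} (hf : ContDiffOn ℝ ∞ f Ω)
    {x : E} (hx : x ∈ Ω) : DifferentiableAt ℝ f x :=
  (hf.contDiffAt (hΩ.mem_nhds hx)).differentiableAt (by simp)

theorem contDiffOn_fderiv (hΩ : IsOpen Ω) {f : E → F} (hf : ContDiffOn ℝ ∞ f Ω) :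
    ContDiffOn ℝ ∞ (fderiv ℝ f) Ω :=
  hf.fderiv_of_isOpen hΩ (by simp)

theorem contDiffOn_derivAlong (hΩ : IsOpen Ω) {X : E → E} {f : E → F}
    (hX : ContDiffOn ℝ ∞ X Ω) (hf : ContDiffOn ℝ ∞ f Ω) : ContDiffOn ℝ ∞ (derivAlong X f) Ω :=
  (contDiffOn_fderiv hΩ hf).clm_apply hX

theorem contDiffOn_lieBracket (hΩ : IsOpen Ω) {X Y : E → E} (hX : ContDiffOn ℝ ∞ X Ω)
    (hY : ContDiffOn ℝ ∞ Y Ω) : ContDiffOn ℝ ∞ (lieBracket ℝ X Y) Ω :=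
  (contDiffOn_derivAlong hΩ hX hY).sub (contDiffOn_derivAlong hΩ hY hX)

theorem fderiv_congr_of_eqOn (hΩ : IsOpen Ω) {f g : E → F} (h : EqOn f g Ω) {x : E}
    (hx : x ∈ Ω) : fderiv ℝ f x = fderiv ℝ g x :=
  (h.eventuallyEq_of_mem (hΩ.mem_nhds hx)).fderiv_eq

theorem derivAlong_congr (hΩ : IsOpen Ω) {X Y : E → E} {f g : E → F} (hX : EqOn X Y Ω)
    (hf : EqOn f g Ω) : EqOn (derivAlong X f) (derivAlong Y g) Ω := by
  intro x hx
  rw [derivAlong, derivAlong, fderiv_congr_of_eqOn hΩ hf hx, hX hx]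

theorem fderiv_eq_zero_of_eqOn_const (hΩ : IsOpen Ω) {f : E → F} {c : F}
    (h : ∀ x ∈ Ω, f x = c) {x : E} (hx : x ∈ Ω) : fderiv ℝ f x = 0 := by
  rw [fderiv_congr_of_eqOn hΩ (g := fun _ => c) h hx, fderiv_fun_const, Pi.zero_apply]

theorem fderiv_clm_apply_vec {p : E → F →L[ℝ] G} {Y : E → F} {x : E}
    (hp : DifferentiableAt ℝ p x) (hY : DifferentiableAt ℝ Y x) (ξ : E) :
    fderiv ℝ (fun y => p y (Y y)) x ξ = p x (fderiv ℝ Y x ξ) + fderiv ℝ p x ξ (Y x) := by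
  rw [fderiv_clm_apply hp hY]
  rfl

theorem fderiv_apply_of_pairing_const (hΩ : IsOpen Ω) {p : E → F →L[ℝ] G} {Y : E → F} {c : G}
    (hp : ContDiffOn ℝ ∞ p Ω) (hY : ContDiffOn ℝ ∞ Y Ω) (h : ∀ x ∈ Ω, p x (Y x) = c)
    {x : E} (hx : x ∈ Ω) (ξ : E) : fderiv ℝ p x ξ (Y x) = -p x (fderiv ℝ Y x ξ) := by
  have h0 := fderiv_clm_apply_vec (differentiableAt_of_contDiffOn hΩ hp hx)
    (differentiableAt_of_contDiffOn hΩ hY hx) ξ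
  rw [fderiv_eq_zero_of_eqOn_const hΩ h hx, zero_apply] at h0
  exact eq_neg_of_add_eq_zero_right h0.symm

theorem fderiv_derivAlong (hΩ : IsOpen Ω) {X : E → E} {f : E → F} (hX : ContDiffOn ℝ ∞ X Ω)
    (hf : ContDiffOn ℝ ∞ f Ω) {x : E} (hx : x ∈ Ω) (ξ : E) :
    fderiv ℝ (derivAlong X f) x ξ
      = fderiv ℝ f x (fderiv ℝ X x ξ) + fderiv ℝ (fderiv ℝ f) x ξ (X x) :=
  fderiv_clm_apply_vec (differentiableAt_of_contDiffOn hΩ (contDiffOn_fderiv hΩ hf) hx)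
    (differentiableAt_of_contDiffOn hΩ hX hx) ξ

theorem fderiv_fderiv_comm (hΩ : IsOpen Ω) {f : E → F} (hf : ContDiffOn ℝ ∞ f Ω) {x : E}
    (hx : x ∈ Ω) (ξ η : E) : fderiv ℝ (fderiv ℝ f) x ξ η = fderiv ℝ (fderiv ℝ f) x η ξ :=
  ((hf.contDiffAt (hΩ.mem_nhds hx)).isSymmSndFDerivAt minSmoothness_two_le_infty).eq ξ η

theorem lieBracket_jacobi (hΩ : IsOpen Ω) {X Y Z : E → E} (hX : ContDiffOn ℝ ∞ X Ω)
    (hY : ContDiffOn ℝ ∞ Y Ω) (hZ : ContDiffOn ℝ ∞ Z Ω) {x : E} (hx : x ∈ Ω) :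
    lieBracket ℝ X (lieBracket ℝ Y Z) x
      = lieBracket ℝ (lieBracket ℝ X Y) Z x + lieBracket ℝ Y (lieBracket ℝ X Z) x :=
  VectorField.leibniz_identity_lieBracket minSmoothness_two_le_infty
    (hX.contDiffAt (hΩ.mem_nhds hx)) (hY.contDiffAt (hΩ.mem_nhds hx))
    (hZ.contDiffAt (hΩ.mem_nhds hx))

theorem fst_fderiv_apply {X : E → F × G} {x : E} (hX : DifferentiableAt ℝ X x) (ξ : E) :
    (fderiv ℝ X x ξ).1 = fderiv ℝ (fun y => (X y).1) x ξ := by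
  rw [fderiv.fst hX]
  rfl

theorem snd_fderiv_apply {X : E → F × G} {x : E} (hX : DifferentiableAt ℝ X x) (ξ : E) :
    (fderiv ℝ X x ξ).2 = fderiv ℝ (fun y => (X y).2) x ξ := by
  rw [fderiv.snd hX]
  rfl

theorem fst_lieBracket {X Y : E × F → E × F} {x : E × F} (hX : DifferentiableAt ℝ X x)
    (hY : DifferentiableAt ℝ Y x) : (lieBracket ℝ X Y x).1
      = derivAlong X (fun y => (Y y).1) x - derivAlong Y (fun y => (X y).1) x := by
  rw [lieBracket, Prod.fst_sub, fst_fderiv_apply hX, fst_fderiv_apply hY]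
  rfl

theorem snd_lieBracket {X Y : E × F → E × F} {x : E × F} (hX : DifferentiableAt ℝ X x)
    (hY : DifferentiableAt ℝ Y x) : (lieBracket ℝ X Y x).2
      = derivAlong X (fun y => (Y y).2) x - derivAlong Y (fun y => (X y).2) x := by
  rw [lieBracket, Prod.snd_sub, snd_fderiv_apply hX, snd_fderiv_apply hY]
  rfl

theorem fderiv_partial_fst {f : E × F → G} {x : E × F} (hf : DifferentiableAt ℝ f x) (ξ : E) :
    fderiv ℝ (fun y => f (y, x.2)) x.1 ξ = fderiv ℝ f x (ξ, 0) := by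
  have hcomp : HasFDerivAt (fun y => f (y, x.2))
      ((fderiv ℝ f x).comp (ContinuousLinearMap.inl ℝ E F)) x.1 :=
    HasFDerivAt.comp (f := fun y : E => (y, x.2)) x.1 hf.hasFDerivAt
      (hasFDerivAt_prodMk_left x.1 x.2)
  rw [hcomp.fderiv]
  rfl

end Calculus

/-! ### Plane vectors and the derivative in the control -/

section Control

variable {G : Type*} [NormedAddCommGroup G] [NormedSpace ℝ G] {F : Plane × ℝ → Plane}
  {Ω : Set (Plane × ℝ)}

theorem hasDerivAt_control {f : Plane × ℝ → G} {x : Plane × ℝ} (hf : DifferentiableAt ℝ f x) :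
    HasDerivAt (fun t => f (x.1, t)) (fderiv ℝ f x (0, 1)) x.2 :=
  HasFDerivAt.comp_hasDerivAt x.2 (f := fun t : ℝ => (x.1, t)) hf.hasFDerivAt
    ((hasDerivAt_const x.2 x.1).prodMk (hasDerivAt_id x.2))

theorem dU_eq_fderiv {x : Plane × ℝ} (hF : DifferentiableAt ℝ F x) :
    dU F x = fderiv ℝ F x (0, 1) :=
  (hasDerivAt_control hF).deriv

theorem eqOn_dU_derivAlong (hΩ : IsOpen Ω) (hF : ContDiffOn ℝ ∞ F Ω) :
    EqOn (dU F) (derivAlong (fun _ => (0, 1)) F) Ω :=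
  fun _ hx => dU_eq_fderiv (differentiableAt_of_contDiffOn hΩ hF hx)

theorem contDiffOn_dU (hΩ : IsOpen Ω) (hF : ContDiffOn ℝ ∞ F Ω) : ContDiffOn ℝ ∞ (dU F) Ω :=
  (contDiffOn_derivAlong hΩ contDiffOn_const hF).congr (eqOn_dU_derivAlong hΩ hF)

theorem fderiv_eq_horizontal_add {x : Plane × ℝ} (hF : DifferentiableAt ℝ F x) (ξ : Plane × ℝ) :
    fderiv ℝ F x ξ = fderiv ℝ F x (ξ.1, 0) + ξ.2 • dU F x := by
  rw [dU_eq_fderiv hF, ← map_smul, ← map_add]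
  congr 1
  ext1 <;> simp

theorem fderiv_vertical {x ξ : Plane × ℝ} (hF : DifferentiableAt ℝ F x) (hξ : ξ.1 = 0) :
    fderiv ℝ F x ξ = ξ.2 • dU F x := by
  rw [fderiv_eq_horizontal_add hF ξ, hξ, Prod.mk_zero_zero, map_zero, zero_add]

end Control

section Wedge

/-- The wedge product as a continuous bilinear map, which gives access to the product rule. -/
noncomputable def wedgeL : Plane →L[ℝ] Plane →L[ℝ] ℝ :=
  LinearMap.mkContinuous₂ (LinearMap.mk₂ ℝ wedge
    (by intros; simp [wedge]; ring) (by intros; simp [wedge]; ring)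
    (by intros; simp [wedge]; ring) (by intros; simp [wedge]; ring)) 2 (by
      intro a b
      have coord_le (c : Plane) (i : Fin 2) : |c i| ≤ ‖c‖ := by
        simpa using PiLp.norm_apply_le c i
      calc |a 0 * b 1 - a 1 * b 0| ≤ |a 0 * b 1| + |a 1 * b 0| := abs_sub _ _
        _ ≤ ‖a‖ * ‖b‖ + ‖a‖ * ‖b‖ := by
          rw [abs_mul, abs_mul]
          gcongr <;> exact coord_le _ _
        _ = 2 * ‖a‖ * ‖b‖ := by ring)

theorem wedgeL_apply (a b : Plane) : wedgeL a b = wedge a b := rfl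

variable {E : Type*} [NormedAddCommGroup E] [NormedSpace ℝ E]

theorem contDiffOn_wedge {Ω : Set E} {a b : E → Plane} (ha : ContDiffOn ℝ ∞ a Ω)
    (hb : ContDiffOn ℝ ∞ b Ω) : ContDiffOn ℝ ∞ (fun x => wedge (a x) (b x)) Ω :=
  (wedgeL.contDiff.comp_contDiffOn ha).clm_apply hb

theorem wedge_smul_left (r : ℝ) (a b : Plane) : wedge (r • a) b = r * wedge a b := by
  simp [wedge]; ring

theorem wedge_smul_right (r : ℝ) (a b : Plane) : wedge a (r • b) = r * wedge a b := by
  simp [wedge]; ring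

theorem wedge_add_left (a b c : Plane) : wedge (a + b) c = wedge a c + wedge b c := by
  simp [wedge]; ring

theorem wedge_add_right (a b c : Plane) : wedge a (b + c) = wedge a b + wedge a c := by
  simp [wedge]; ring

theorem wedge_sub_left (a b c : Plane) : wedge (a - b) c = wedge a c - wedge b c := by
  simp [wedge]; ring

theorem wedge_sub_right (a b c : Plane) : wedge a (b - c) = wedge a b - wedge a c := by
  simp [wedge]; ring

theorem wedge_neg_right (a b : Plane) : wedge a (-b) = -wedge a b := by
  simp [wedge]; ring

@[simp] theorem wedge_self (a : Plane) : wedge a a = 0 := by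
  simp [wedge]; ring

@[simp] theorem wedge_zero_left (a : Plane) : wedge 0 a = 0 := by
  simp [wedge]

@[simp] theorem wedge_zero_right (a : Plane) : wedge a 0 = 0 := by
  simp [wedge]

theorem wedge_smul_eq (a b c : Plane) : wedge a b • c = wedge c b • a + wedge a c • b := by
  ext i
  fin_cases i <;> simp [wedge] <;> ring

theorem eq_smul_add_smul {a b : Plane} (h : wedge a b ≠ 0) (c : Plane) :
    c = (wedge c b / wedge a b) • a + (wedge a c / wedge a b) • b := by
  rw [← smul_right_inj h, smul_add, smul_smul, smul_smul, mul_div_cancel₀ _ h,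
    mul_div_cancel₀ _ h, wedge_smul_eq]

theorem ne_zero_of_wedge_ne_zero {a b : Plane} (h : wedge a b ≠ 0) : a ≠ 0 ∧ b ≠ 0 :=
  ⟨fun ha => h (by rw [ha, wedge_zero_left]), fun hb => h (by rw [hb, wedge_zero_right])⟩

theorem clm_ext_of_wedge {G : Type*} [NormedAddCommGroup G] [NormedSpace ℝ G] {a b : Plane}
    (h : wedge a b ≠ 0) {p p' : Plane →L[ℝ] G} (ha : p a = p' a) (hb : p b = p' b) : p = p' := by
  ext c
  rw [eq_smul_add_smul h c]
  simp only [map_add, map_smul, ha, hb]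

end Wedge

/-! ### Frames described by brackets -/

/-- The vertical part of the invariant frame of `q' = F (q, u)` on an open set of pairs `(q, u)`:
a vertical field `v` and a function `b` with `D_v² F = -F - b D_v F`, which is the equation
`L_v² s = -s + b L_v s` for the dual covector. -/
structure IsNaturalField (F : Plane × ℝ → Plane) (Ω : Set (Plane × ℝ))
    (v : Plane × ℝ → Plane × ℝ) (b : Plane × ℝ → ℝ) : Prop where
  isOpen : IsOpen Ω
  smooth_F : ContDiffOn ℝ ∞ F Ω
  smooth_v : ContDiffOn ℝ ∞ v Ω
  smooth_b : ContDiffOn ℝ ∞ b Ω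
  vertical : ∀ x ∈ Ω, (v x).1 = 0
  indep : ∀ x ∈ Ω, wedge (F x) (derivAlong v F x) ≠ 0
  natural : ∀ x ∈ Ω, derivAlong v (derivAlong v F) x = -F x - b x • derivAlong v F x

/-- The invariant frame of `q' = F (q, u)` described by fields on the space of pairs `(q, u)`
only, without covectors: the Hamiltonian field is the lift `H` of `F` for which `[H, [v, H]]` is
vertical. -/
structure IsBracketFrame (F : Plane × ℝ → Plane) (Ω : Set (Plane × ℝ))
    (H v : Plane × ℝ → Plane × ℝ) (b k : Plane × ℝ → ℝ) : Prop extends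
    IsNaturalField F Ω v b where
  smooth_H : ContDiffOn ℝ ∞ H Ω
  smooth_k : ContDiffOn ℝ ∞ k Ω
  fst_H : ∀ x ∈ Ω, (H x).1 = F x
  curvature : ∀ x ∈ Ω, lieBracket ℝ H (lieBracket ℝ v H) x = k x • v x

theorem fst_lieBracket_vertical {F : Plane × ℝ → Plane} {Ω : Set (Plane × ℝ)}
    {v Y : Plane × ℝ → Plane × ℝ} (hΩ : IsOpen Ω) (hv : ContDiffOn ℝ ∞ v Ω)
    (hY : ContDiffOn ℝ ∞ Y Ω) (hv1 : ∀ x ∈ Ω, (v x).1 = 0) (hYF : ∀ x ∈ Ω, (Y x).1 = F x) :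
    EqOn (fun x => (lieBracket ℝ v Y x).1) (derivAlong v F) Ω := by
  intro x hx
  have hY0 : fderiv ℝ (fun y => (v y).1) x = 0 := fderiv_eq_zero_of_eqOn_const hΩ hv1 hx
  simp only [fst_lieBracket (differentiableAt_of_contDiffOn hΩ hv hx)
    (differentiableAt_of_contDiffOn hΩ hY hx), derivAlong, hY0, fderiv_congr_of_eqOn hΩ hYF hx,
    zero_apply, sub_zero]

namespace IsNaturalField

variable {F : Plane × ℝ → Plane} {Ω : Set (Plane × ℝ)} {v : Plane × ℝ → Plane × ℝ}
  {b : Plane × ℝ → ℝ} {x : Plane × ℝ}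

theorem smooth_derivAlong (h : IsNaturalField F Ω v b) : ContDiffOn ℝ ∞ (derivAlong v F) Ω :=
  contDiffOn_derivAlong h.isOpen h.smooth_v h.smooth_F

theorem derivAlong_eq (h : IsNaturalField F Ω v b) (hx : x ∈ Ω) :
    derivAlong v F x = (v x).2 • dU F x :=
  fderiv_vertical (differentiableAt_of_contDiffOn h.isOpen h.smooth_F hx) (h.vertical x hx)

theorem snd_ne_zero (h : IsNaturalField F Ω v b) (hx : x ∈ Ω) : (v x).2 ≠ 0 := by
  have hind := h.indep x hx
  rw [h.derivAlong_eq hx, wedge_smul_right] at hind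
  exact left_ne_zero_of_mul hind

theorem wedge_dU_ne_zero (h : IsNaturalField F Ω v b) (hx : x ∈ Ω) :
    wedge (F x) (dU F x) ≠ 0 := by
  have hind := h.indep x hx
  rw [h.derivAlong_eq hx, wedge_smul_right] at hind
  exact right_ne_zero_of_mul hind

theorem mono (h : IsNaturalField F Ω v b) {Ω' : Set (Plane × ℝ)} (hΩ' : IsOpen Ω')
    (hs : Ω' ⊆ Ω) : IsNaturalField F Ω' v b where
  isOpen := hΩ'
  smooth_F := h.smooth_F.mono hs
  smooth_v := h.smooth_v.mono hs
  smooth_b := h.smooth_b.mono hs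
  vertical := fun x hx => h.vertical x (hs hx)
  indep := fun x hx => h.indep x (hs hx)
  natural := fun x hx => h.natural x (hs hx)

end IsNaturalField

namespace IsBracketFrame

variable {F : Plane × ℝ → Plane} {Ω : Set (Plane × ℝ)} {H v : Plane × ℝ → Plane × ℝ}
  {b k : Plane × ℝ → ℝ} {x : Plane × ℝ}

theorem smooth_lieBracket (h : IsBracketFrame F Ω H v b k) :
    ContDiffOn ℝ ∞ (lieBracket ℝ v H) Ω :=
  contDiffOn_lieBracket h.isOpen h.smooth_v h.smooth_H

theorem fst_lieBracket (h : IsBracketFrame F Ω H v b k) :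
    EqOn (fun x => (lieBracket ℝ v H x).1) (derivAlong v F) Ω :=
  fst_lieBracket_vertical h.isOpen h.smooth_v h.smooth_H h.vertical h.fst_H

theorem fst_curvature (h : IsBracketFrame F Ω H v b k) (hx : x ∈ Ω) :
    derivAlong H (derivAlong v F) x = derivAlong (lieBracket ℝ v H) F x := by
  have hcurv := congrArg Prod.fst (h.curvature x hx)
  rw [_root_.fst_lieBracket (differentiableAt_of_contDiffOn h.isOpen h.smooth_H hx)
    (differentiableAt_of_contDiffOn h.isOpen h.smooth_lieBracket hx),
    derivAlong_congr h.isOpen (eqOn_refl H Ω) h.fst_lieBracket hx,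
    derivAlong_congr h.isOpen (eqOn_refl _ Ω) h.fst_H hx, Prod.smul_fst, h.vertical x hx,
    smul_zero] at hcurv
  exact sub_eq_zero.1 hcurv

end IsBracketFrame

/-! ### The dual coframe -/

section DualBasis

variable {a a' : Plane} {p p' : Coplane}

theorem wedge_ne_zero_of_dual (h : p a = 1) (h' : p a' = 0) (h₁ : p' a' = 1) :
    wedge a a' ≠ 0 := by
  intro h0
  have hwedge (c : Plane) : wedge c a' = 0 := by
    have hc := congrArg p (wedge_smul_eq a a' c)
    simpa [h0, h, h'] using hc.symm
  have ha' : a' = 0 := by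
    ext i
    fin_cases i
    · simpa [wedge, e₂] using hwedge e₂
    · simpa [wedge, e₁] using hwedge e₁
  simp [ha'] at h₁

theorem eq_of_dual (h : p a = 1) (h' : p a' = 0) (h₁ : p' a = 0) (h₁' : p' a' = 1) {c d : Plane}
    (hp : p c = p d) (hp' : p' c = p' d) : c = d := by
  have coeffs (c : Plane) : c = p c • a + p' c • a' := by
    have hc := eq_smul_add_smul (wedge_ne_zero_of_dual h h' h₁') c
    have hpc := congrArg p hc
    have hpc' := congrArg p' hc
    simp only [map_add, map_smul, h, h', h₁, h₁', smul_eq_mul, mul_one, mul_zero, add_zero,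
      zero_add] at hpc hpc'
    rw [hpc, hpc']
    exact hc
  rw [coeffs c, coeffs d, hp, hp']

end DualBasis

section DualCovector

variable {E : Type*} [NormedAddCommGroup E] [NormedSpace ℝ E] {Ω : Set E} {X : E → E}
  {F : E → Plane} {p : E → Coplane} {b : E → ℝ} {x : E}

/-- The covector field `p` is dual to the first vector of the frame `(F, D_X F)`. -/
structure IsDualCovector (Ω : Set E) (X : E → E) (F : E → Plane) (p : E → Coplane) : Prop where
  isOpen : IsOpen Ω
  smooth_X : ContDiffOn ℝ ∞ X Ω
  smooth_F : ContDiffOn ℝ ∞ F Ω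
  smooth_p : ContDiffOn ℝ ∞ p Ω
  apply_self : ∀ x ∈ Ω, p x (F x) = 1
  apply_derivAlong : ∀ x ∈ Ω, p x (derivAlong X F x) = 0

theorem derivAlong_apply_of_pairing_const (hΩ : IsOpen Ω) {c : ℝ} (hp : ContDiffOn ℝ ∞ p Ω)
    (hF : ContDiffOn ℝ ∞ F Ω) (h : ∀ x ∈ Ω, p x (F x) = c) (hx : x ∈ Ω) :
    derivAlong X p x (F x) = -p x (derivAlong X F x) :=
  fderiv_apply_of_pairing_const hΩ hp hF h hx (X x)

namespace IsDualCovector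

theorem smooth_derivAlong (h : IsDualCovector Ω X F p) : ContDiffOn ℝ ∞ (derivAlong X F) Ω :=
  contDiffOn_derivAlong h.isOpen h.smooth_X h.smooth_F

theorem smooth_derivAlong_covector (h : IsDualCovector Ω X F p) :
    ContDiffOn ℝ ∞ (derivAlong X p) Ω :=
  contDiffOn_derivAlong h.isOpen h.smooth_X h.smooth_p

theorem derivAlong_apply_self (h : IsDualCovector Ω X F p) (hx : x ∈ Ω) :
    derivAlong X p x (F x) = 0 := by
  rw [derivAlong_apply_of_pairing_const h.isOpen h.smooth_p h.smooth_F h.apply_self hx,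
    h.apply_derivAlong x hx, neg_zero]

section Covector

variable (hnat : ∀ x ∈ Ω, derivAlong X (derivAlong X p) x = -p x + b x • derivAlong X p x)
include hnat

theorem derivAlong_apply_derivAlong_of_covector (h : IsDualCovector Ω X F p) (hx : x ∈ Ω) :
    derivAlong X p x (derivAlong X F x) = 1 := by
  have hpair := derivAlong_apply_of_pairing_const (X := X) h.isOpen h.smooth_derivAlong_covector
    h.smooth_F (fun x hx => h.derivAlong_apply_self hx) hx
  rw [hnat x hx, add_apply, neg_apply, smul_apply, h.derivAlong_apply_self hx,
    h.apply_self x hx, smul_zero, add_zero] at hpair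
  exact (neg_inj.1 hpair).symm

theorem derivAlong_derivAlong_vector (h : IsDualCovector Ω X F p) (hx : x ∈ Ω) :
    derivAlong X (derivAlong X F) x = -F x - b x • derivAlong X F x := by
  have hDD {x} (hx : x ∈ Ω) := h.derivAlong_apply_derivAlong_of_covector hnat hx
  have hp : p x (derivAlong X (derivAlong X F) x) = -1 := by
    rw [← hDD hx, derivAlong_apply_of_pairing_const h.isOpen h.smooth_p h.smooth_derivAlong
      h.apply_derivAlong hx, neg_neg]
  have hDp : derivAlong X p x (derivAlong X (derivAlong X F) x) = -b x := by
    have hpair := derivAlong_apply_of_pairing_const (X := X) h.isOpen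
      h.smooth_derivAlong_covector h.smooth_derivAlong (fun x hx => hDD hx) hx
    rw [hnat x hx] at hpair
    simpa [h.apply_derivAlong x hx, hDD hx, neg_eq_iff_eq_neg] using hpair.symm
  refine eq_of_dual (h.apply_self x hx) (h.apply_derivAlong x hx) (h.derivAlong_apply_self hx)
    (hDD hx) ?_ ?_
  · rw [hp]
    simp [h.apply_self x hx, h.apply_derivAlong x hx]
  · rw [hDp]
    simp [h.derivAlong_apply_self hx, hDD hx]

end Covector

section Vector

variable (hnat : ∀ x ∈ Ω, derivAlong X (derivAlong X F) x = -F x - b x • derivAlong X F x)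
include hnat

theorem derivAlong_apply_derivAlong_of_vector (h : IsDualCovector Ω X F p) (hx : x ∈ Ω) :
    derivAlong X p x (derivAlong X F x) = 1 := by
  rw [derivAlong_apply_of_pairing_const h.isOpen h.smooth_p h.smooth_derivAlong
    h.apply_derivAlong hx, hnat x hx]
  simp [h.apply_self x hx, h.apply_derivAlong x hx]

theorem derivAlong_derivAlong_covector (h : IsDualCovector Ω X F p) (hx : x ∈ Ω) :
    derivAlong X (derivAlong X p) x = -p x + b x • derivAlong X p x := by
  have hDD {x} (hx : x ∈ Ω) := h.derivAlong_apply_derivAlong_of_vector hnat hx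
  apply clm_ext_of_wedge
    (wedge_ne_zero_of_dual (h.apply_self x hx) (h.apply_derivAlong x hx) (hDD hx))
  · rw [derivAlong_apply_of_pairing_const h.isOpen h.smooth_derivAlong_covector h.smooth_F
      (fun x hx => h.derivAlong_apply_self hx) hx, hDD hx]
    simp [h.apply_self x hx, h.derivAlong_apply_self hx]
  · rw [derivAlong_apply_of_pairing_const h.isOpen h.smooth_derivAlong_covector
      h.smooth_derivAlong (fun x hx => hDD hx) hx, hnat x hx]
    simp [h.apply_derivAlong x hx, h.derivAlong_apply_self hx, hDD hx]

end Vector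

end IsDualCovector

end DualCovector

/-! ### The symplectic description -/

section Liouville

variable {v : Plane × ℝ → Plane × ℝ} {p : Plane × ℝ → Coplane} {Ω : Set (Plane × ℝ)}

theorem lieDerivForm_liouville (hΩ : IsOpen Ω) (hv : ContDiffOn ℝ ∞ v Ω)
    (hp : ContDiffOn ℝ ∞ p Ω) (hv1 : ∀ x ∈ Ω, (v x).1 = 0) :
    EqOn (lieDerivForm v (liouville p)) (liouville (derivAlong v p)) Ω := by
  intro x hx
  have hliouville : fderiv ℝ (liouville p) x (v x) = liouville (derivAlong v p) x := by
    have hfun : liouville p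
        = fun y => (p y).comp (ContinuousLinearMap.fst ℝ Plane ℝ) := rfl
    rw [hfun, fderiv_clm_comp (differentiableAt_of_contDiffOn hΩ hp hx)
      (differentiableAt_const _)]
    ext <;> simp [liouville, derivAlong]
  have hvert (ξ : Plane × ℝ) : (fderiv ℝ v x ξ).1 = 0 := by
    rw [fst_fderiv_apply (differentiableAt_of_contDiffOn hΩ hv hx),
      fderiv_eq_zero_of_eqOn_const hΩ hv1 hx, zero_apply]
  refine ContinuousLinearMap.ext fun ξ => ?_
  rw [lieDerivForm, hliouville]
  simp [liouville, hvert]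

theorem lieDerivForm_lieDerivForm_liouville (hΩ : IsOpen Ω) (hv : ContDiffOn ℝ ∞ v Ω)
    (hp : ContDiffOn ℝ ∞ p Ω) (hv1 : ∀ x ∈ Ω, (v x).1 = 0) {x : Plane × ℝ} (hx : x ∈ Ω) :
    lieDerivForm v (lieDerivForm v (liouville p)) x
      = liouville (derivAlong v (derivAlong v p)) x := by
  have hfirst := lieDerivForm_liouville hΩ hv hp hv1
  change fderiv ℝ (lieDerivForm v (liouville p)) x (v x)
    + (lieDerivForm v (liouville p) x).comp (fderiv ℝ v x) = _
  rw [fderiv_congr_of_eqOn hΩ hfirst hx, hfirst hx]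
  exact lieDerivForm_liouville hΩ hv (contDiffOn_derivAlong hΩ hv hp) hv1 hx

theorem lieDerivForm_liouville_natural_iff {r : ℝ} (hΩ : IsOpen Ω) (hv : ContDiffOn ℝ ∞ v Ω)
    (hp : ContDiffOn ℝ ∞ p Ω) (hv1 : ∀ x ∈ Ω, (v x).1 = 0) {x : Plane × ℝ} (hx : x ∈ Ω) :
    lieDerivForm v (lieDerivForm v (liouville p)) x
        = -liouville p x + r • lieDerivForm v (liouville p) x ↔
      derivAlong v (derivAlong v p) x = -p x + r • derivAlong v p x := by
  rw [lieDerivForm_lieDerivForm_liouville hΩ hv hp hv1 hx, lieDerivForm_liouville hΩ hv hp hv1 hx]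
  simp only [liouville, ← ContinuousLinearMap.neg_comp, ← ContinuousLinearMap.smul_comp,
    ← ContinuousLinearMap.add_comp]
  refine ⟨fun h => ?_, fun h => by rw [h]⟩
  ext1 ξ
  exact congrArg (fun l => l (ξ, (0 : ℝ))) h

end Liouville

section Hamiltonian

variable {F : Plane × ℝ → Plane} {O : Set Plane} {V : Set ℝ} {x : Plane × ℝ} {p : Coplane}
  {h : Plane × Coplane → ℝ}

theorem hasDerivAt_covector_control (p : Coplane) (hF : DifferentiableAt ℝ F x) :
    HasDerivAt (fun t => p (F (x.1, t))) (p (dU F x)) x.2 := by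
  rw [dU_eq_fderiv hF]
  exact p.hasFDerivAt.comp_hasDerivAt x.2 (hasDerivAt_control hF)

theorem hasFDerivAt_fixed_control (hF : DifferentiableAt ℝ F x) (p : Coplane) :
    HasFDerivAt (fun l : Plane × Coplane => l.2 (F (l.1, x.2)))
      ((p.comp (fderiv ℝ F x)).comp ((ContinuousLinearMap.fst ℝ Plane Coplane).prod 0)
        + (ContinuousLinearMap.apply ℝ ℝ (F x)).comp (ContinuousLinearMap.snd ℝ Plane Coplane))
      (x.1, p) := by
  have hslice : HasFDerivAt (fun l : Plane × Coplane => F (l.1, x.2))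
      ((fderiv ℝ F x).comp ((ContinuousLinearMap.fst ℝ Plane Coplane).prod 0)) (x.1, p) :=
    HasFDerivAt.comp (x.1, p) (g := F) (f := fun l : Plane × Coplane => (l.1, x.2))
      hF.hasFDerivAt (hasFDerivAt_fst.prodMk (hasFDerivAt_const x.2 _))
  refine (hasFDerivAt_snd.clm_apply hslice).congr_fderiv ?_
  ext <;> simp

-- Envelope theorem: `h` touches from above the Hamiltonian of the fixed control `x.2`.
theorem fderiv_maximizedHamiltonian (hF : DifferentiableAt ℝ F x)
    (hmax : IsMaximizedHamiltonian F V x.1 x.2 p h) (hd : DifferentiableAt ℝ h (x.1, p))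
    (hval : h (x.1, p) = p (F x)) (ξ : Plane × Coplane) :
    fderiv ℝ h (x.1, p) ξ = p (fderiv ℝ F x (ξ.1, 0)) + ξ.2 (F x) := by
  obtain ⟨N, -, hN, hgreatest⟩ := hmax
  have hmin : IsLocalMin (fun l : Plane × Coplane => h l - l.2 (F (l.1, x.2))) (x.1, p) := by
    filter_upwards [hgreatest] with l hl
    rw [hval, sub_self]
    exact sub_nonneg.2 (hl.2 ⟨x.2, mem_of_mem_nhds hN, rfl⟩)
  rw [sub_eq_zero.1 (hmin.hasFDerivAt_eq_zero
    (hd.hasFDerivAt.sub (hasFDerivAt_fixed_control hF p)))]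
  simp

theorem IsMaximizedHamiltonian.apply_dU_eq_zero (hF : DifferentiableAt ℝ F x)
    (hmax : IsMaximizedHamiltonian F V x.1 x.2 p h) (hval : h (x.1, p) = p (F x)) :
    p (dU F x) = 0 := by
  obtain ⟨N, -, hN, hgreatest⟩ := hmax
  have hlocal : IsLocalMax (fun t => p (F (x.1, t))) x.2 := by
    filter_upwards [hN] with t ht
    exact (hgreatest.self_of_nhds.2 ⟨t, ht, rfl⟩).trans_eq hval
  exact hlocal.hasDerivAt_eq_zero (hasDerivAt_covector_control p hF)

theorem fderiv_graph_apply {p : Plane × ℝ → Coplane} (hp : DifferentiableAt ℝ p x)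
    (ξ : Plane × ℝ) :
    fderiv ℝ (fun y : Plane × ℝ => (y.1, p y)) x ξ = (ξ.1, fderiv ℝ p x ξ) := by
  rw [(hasFDerivAt_fst.prodMk hp.hasFDerivAt).fderiv]
  rfl

end Hamiltonian

namespace IsMovingFrame

variable {F : Plane × ℝ → Plane} {O : Set Plane} {V : Set ℝ} {p : Plane × ℝ → Coplane}
  {H v : Plane × ℝ → Plane × ℝ} {b k : Plane × ℝ → ℝ} {x : Plane × ℝ}

theorem apply_self (h : IsMovingFrame F O V p H v b k) (hx : x ∈ O ×ˢ V) : p x (F x) = 1 :=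
  have ⟨_, _, _, _, hpF, _⟩ := h.hamiltonian x hx
  hpF

theorem apply_dU (h : IsMovingFrame F O V p H v b k) (hF : DifferentiableAt ℝ F x)
    (hx : x ∈ O ×ˢ V) : p x (dU F x) = 0 := by
  obtain ⟨_, hmax, -, hval, hpF, -⟩ := h.hamiltonian x hx
  exact hmax.apply_dU_eq_zero hF (hval.trans hpF.symm)

theorem fst_H (h : IsMovingFrame F O V p H v b k) (hF : DifferentiableAt ℝ F x)
    (hp : DifferentiableAt ℝ p x) (hx : x ∈ O ×ˢ V) : (H x).1 = F x := by
  obtain ⟨g, hmax, hg, hval, hpF, hham⟩ := h.hamiltonian x hx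
  rw [SeparatingDual.eq_iff_forall_dual_eq (R := ℝ)]
  intro η
  have hη := hham (0, η)
  rw [fderiv_graph_apply hp, fderiv_maximizedHamiltonian hF hmax (hg.differentiableAt (by simp))
    (hval.trans hpF.symm)] at hη
  simpa [symplectic, Prod.mk_zero_zero] using hη

variable (hO : IsOpen O) (hV : IsOpen V) (hF : ContDiffOn ℝ ∞ F (O ×ˢ V))
  (h : IsMovingFrame F O V p H v b k)
include hO hV hF h

theorem isDualCovector : IsDualCovector (O ×ˢ V) v F p where
  isOpen := hO.prod hV
  smooth_X := h.smooth_v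
  smooth_F := hF
  smooth_p := h.smooth_p
  apply_self := fun _ hx => h.apply_self hx
  apply_derivAlong := fun x hx => by
    have hFx := differentiableAt_of_contDiffOn (hO.prod hV) hF hx
    rw [derivAlong, fderiv_vertical hFx (h.vertical x hx), map_smul, h.apply_dU hFx hx, smul_zero]

theorem isBracketFrame : IsBracketFrame F (O ×ˢ V) H v b k where
  isOpen := hO.prod hV
  smooth_F := hF
  smooth_v := h.smooth_v
  smooth_b := h.smooth_b
  vertical := h.vertical
  indep := fun x hx =>
    have hdual := h.isDualCovector hO hV hF
    wedge_ne_zero_of_dual (hdual.apply_self x hx) (hdual.apply_derivAlong x hx)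
      (hdual.derivAlong_apply_derivAlong_of_covector (fun y hy =>
        (lieDerivForm_liouville_natural_iff hdual.isOpen h.smooth_v h.smooth_p h.vertical hy).1
          (h.natural y hy)) hx)
  natural := fun _ hx =>
    have hdual := h.isDualCovector hO hV hF
    hdual.derivAlong_derivAlong_vector (fun y hy =>
      (lieDerivForm_liouville_natural_iff hdual.isOpen h.smooth_v h.smooth_p h.vertical hy).1
        (h.natural y hy)) hx
  smooth_H := h.smooth_H
  smooth_k := h.smooth_k
  fst_H := fun _ hx => h.fst_H (differentiableAt_of_contDiffOn (hO.prod hV) hF hx)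
    (differentiableAt_of_contDiffOn (hO.prod hV) h.smooth_p hx) hx
  curvature := h.curvature

end IsMovingFrame

/-! ### Existence of the maximized Hamiltonian -/

theorem isMaxOn_of_hasDerivAt_of_hasDerivAt_nonpos {f f' f'' : ℝ → ℝ} {D : Set ℝ}
    (hD : Convex ℝ D) (hf : ∀ t ∈ D, HasDerivAt f (f' t) t)
    (hf' : ∀ t ∈ D, HasDerivAt f' (f'' t) t) (hf'' : ∀ t ∈ D, f'' t ≤ 0) {c : ℝ}
    (hc : c ∈ interior D) (hcrit : f' c = 0) : IsMaxOn f D c := by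
  have hconc : ConcaveOn ℝ D f := concaveOn_of_hasDerivWithinAt2_nonpos hD
    (fun t ht => (hf t ht).continuousAt.continuousWithinAt)
    (fun t ht => (hf t (interior_subset ht)).hasDerivWithinAt)
    (fun t ht => (hf' t (interior_subset ht)).hasDerivWithinAt)
    (fun t ht => hf'' t (interior_subset ht))
  have hderiv : derivWithin (-f) (Ioi c) c = 0 := by
    rw [(hf c (interior_subset hc)).neg.hasDerivWithinAt.derivWithin (uniqueDiffWithinAt_Ioi c),
      hcrit, neg_zero]
  simpa using (hconc.neg.isMinOn_of_rightDeriv_eq_zero hc hderiv).neg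

theorem isInvertible_real_of_ne_zero {l : ℝ →L[ℝ] ℝ} (h : l 1 ≠ 0) : l.IsInvertible := by
  refine ⟨ContinuousLinearEquiv.unitsEquivAut ℝ (Units.mk0 (l 1) h), ?_⟩
  ext
  simp

section MaximizedHamiltonian

variable {F : Plane × ℝ → Plane} {O : Set Plane} {V : Set ℝ} {Ω : Set (Plane × ℝ)}
  {x : Plane × ℝ} {p : Coplane}

theorem contDiffAt_covector_apply (hF : ContDiffAt ℝ ∞ F x) :
    ContDiffAt ℝ ∞ (fun z : (Plane × Coplane) × ℝ => z.1.2 (F (z.1.1, z.2))) ((x.1, p), x.2) :=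
  contDiffAt_fst.snd.clm_apply (ContDiffAt.comp (g := F)
    (f := fun z : (Plane × Coplane) × ℝ => (z.1.1, z.2)) ((x.1, p), x.2) hF
    (contDiffAt_fst.fst.prodMk contDiffAt_snd))

theorem exists_smooth_critical_control (hΩ : IsOpen Ω) (hF : ContDiffOn ℝ ∞ F Ω) (hx : x ∈ Ω)
    (hcrit : p (dU F x) = 0) (hnondeg : p (dU (dU F) x) ≠ 0) :
    ∃ g : Plane × Coplane → ℝ, ContDiffAt ℝ ∞ g (x.1, p) ∧ g (x.1, p) = x.2 ∧
      ∀ᶠ l in 𝓝 (x.1, p), l.2 (dU F (l.1, g l)) = 0 := by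
  have hF' := contDiffOn_dU hΩ hF
  have hsmooth := contDiffAt_covector_apply (p := p) (hF'.contDiffAt (hΩ.mem_nhds hx))
  have hinv : (fderiv ℝ (fun z : (Plane × Coplane) × ℝ => z.1.2 (dU F (z.1.1, z.2)))
      ((x.1, p), x.2) ∘L .inr ℝ (Plane × Coplane) ℝ).IsInvertible := by
    apply isInvertible_real_of_ne_zero
    have hline : HasDerivAt (fun t : ℝ => ((x.1, p), t)) ((0 : Plane × Coplane), 1) x.2 :=
      (hasDerivAt_const _ _).prodMk (hasDerivAt_id _)
    have hcomp := HasFDerivAt.comp_hasDerivAt x.2 (f := fun t : ℝ => ((x.1, p), t))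
      (hsmooth.differentiableAt (by simp)).hasFDerivAt hline
    have hunique := hcomp.unique
      (hasDerivAt_covector_control p (differentiableAt_of_contDiffOn hΩ hF' hx))
    rwa [ContinuousLinearMap.comp_apply, ContinuousLinearMap.inr_apply, hunique]
  refine ⟨hsmooth.implicitFunction (by simp) hinv,
    hsmooth.contDiffAt_implicitFunction (by simp) hinv,
    hsmooth.implicitFunction_apply_self (by simp) hinv, ?_⟩
  filter_upwards [hsmooth.eventually_apply_implicitFunction (by simp) hinv] with l hl
  exact hl.trans hcrit

theorem exists_concave_neighborhood (hΩ : IsOpen Ω) (hF : ContDiffOn ℝ ∞ F Ω) (hx : x ∈ Ω)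
    (hconc : p (dU (dU F) x) < 0) :
    ∃ A ∈ 𝓝 (x.1, p), ∃ ε > 0, ∀ l ∈ A, ∀ t ∈ Metric.ball x.2 ε,
      (l.1, t) ∈ Ω ∧ l.2 (dU (dU F) (l.1, t)) < 0 := by
  have hF'' := contDiffOn_dU hΩ (contDiffOn_dU hΩ hF)
  have hdomain : ContinuousAt (fun z : (Plane × Coplane) × ℝ => (z.1.1, z.2))
      ((x.1, p), x.2) := by
    fun_prop
  have hneg := (hdomain.eventually_mem (hΩ.mem_nhds hx)).and
    ((contDiffAt_covector_apply (p := p)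
      (hF''.contDiffAt (hΩ.mem_nhds hx))).continuousAt.eventually_lt_const hconc)
  rw [nhds_prod_eq, Filter.eventually_prod_iff] at hneg
  obtain ⟨A, hA, B, hB, hAB⟩ := hneg
  obtain ⟨ε, hε, hεB⟩ := Metric.eventually_nhds_iff_ball.1 hB
  exact ⟨{l | A l}, hA, ε, hε, fun l hl t ht => hAB hl (hεB t ht)⟩

theorem exists_maximizedHamiltonian (hO : IsOpen O) (hV : IsOpen V)
    (hF : ContDiffOn ℝ ∞ F (O ×ˢ V)) (hx : x ∈ O ×ˢ V) (hcrit : p (dU F x) = 0)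
    (hconc : p (dU (dU F) x) < 0) :
    ∃ h, IsMaximizedHamiltonian F V x.1 x.2 p h ∧ ContDiffAt ℝ ∞ h (x.1, p) ∧
      h (x.1, p) = p (F x) := by
  have hΩ := hO.prod hV
  obtain ⟨g, hg, hgx, hgcrit⟩ := exists_smooth_critical_control hΩ hF hx hcrit hconc.ne
  obtain ⟨A, hA, ε, hε, hAε⟩ := exists_concave_neighborhood hΩ hF hx hconc
  refine ⟨fun l => l.2 (F (l.1, g l)), ⟨Metric.ball x.2 ε, fun t ht =>
    (hAε _ (mem_of_mem_nhds hA) t ht).1.2, Metric.ball_mem_nhds x.2 hε, ?_⟩, ?_, by simp [hgx]⟩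
  · have hgε : ∀ᶠ l in 𝓝 (x.1, p), g l ∈ Metric.ball x.2 ε := by
      apply hg.continuousAt.eventually_mem
      rw [hgx]
      exact Metric.ball_mem_nhds x.2 hε
    filter_upwards [hgcrit, hA, hgε] with l hl hlA hlε
    have hmax : IsMaxOn (fun t => l.2 (F (l.1, t))) (Metric.ball x.2 ε) (g l) :=
      isMaxOn_of_hasDerivAt_of_hasDerivAt_nonpos (convex_ball x.2 ε)
        (fun t ht => hasDerivAt_covector_control (x := (l.1, t)) l.2
          (differentiableAt_of_contDiffOn hΩ hF (hAε l hlA t ht).1))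
        (fun t ht => hasDerivAt_covector_control (x := (l.1, t)) l.2
          (differentiableAt_of_contDiffOn hΩ (contDiffOn_dU hΩ hF) (hAε l hlA t ht).1))
        (fun t ht => (hAε l hlA t ht).2.le) (by rwa [Metric.isOpen_ball.interior_eq]) hl
    exact ⟨⟨g l, hlε, rfl⟩, forall_mem_image.2 hmax⟩
  · refine ContDiffAt.comp (x.1, p) (f := fun l : Plane × Coplane => (l, g l))
      (g := fun z : (Plane × Coplane) × ℝ => z.1.2 (F (z.1.1, z.2))) ?_ (contDiffAt_id.prodMk hg)
    rw [hgx]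
    exact contDiffAt_covector_apply (hF.contDiffAt (hΩ.mem_nhds hx))

end MaximizedHamiltonian

namespace IsNaturalField

variable {F : Plane × ℝ → Plane} {Ω : Set (Plane × ℝ)} {v : Plane × ℝ → Plane × ℝ}
  {b : Plane × ℝ → ℝ} {p : Plane × ℝ → Coplane} {x : Plane × ℝ}

theorem exists_isDualCovector (h : IsNaturalField F Ω v b) : ∃ p, IsDualCovector Ω v F p :=
  ⟨fun x => (wedge (F x) (derivAlong v F x))⁻¹ • wedgeL.flip (derivAlong v F x), {
    isOpen := h.isOpen
    smooth_X := h.smooth_v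
    smooth_F := h.smooth_F
    smooth_p := ((contDiffOn_wedge h.smooth_F h.smooth_derivAlong).inv h.indep).smul
      (wedgeL.flip.contDiff.comp_contDiffOn h.smooth_derivAlong)
    apply_self := fun x hx => by simp [wedgeL_apply, h.indep x hx]
    apply_derivAlong := fun x _ => by simp [wedgeL_apply] }⟩

theorem apply_dU_eq_zero (h : IsNaturalField F Ω v b) (hp : IsDualCovector Ω v F p)
    (hx : x ∈ Ω) : p x (dU F x) = 0 := by
  have hpZ := hp.apply_derivAlong x hx
  rw [h.derivAlong_eq hx, map_smul] at hpZ
  exact (smul_eq_zero.1 hpZ).resolve_left (h.snd_ne_zero hx)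

theorem apply_dU_dU_neg (h : IsNaturalField F Ω v b) (hp : IsDualCovector Ω v F p)
    (hx : x ∈ Ω) : p x (dU (dU F) x) < 0 := by
  have hU := contDiffOn_dU h.isOpen h.smooth_F
  have hDp := derivAlong_apply_of_pairing_const (X := v) h.isOpen hp.smooth_p hU
    (fun y hy => h.apply_dU_eq_zero hp hy) hx
  rw [derivAlong, derivAlong, fderiv_vertical (differentiableAt_of_contDiffOn h.isOpen hU hx)
    (h.vertical x hx), map_smul, smul_eq_mul] at hDp
  have hone := hp.derivAlong_apply_derivAlong_of_vector h.natural hx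
  rw [h.derivAlong_eq hx, map_smul, smul_eq_mul, derivAlong, hDp] at hone
  nlinarith [sq_nonneg (v x).2, mul_self_pos.2 (h.snd_ne_zero hx)]

end IsNaturalField

namespace IsBracketFrame

variable {F : Plane × ℝ → Plane} {H v : Plane × ℝ → Plane × ℝ} {b k : Plane × ℝ → ℝ}
  {p : Plane × ℝ → Coplane}

theorem fderiv_covector_hamiltonian {Ω : Set (Plane × ℝ)} (h : IsBracketFrame F Ω H v b k)
    (hp : IsDualCovector Ω v F p) {x : Plane × ℝ} (hx : x ∈ Ω) (ξ : Plane) :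
    fderiv ℝ p x (H x) ξ = -p x (fderiv ℝ F x (ξ, 0)) := by
  have hFx := differentiableAt_of_contDiffOn h.isOpen h.smooth_F hx
  have hpU := h.apply_dU_eq_zero hp hx
  suffices hclm : fderiv ℝ p x (H x)
      = -((p x).comp ((fderiv ℝ F x).comp (ContinuousLinearMap.inl ℝ Plane ℝ))) by
    rw [hclm]
    rfl
  apply clm_ext_of_wedge (h.indep x hx)
  · rw [fderiv_apply_of_pairing_const h.isOpen hp.smooth_p h.smooth_F hp.apply_self hx,
      fderiv_eq_horizontal_add hFx, h.fst_H x hx]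
    simp [hpU]
  · have hcurv : fderiv ℝ (derivAlong v F) x (H x) = fderiv ℝ F x (lieBracket ℝ v H x) :=
      h.fst_curvature hx
    rw [fderiv_apply_of_pairing_const h.isOpen hp.smooth_p hp.smooth_derivAlong
      hp.apply_derivAlong hx, hcurv, fderiv_eq_horizontal_add hFx]
    have hfst : (lieBracket ℝ v H x).1 = derivAlong v F x := h.fst_lieBracket hx
    simp [hpU, hfst]

theorem exists_isMovingFrame {O : Set Plane} {V : Set ℝ} (hO : IsOpen O) (hV : IsOpen V)
    (h : IsBracketFrame F (O ×ˢ V) H v b k) : ∃ p, IsMovingFrame F O V p H v b k := by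
  obtain ⟨p, hp⟩ := h.exists_isDualCovector
  refine ⟨p, hp.smooth_p, h.smooth_H, h.smooth_v, h.smooth_b, h.smooth_k, fun x hx => ?_,
    h.vertical, fun x hx => ?_, h.curvature⟩
  · obtain ⟨g, hmax, hg, hval⟩ := exists_maximizedHamiltonian hO hV h.smooth_F hx
      (h.apply_dU_eq_zero hp hx) (h.apply_dU_dU_neg hp hx)
    refine ⟨g, hmax, hg, hval.trans (hp.apply_self x hx), hp.apply_self x hx, fun ξ => ?_⟩
    rw [fderiv_graph_apply (differentiableAt_of_contDiffOn h.isOpen hp.smooth_p hx),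
      fderiv_maximizedHamiltonian (differentiableAt_of_contDiffOn h.isOpen h.smooth_F hx) hmax
        (hg.differentiableAt (by simp)) hval]
    simp only [symplectic, h.fderiv_covector_hamiltonian hp hx, h.fst_H x hx]
    ring
  · exact (lieDerivForm_liouville_natural_iff h.isOpen h.smooth_v hp.smooth_p h.vertical hx).2
      (hp.derivAlong_derivAlong_covector h.natural hx)

end IsBracketFrame

/-! ### Consequences of the Jacobi identity -/

theorem wedge_swap (a b : Plane) : wedge a b = -wedge b a := by
  simp [wedge]; ring

theorem derivAlong_wedge {E : Type*} [NormedAddCommGroup E] [NormedSpace ℝ E] {X : E → E}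
    {a b : E → Plane} {x : E} (ha : DifferentiableAt ℝ a x) (hb : DifferentiableAt ℝ b x) :
    derivAlong X (fun y => wedge (a y) (b y)) x
      = wedge (derivAlong X a x) (b x) + wedge (a x) (derivAlong X b x) := by
  have hprod := fderiv_clm_apply_vec (p := fun y => wedgeL (a y))
    (wedgeL.differentiableAt.comp x ha) hb (X x)
  have hleft : fderiv ℝ (fun y => wedgeL (a y)) x = wedgeL.comp (fderiv ℝ a x) :=
    (wedgeL.hasFDerivAt.comp x ha.hasFDerivAt).fderiv
  rw [hleft, add_comm] at hprod
  exact hprod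

/-- The field `[v, [v, H]] + H + b [v, H]`. It is vertical for a natural field `v` and a lift `H`
of `F`, and its vertical part measures the derivative of `b` along `H`. -/
noncomputable def verticalDefect (H v : Plane × ℝ → Plane × ℝ) (b : Plane × ℝ → ℝ) :
    Plane × ℝ → Plane × ℝ :=
  lieBracket ℝ v (lieBracket ℝ v H) + H + fun x => b x • lieBracket ℝ v H x

section Jacobi

variable {F : Plane × ℝ → Plane} {Ω : Set (Plane × ℝ)} {H v W : Plane × ℝ → Plane × ℝ}
  {b k : Plane × ℝ → ℝ} {x : Plane × ℝ}

theorem fst_lieBracket_of_vertical_right (hΩ : IsOpen Ω) (hF : ContDiffOn ℝ ∞ F Ω)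
    (hH : ContDiffOn ℝ ∞ H Ω) (hH1 : ∀ x ∈ Ω, (H x).1 = F x) (hW : ContDiffOn ℝ ∞ W Ω)
    (hW1 : ∀ x ∈ Ω, (W x).1 = 0) (hx : x ∈ Ω) :
    (lieBracket ℝ H W x).1 = -(W x).2 • dU F x := by
  have hbracket : (lieBracket ℝ W H x).1 = derivAlong W F x :=
    fst_lieBracket_vertical hΩ hW hH hW1 hH1 hx
  rw [VectorField.lieBracket_swap, Prod.fst_neg, hbracket, derivAlong,
    fderiv_vertical (differentiableAt_of_contDiffOn hΩ hF hx) (hW1 x hx), neg_smul]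

namespace IsNaturalField

variable (h : IsNaturalField F Ω v b) (hH : ContDiffOn ℝ ∞ H Ω) (hH1 : ∀ x ∈ Ω, (H x).1 = F x)
include h hH hH1

theorem fst_lieBracket_lieBracket (hx : x ∈ Ω) :
    (lieBracket ℝ v (lieBracket ℝ v H) x).1 = -F x - b x • derivAlong v F x := by
  rw [← h.natural x hx]
  exact fst_lieBracket_vertical h.isOpen h.smooth_v (contDiffOn_lieBracket h.isOpen h.smooth_v hH)
    h.vertical (fst_lieBracket_vertical h.isOpen h.smooth_v hH h.vertical hH1) hx

omit hH1 in
theorem smooth_verticalDefect : ContDiffOn ℝ ∞ (verticalDefect H v b) Ω :=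
  have hZ := contDiffOn_lieBracket h.isOpen h.smooth_v hH
  ((contDiffOn_lieBracket h.isOpen h.smooth_v hZ).add hH).add (h.smooth_b.smul hZ)

theorem fst_verticalDefect (hx : x ∈ Ω) : (verticalDefect H v b x).1 = 0 := by
  have hZ : (lieBracket ℝ v H x).1 = derivAlong v F x :=
    fst_lieBracket_vertical h.isOpen h.smooth_v hH h.vertical hH1 hx
  simp only [verticalDefect, Pi.add_apply, Prod.fst_add, Prod.smul_fst, hZ, hH1 x hx,
    h.fst_lieBracket_lieBracket hH hH1 hx]
  abel

omit hH1 in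
theorem lieBracket_verticalDefect (hx : x ∈ Ω) :
    lieBracket ℝ H (verticalDefect H v b) x
      = lieBracket ℝ v (lieBracket ℝ H (lieBracket ℝ v H)) x
        + (derivAlong H b x • lieBracket ℝ v H x
          + b x • lieBracket ℝ H (lieBracket ℝ v H) x) := by
  have hZ := contDiffOn_lieBracket h.isOpen h.smooth_v hH
  have hvZ := contDiffOn_lieBracket h.isOpen h.smooth_v hZ
  have diff {X : Plane × ℝ → Plane × ℝ} (hX : ContDiffOn ℝ ∞ X Ω) : DifferentiableAt ℝ X x :=
    differentiableAt_of_contDiffOn h.isOpen hX hx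
  have hbZ : ContDiffOn ℝ ∞ (fun x => b x • lieBracket ℝ v H x) Ω := h.smooth_b.smul hZ
  rw [verticalDefect, VectorField.lieBracket_add_right ((diff hvZ).add (diff hH)) (diff hbZ),
    VectorField.lieBracket_add_right (diff hvZ) (diff hH),
    VectorField.lieBracket_smul_right (differentiableAt_of_contDiffOn h.isOpen h.smooth_b hx)
      (diff hZ),
    lieBracket_jacobi h.isOpen h.smooth_v hH hZ hx, VectorField.lieBracket_self,
    VectorField.lieBracket_self]
  simp only [Pi.zero_apply, add_zero, zero_add, derivAlong]

theorem fst_lieBracket_vertical_curvature (hx : x ∈ Ω) :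
    (lieBracket ℝ v (lieBracket ℝ H (lieBracket ℝ v H)) x).1
      = -(verticalDefect H v b x).2 • dU F x - derivAlong H b x • derivAlong v F x
        - b x • (lieBracket ℝ H (lieBracket ℝ v H) x).1 := by
  have hfst := congrArg Prod.fst (h.lieBracket_verticalDefect hH hx)
  have hZ : (lieBracket ℝ v H x).1 = derivAlong v F x :=
    fst_lieBracket_vertical h.isOpen h.smooth_v hH h.vertical hH1 hx
  rw [fst_lieBracket_of_vertical_right h.isOpen h.smooth_F hH hH1
    (h.smooth_verticalDefect hH) (fun y hy => h.fst_verticalDefect hH hH1 hy) hx] at hfst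
  rw [hfst]
  simp only [Prod.fst_add, Prod.smul_fst, hZ]
  abel

theorem fst_curvature_eq_zero
    (hw : ∀ x ∈ Ω, wedge (lieBracket ℝ H (lieBracket ℝ v H) x).1 (derivAlong v F x) = 0)
    (hx : x ∈ Ω) : (lieBracket ℝ H (lieBracket ℝ v H) x).1 = 0 := by
  have hY := contDiffOn_lieBracket h.isOpen hH (contDiffOn_lieBracket h.isOpen h.smooth_v hH)
  have hprod := derivAlong_wedge (X := v)
    (differentiableAt_of_contDiffOn h.isOpen hY.fst hx)
    (differentiableAt_of_contDiffOn h.isOpen h.smooth_derivAlong hx)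
  have hDY : derivAlong v (fun y => (lieBracket ℝ H (lieBracket ℝ v H) y).1) x
      = (lieBracket ℝ v (lieBracket ℝ H (lieBracket ℝ v H)) x).1 :=
    (fst_lieBracket_vertical h.isOpen h.smooth_v hY h.vertical (fun _ _ => rfl) hx).symm
  rw [derivAlong, fderiv_eq_zero_of_eqOn_const h.isOpen hw hx, hDY, h.natural x hx,
    h.fst_lieBracket_vertical_curvature hH hH1 hx] at hprod
  have hUZ : wedge (dU F x) (derivAlong v F x) = 0 := by
    rw [h.derivAlong_eq hx, wedge_smul_right, wedge_self, mul_zero]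
  simp only [wedge_sub_left, wedge_smul_left, wedge_sub_right, wedge_smul_right,
    wedge_neg_right, wedge_self, hw x hx, hUZ, zero_apply, mul_zero, sub_zero, zero_add] at hprod
  have hFY : wedge (F x) (lieBracket ℝ H (lieBracket ℝ v H) x).1 = 0 := by
    rw [wedge_swap, ← hprod]
  rw [eq_smul_add_smul (h.indep x hx) (lieBracket ℝ H (lieBracket ℝ v H) x).1, hFY, hw x hx]
  simp only [zero_div, zero_smul, add_zero]

theorem isBracketFrame_of_wedge
    (hw : ∀ x ∈ Ω, wedge (lieBracket ℝ H (lieBracket ℝ v H) x).1 (derivAlong v F x) = 0) :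
    IsBracketFrame F Ω H v b
      (fun x => (lieBracket ℝ H (lieBracket ℝ v H) x).2 / (v x).2) where
  toIsNaturalField := h
  smooth_H := hH
  smooth_k := (contDiffOn_lieBracket h.isOpen hH
    (contDiffOn_lieBracket h.isOpen h.smooth_v hH)).snd.div h.smooth_v.snd
      fun x hx => h.snd_ne_zero hx
  fst_H := hH1
  curvature := fun x hx => by
    ext1
    · rw [h.fst_curvature_eq_zero hH hH1 hw hx, Prod.smul_fst, h.vertical x hx, smul_zero]
    · rw [Prod.smul_snd, smul_eq_mul, div_mul_cancel₀ _ (h.snd_ne_zero hx)]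

end IsNaturalField

theorem IsBracketFrame.snd_verticalDefect (h : IsBracketFrame F Ω H v b k) (hx : x ∈ Ω) :
    (verticalDefect H v b x).2 = -(derivAlong H b x * (v x).2) := by
  have hY := contDiffOn_lieBracket h.isOpen h.smooth_H h.smooth_lieBracket
  have hY1 : ∀ y ∈ Ω, (lieBracket ℝ H (lieBracket ℝ v H) y).1 = 0 := fun y hy => by
    rw [h.curvature y hy, Prod.smul_fst, h.vertical y hy, smul_zero]
  have hvY : (lieBracket ℝ v (lieBracket ℝ H (lieBracket ℝ v H)) x).1 = 0 :=
    (fst_lieBracket_vertical h.isOpen h.smooth_v hY h.vertical hY1 hx).trans <| by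
      rw [derivAlong, fderiv_fun_const, Pi.zero_apply, zero_apply]
  rw [h.fst_lieBracket_vertical_curvature h.smooth_H h.fst_H hx, hY1 x hx, h.derivAlong_eq hx,
    smul_zero, sub_zero, smul_smul, ← sub_smul] at hvY
  have hcoef := (smul_eq_zero.1 hvY).resolve_right
    (ne_zero_of_wedge_ne_zero (h.wedge_dU_ne_zero hx)).2
  linarith

end Jacobi

/-! ### Existence of the frame -/

section Existence

variable {F : Plane × ℝ → Plane} {Ω : Set (Plane × ℝ)} {v : Plane × ℝ → Plane × ℝ}
  {b : Plane × ℝ → ℝ} {x : Plane × ℝ}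

theorem derivAlong_derivAlong_vertical (hΩ : IsOpen Ω) (hF : ContDiffOn ℝ ∞ F Ω)
    (hv : ContDiffOn ℝ ∞ v Ω) (hv1 : ∀ x ∈ Ω, (v x).1 = 0) (hx : x ∈ Ω) :
    derivAlong v (derivAlong v F) x
      = derivAlong v (fun y => (v y).2) x • dU F x + (v x).2 ^ 2 • dU (dU F) x := by
  have hDF : EqOn (derivAlong v F) (fun y => (v y).2 • dU F y) Ω := fun y hy =>
    fderiv_vertical (differentiableAt_of_contDiffOn hΩ hF hy) (hv1 y hy)
  have hdU := differentiableAt_of_contDiffOn hΩ (contDiffOn_dU hΩ hF) hx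
  rw [derivAlong_congr hΩ (eqOn_refl v Ω) hDF hx, derivAlong, derivAlong,
    fderiv_fun_smul (differentiableAt_of_contDiffOn hΩ hv.snd hx) hdU, add_apply, smul_apply,
    fderiv_vertical hdU (hv1 x hx), smul_smul, ← sq, add_comm]
  rfl

theorem exists_isNaturalField (hΩ : IsOpen Ω) (hF : ContDiffOn ℝ ∞ F Ω)
    (hreg : ∀ x ∈ Ω, 0 < wedge (F x) (dU F x) * wedge (dU F x) (dU (dU F) x)) :
    ∃ v b, IsNaturalField F Ω v b := by
  have hF1 := contDiffOn_dU hΩ hF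
  have hF2 := contDiffOn_dU hΩ hF1
  have hne {x} (hx : x ∈ Ω) : wedge (dU F x) (dU (dU F) x) ≠ 0 :=
    right_ne_zero_of_mul (hreg x hx).ne'
  have hpos {x} (hx : x ∈ Ω) : 0 < wedge (F x) (dU F x) / wedge (dU F x) (dU (dU F) x) := by
    rw [← mul_div_mul_right _ _ (hne hx)]
    exact div_pos (hreg x hx) (mul_self_pos.2 (hne hx))
  let c (x : Plane × ℝ) : ℝ := √(wedge (F x) (dU F x) / wedge (dU F x) (dU (dU F) x))
  let v (x : Plane × ℝ) : Plane × ℝ := (0, c x)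
  have hc : ContDiffOn ℝ ∞ c Ω :=
    ((contDiffOn_wedge hF hF1).div (contDiffOn_wedge hF1 hF2) fun x hx => hne hx).sqrt
      fun x hx => (hpos hx).ne'
  have hv : ContDiffOn ℝ ∞ v Ω := contDiffOn_const.prodMk hc
  have hZ := contDiffOn_derivAlong hΩ hv hF
  have hZ_eq {x} (hx : x ∈ Ω) : derivAlong v F x = c x • dU F x :=
    fderiv_vertical (differentiableAt_of_contDiffOn hΩ hF hx) rfl
  have hind : ∀ x ∈ Ω, wedge (F x) (derivAlong v F x) ≠ 0 := fun x hx => by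
    rw [hZ_eq hx, wedge_smul_right]
    exact mul_ne_zero (Real.sqrt_pos.2 (hpos hx)).ne' (left_ne_zero_of_mul (hreg x hx).ne')
  have hparallel {x} (hx : x ∈ Ω) :
      wedge (derivAlong v (derivAlong v F) x + F x) (derivAlong v F x) = 0 := by
    -- The normalization `c² (∂ᵤF ∧ ∂ᵤ²F) = F ∧ ∂ᵤF` makes `D_v² F + F` proportional to `D_v F`.
    have hsq : c x ^ 2 * wedge (dU F x) (dU (dU F) x) = wedge (F x) (dU F x) := by
      rw [Real.sq_sqrt (hpos hx).le, div_mul_cancel₀ _ (hne hx)]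
    rw [derivAlong_derivAlong_vertical hΩ hF hv (fun _ _ => rfl) hx, hZ_eq hx, wedge_smul_right,
      wedge_add_left, wedge_add_left, wedge_smul_left, wedge_smul_left, wedge_self,
      wedge_swap (dU (dU F) x), ← hsq]
    ring
  let b (x : Plane × ℝ) : ℝ :=
    -(wedge (F x) (derivAlong v (derivAlong v F) x + F x) / wedge (F x) (derivAlong v F x))
  refine ⟨v, b, hΩ, hF, hv, ?_, fun _ _ => rfl, hind, fun x hx => ?_⟩
  · exact ((contDiffOn_wedge hF ((contDiffOn_derivAlong hΩ hv hZ).add hF)).div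
      (contDiffOn_wedge hF hZ) hind).neg
  · have hbasis := eq_smul_add_smul (hind x hx) (derivAlong v (derivAlong v F) x + F x)
    rw [hparallel hx, zero_div, zero_smul, zero_add] at hbasis
    rw [neg_smul, ← hbasis]
    abel

theorem IsNaturalField.exists_isBracketFrame (h : IsNaturalField F Ω v b) :
    ∃ H k, IsBracketFrame F Ω H v b k := by
  set Z := derivAlong v F with hZdef
  have hZ : ContDiffOn ℝ ∞ Z Ω := h.smooth_derivAlong
  have hdiff {X : Plane × ℝ → Plane} (hX : ContDiffOn ℝ ∞ X Ω) {x} (hx : x ∈ Ω) :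
      DifferentiableAt ℝ X x := differentiableAt_of_contDiffOn h.isOpen hX hx
  have hne : ∀ x ∈ Ω, wedge (dU Z x) (Z x) ≠ 0 := fun x hx h0 => h.indep x hx <| by
    have hDZ := h.natural x hx
    rw [← hZdef, derivAlong, fderiv_vertical (hdiff hZ hx) (h.vertical x hx)] at hDZ
    have hF : F x = -(v x).2 • dU Z x - b x • Z x := by
      rw [neg_smul, hDZ]
      abel
    rw [← hZdef, hF, wedge_sub_left, wedge_smul_left, wedge_smul_left, h0, wedge_self]
    ring
  let g (x : Plane × ℝ) : ℝ :=
    -(wedge (derivAlong (fun y => (F y, 0)) Z x - derivAlong (fun y => (Z y, 0)) F x) (Z x)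
      / wedge (dU Z x) (Z x))
  have hg : ContDiffOn ℝ ∞ g Ω :=
    ((contDiffOn_wedge ((contDiffOn_derivAlong h.isOpen (h.smooth_F.prodMk contDiffOn_const)
      hZ).sub (contDiffOn_derivAlong h.isOpen (hZ.prodMk contDiffOn_const) h.smooth_F)) hZ).div
      (contDiffOn_wedge (contDiffOn_dU h.isOpen hZ) hZ) hne).neg
  let H (x : Plane × ℝ) : Plane × ℝ := (F x, g x)
  have hH : ContDiffOn ℝ ∞ H Ω := h.smooth_F.prodMk hg
  have hvH1 := fst_lieBracket_vertical h.isOpen h.smooth_v hH h.vertical fun _ _ => rfl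
  have hvH := contDiffOn_lieBracket h.isOpen h.smooth_v hH
  refine ⟨H, _, h.isBracketFrame_of_wedge hH (fun _ _ => rfl) fun x hx => ?_⟩
  have hUZ : wedge (dU F x) (Z x) = 0 := by
    rw [hZdef, h.derivAlong_eq hx, wedge_smul_right, wedge_self, mul_zero]
  have hY : (lieBracket ℝ H (lieBracket ℝ v H) x).1
      = derivAlong (fun y => (F y, 0)) Z x + g x • dU Z x
        - (derivAlong (fun y => (Z y, 0)) F x + (lieBracket ℝ v H x).2 • dU F x) := by
    rw [fst_lieBracket (differentiableAt_of_contDiffOn h.isOpen hH hx)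
      (differentiableAt_of_contDiffOn h.isOpen hvH hx),
      derivAlong_congr h.isOpen (eqOn_refl H Ω) hvH1 hx, derivAlong, derivAlong,
      fderiv_eq_horizontal_add (hdiff hZ hx), fderiv_eq_horizontal_add (hdiff h.smooth_F hx)]
    simp only [hvH1 hx]
    rfl
  have hgx : g x * wedge (dU Z x) (Z x)
      = -wedge (derivAlong (fun y => (F y, 0)) Z x - derivAlong (fun y => (Z y, 0)) F x) (Z x) := by
    rw [neg_mul, div_mul_cancel₀ _ (hne x hx)]
  rw [hY, wedge_sub_left, wedge_add_left, wedge_add_left, wedge_smul_left, wedge_smul_left, hgx,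
    ← hZdef, hUZ, wedge_sub_left]
  ring

end Existence

/-! ### Smooth diffeomorphisms between open sets -/

section Diffeo

variable {E F : Type*} [NormedAddCommGroup E] [NormedSpace ℝ E]
  [NormedAddCommGroup F] [NormedSpace ℝ F]

/-- The open partial homeomorphism `ρ` is a smooth diffeomorphism of its source onto its
target. -/
structure IsSmoothDiffeo (ρ : OpenPartialHomeomorph E F) : Prop where
  smooth : ContDiffOn ℝ ∞ ρ ρ.source
  smooth_symm : ContDiffOn ℝ ∞ ρ.symm ρ.target

namespace IsSmoothDiffeo

variable {ρ : OpenPartialHomeomorph E F} {x : E}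

theorem symm (h : IsSmoothDiffeo ρ) : IsSmoothDiffeo ρ.symm := ⟨h.smooth_symm, h.smooth⟩

theorem differentiableAt (h : IsSmoothDiffeo ρ) (hx : x ∈ ρ.source) : DifferentiableAt ℝ ρ x :=
  differentiableAt_of_contDiffOn ρ.open_source h.smooth hx

theorem fderiv_symm_fderiv (h : IsSmoothDiffeo ρ) (hx : x ∈ ρ.source) (ξ : E) :
    fderiv ℝ ρ.symm (ρ x) (fderiv ℝ ρ x ξ) = ξ := by
  have hcomp : fderiv ℝ (ρ.symm ∘ ρ) x = ContinuousLinearMap.id ℝ E := by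
    rw [fderiv_congr_of_eqOn ρ.open_source (f := ρ.symm ∘ ρ) (g := id)
      (fun y hy => ρ.left_inv hy) hx, fderiv_id]
  rw [← ContinuousLinearMap.comp_apply, ← fderiv_comp x
    (h.symm.differentiableAt (ρ.map_source hx)) (h.differentiableAt hx), hcomp,
    ContinuousLinearMap.id_apply]

theorem isInvertible_fderiv (h : IsSmoothDiffeo ρ) (hx : x ∈ ρ.source) :
    (fderiv ℝ ρ x).IsInvertible := by
  refine ContinuousLinearMap.IsInvertible.of_inverse (g := fderiv ℝ ρ.symm (ρ x)) ?_ ?_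
  · ext1 η
    have hη := h.symm.fderiv_symm_fderiv (ρ.map_source hx) η
    rwa [OpenPartialHomeomorph.symm_symm, ρ.left_inv hx] at hη
  · ext1 ξ
    exact h.fderiv_symm_fderiv hx ξ

theorem injective_fderiv (h : IsSmoothDiffeo ρ) (hx : x ∈ ρ.source) :
    Function.Injective (fderiv ℝ ρ x) :=
  Function.LeftInverse.injective (h.fderiv_symm_fderiv hx)

end IsSmoothDiffeo

variable [CompleteSpace E] {f : E → F} {Ω : Set E}

theorem isOpenMap_domRestrict_of_isInvertible (hΩ : IsOpen Ω) (hf : ContDiffOn ℝ ∞ f Ω)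
    (hinv : ∀ x ∈ Ω, (fderiv ℝ f x).IsInvertible) : IsOpenMap (Ω.domRestrict f) := by
  rw [isOpenMap_iff_nhds_le]
  rintro ⟨x, hx⟩
  obtain ⟨e, he⟩ := hinv x hx
  have hstrict := (hf.contDiffAt (hΩ.mem_nhds hx)).hasStrictFDerivAt (by simp)
  rw [← he] at hstrict
  rw [domRestrict_apply, ← hstrict.map_nhds_eq_of_equiv, domRestrict_eq, ← Filter.map_map,
    map_nhds_subtype_coe_eq_nhds hx (hΩ.mem_nhds hx)]

theorem exists_isSmoothDiffeo_of_injOn (hΩ : IsOpen Ω) (hf : ContDiffOn ℝ ∞ f Ω)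
    (hinj : InjOn f Ω) (hinv : ∀ x ∈ Ω, (fderiv ℝ f x).IsInvertible) :
    ∃ ρ : OpenPartialHomeomorph E F, IsSmoothDiffeo ρ ∧ ρ.source = Ω ∧ ⇑ρ = f := by
  let ρ : OpenPartialHomeomorph E F := OpenPartialHomeomorph.ofContinuousOpenRestrict
    (hinj.toPartialEquiv f Ω) hf.continuousOn (isOpenMap_domRestrict_of_isInvertible hΩ hf hinv) hΩ
  refine ⟨ρ, ⟨hf, fun y hy => ?_⟩, rfl, rfl⟩
  have hx : ρ.symm y ∈ Ω := ρ.map_target hy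
  obtain ⟨e, he⟩ := hinv _ hx
  refine (ρ.contDiffAt_symm (f₀' := e) hy ?_ (hf.contDiffAt (hΩ.mem_nhds hx))).contDiffWithinAt
  rw [he]
  exact (differentiableAt_of_contDiffOn hΩ hf hx).hasFDerivAt

theorem exists_isSmoothDiffeo_of_isInvertible (hΩ : IsOpen Ω) (hf : ContDiffOn ℝ ∞ f Ω)
    (hinv : ∀ x ∈ Ω, (fderiv ℝ f x).IsInvertible) {x : E} (hx : x ∈ Ω) :
    ∃ ρ : OpenPartialHomeomorph E F,
      IsSmoothDiffeo ρ ∧ x ∈ ρ.source ∧ ρ.source ⊆ Ω ∧ ⇑ρ = f := by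
  obtain ⟨e, he⟩ := hinv x hx
  have hstrict := (hf.contDiffAt (hΩ.mem_nhds hx)).hasStrictFDerivAt (by simp)
  rw [← he] at hstrict
  set ρ₀ := hstrict.toOpenPartialHomeomorph f
  obtain ⟨ρ, hρ, hsource, hcoe⟩ := exists_isSmoothDiffeo_of_injOn (Ω := Ω ∩ ρ₀.source)
    (hΩ.inter ρ₀.open_source) (hf.mono inter_subset_left) (ρ₀.injOn.mono inter_subset_right)
    (fun x hx => hinv x hx.1)
  exact ⟨ρ, hρ, hsource ▸ ⟨hx, hstrict.mem_toOpenPartialHomeomorph_source⟩,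
    hsource ▸ inter_subset_left, hcoe⟩

theorem isInvertible_of_injective {E : Type*} [NormedAddCommGroup E] [NormedSpace ℝ E]
    [FiniteDimensional ℝ E] {l : E →L[ℝ] E} (h : Function.Injective l) : l.IsInvertible :=
  ⟨(LinearEquiv.ofInjectiveEndo (l : E →ₗ[ℝ] E) h).toContinuousLinearEquiv, by ext; rfl⟩

end Diffeo

/-! ### Feedback transformations of frames -/

section Pullback

open VectorField (pullback)

variable {E : Type*} [NormedAddCommGroup E] [NormedSpace ℝ E] {Ω Ω' : Set E} {T X Y : E → E}

theorem pullback_eq_iff {y ξ : E} (hinv : (fderiv ℝ T y).IsInvertible) :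
    pullback ℝ T X y = ξ ↔ fderiv ℝ T y ξ = X (T y) := by
  rw [← VectorField.fderiv_pullback T X y hinv, hinv.injective.eq_iff, eq_comm]

theorem derivAlong_comp_pullback {G : Type*} [NormedAddCommGroup G] [NormedSpace ℝ G]
    {f : E → G} {y : E} (hinv : (fderiv ℝ T y).IsInvertible) (hT : DifferentiableAt ℝ T y)
    (hf : DifferentiableAt ℝ f (T y)) :
    derivAlong (pullback ℝ T X) (f ∘ T) y = derivAlong X f (T y) := by
  rw [derivAlong, fderiv_comp y hf hT, ContinuousLinearMap.comp_apply,
    VectorField.fderiv_pullback T X y hinv, derivAlong]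

variable [CompleteSpace E]

theorem contDiffOn_pullback (hΩ' : IsOpen Ω') (hT : ContDiffOn ℝ ∞ T Ω') (hmaps : MapsTo T Ω' Ω)
    (hinv : ∀ y ∈ Ω', (fderiv ℝ T y).IsInvertible) (hX : ContDiffOn ℝ ∞ X Ω) :
    ContDiffOn ℝ ∞ (pullback ℝ T X) Ω' :=
  ContDiffOn.clm_apply (fun y hy => (hinv y hy).contDiffAt_map_inverse.comp_contDiffWithinAt y
    (contDiffOn_fderiv hΩ' hT y hy)) (hX.comp hT hmaps)

theorem eqOn_lieBracket_pullback (hΩ : IsOpen Ω) (hΩ' : IsOpen Ω') (hT : ContDiffOn ℝ ∞ T Ω')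
    (hmaps : MapsTo T Ω' Ω) (hX : ContDiffOn ℝ ∞ X Ω) (hY : ContDiffOn ℝ ∞ Y Ω) :
    EqOn (lieBracket ℝ (pullback ℝ T X) (pullback ℝ T Y)) (pullback ℝ T (lieBracket ℝ X Y)) Ω' :=
  fun _ hy => (VectorField.pullback_lieBracket (n := ∞) minSmoothness_two_le_infty
    (hT.contDiffAt (hΩ'.mem_nhds hy)) (differentiableAt_of_contDiffOn hΩ hX (hmaps hy))
    (differentiableAt_of_contDiffOn hΩ hY (hmaps hy))).symm

end Pullback

theorem plane_eq_smul_add_smul (q : Plane) : q = q 0 • e₁ + q 1 • e₂ := by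
  ext i
  fin_cases i <;> simp [e₁, e₂]

theorem wedge_map (l : Plane →L[ℝ] Plane) (a b : Plane) :
    wedge (l a) (l b) = wedge (l e₁) (l e₂) * wedge a b := by
  have hl (c : Plane) : l c = c 0 • l e₁ + c 1 • l e₂ := by
    rw [← map_smul, ← map_smul, ← map_add, ← plane_eq_smul_add_smul]
  rw [hl a, hl b]
  simp only [wedge, PiLp.add_apply, PiLp.smul_apply, smul_eq_mul]
  ring

theorem wedge_ne_zero_of_map {l : Plane →L[ℝ] Plane} {a b : Plane}
    (h : wedge (l a) (l b) ≠ 0) : wedge a b ≠ 0 := by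
  rw [wedge_map] at h
  exact right_ne_zero_of_mul h

/-- A feedback transformation in coordinates: `T (q, w) = (ρ q, ψ (q, w))` is a diffeomorphism that
carries the system `G` to the system `F`. -/
structure IsCoordFeedback (T : OpenPartialHomeomorph (Plane × ℝ) (Plane × ℝ))
    (ρ : OpenPartialHomeomorph Plane Plane) (G F : Plane × ℝ → Plane) : Prop extends
    IsSmoothDiffeo T where
  base : IsSmoothDiffeo ρ
  mem_base : ∀ y ∈ T.source, y.1 ∈ ρ.source
  triangular : ∀ y ∈ T.source, (T y).1 = ρ y.1
  transforms : ∀ y ∈ T.source, fderiv ℝ ρ y.1 (G y) = F (T y)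

namespace IsCoordFeedback

open VectorField (pullback)

variable {T : OpenPartialHomeomorph (Plane × ℝ) (Plane × ℝ)}
  {ρ : OpenPartialHomeomorph Plane Plane} {F G : Plane × ℝ → Plane} {Ω : Set (Plane × ℝ)}
  {H v X Y : Plane × ℝ → Plane × ℝ} {b k : Plane × ℝ → ℝ} {y : Plane × ℝ}

theorem fst_fderiv (h : IsCoordFeedback T ρ G F) (hy : y ∈ T.source) (ξ : Plane × ℝ) :
    (fderiv ℝ T y ξ).1 = fderiv ℝ ρ y.1 ξ.1 := by
  have hcomp : HasFDerivAt (fun z : Plane × ℝ => ρ z.1)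
      ((fderiv ℝ ρ y.1).comp (ContinuousLinearMap.fst ℝ Plane ℝ)) y :=
    (h.base.differentiableAt (h.mem_base y hy)).hasFDerivAt.comp y hasFDerivAt_fst
  rw [fst_fderiv_apply (h.differentiableAt hy),
    fderiv_congr_of_eqOn T.open_source (g := fun z => ρ z.1) h.triangular hy, hcomp.fderiv]
  rfl

theorem fderiv_fst_pullback (h : IsCoordFeedback T ρ G F) (hy : y ∈ T.source) :
    fderiv ℝ ρ y.1 (pullback ℝ T X y).1 = (X (T y)).1 := by
  rw [← h.fst_fderiv hy, VectorField.fderiv_pullback T X y (h.isInvertible_fderiv hy)]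

theorem fst_pullback_eq_iff (h : IsCoordFeedback T ρ G F) (hy : y ∈ T.source) {a : Plane} :
    (pullback ℝ T X y).1 = a ↔ (X (T y)).1 = fderiv ℝ ρ y.1 a := by
  rw [← h.fderiv_fst_pullback hy, (h.base.injective_fderiv (h.mem_base y hy)).eq_iff]

theorem contDiffOn_pullback (h : IsCoordFeedback T ρ G F) (hmaps : MapsTo T T.source Ω)
    (hX : ContDiffOn ℝ ∞ X Ω) : ContDiffOn ℝ ∞ (pullback ℝ T X) T.source :=
  _root_.contDiffOn_pullback T.open_source h.smooth hmaps (fun _ hy => h.isInvertible_fderiv hy) hX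

theorem fst_pullback_lieBracket (h : IsCoordFeedback T ρ G F) (hΩ : IsOpen Ω)
    (hmaps : MapsTo T T.source Ω) (hX : ContDiffOn ℝ ∞ X Ω) (hY : ContDiffOn ℝ ∞ Y Ω)
    (hX1 : ∀ x ∈ Ω, (X x).1 = 0) {g : Plane × ℝ → Plane}
    (hg : ∀ y ∈ T.source, (pullback ℝ T Y y).1 = g y) :
    EqOn (fun y => (pullback ℝ T (lieBracket ℝ X Y) y).1) (derivAlong (pullback ℝ T X) g)
      T.source := by
  intro y hy
  have hvert (z) (hz : z ∈ T.source) : (pullback ℝ T X z).1 = 0 := by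
    rw [h.fst_pullback_eq_iff hz, hX1 _ (hmaps hz), map_zero]
  have hbracket := eqOn_lieBracket_pullback hΩ T.open_source h.smooth hmaps hX hY hy
  rw [← fst_lieBracket_vertical T.open_source (h.contDiffOn_pullback hmaps hX)
    (h.contDiffOn_pullback hmaps hY) hvert hg hy]
  exact congrArg Prod.fst hbracket.symm

theorem fst_pullback_lift (h : IsCoordFeedback T ρ G F) (hmaps : MapsTo T T.source Ω)
    (hH : ∀ x ∈ Ω, (H x).1 = F x) (hy : y ∈ T.source) : (pullback ℝ T H y).1 = G y := by
  rw [h.fst_pullback_eq_iff hy, hH _ (hmaps hy), h.transforms y hy]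

theorem fst_pullback_bracket (h : IsCoordFeedback T ρ G F) (hmaps : MapsTo T T.source Ω)
    (hF : IsBracketFrame F Ω H v b k) :
    EqOn (fun y => (pullback ℝ T (lieBracket ℝ v H) y).1) (derivAlong (pullback ℝ T v) G)
      T.source :=
  h.fst_pullback_lieBracket hF.isOpen hmaps hF.smooth_v hF.smooth_H hF.vertical
    fun _ hy => h.fst_pullback_lift hmaps hF.fst_H hy

theorem fderiv_derivAlong_pullback (h : IsCoordFeedback T ρ G F) (hmaps : MapsTo T T.source Ω)
    (hF : IsBracketFrame F Ω H v b k) (hy : y ∈ T.source) :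
    fderiv ℝ ρ y.1 (derivAlong (pullback ℝ T v) G y) = derivAlong v F (T y) := by
  rw [← h.fst_pullback_bracket hmaps hF hy, h.fderiv_fst_pullback hy]
  exact hF.fst_lieBracket (hmaps hy)

theorem fderiv_derivAlong_derivAlong_pullback (h : IsCoordFeedback T ρ G F)
    (hmaps : MapsTo T T.source Ω) (hF : IsBracketFrame F Ω H v b k) (hy : y ∈ T.source) :
    fderiv ℝ ρ y.1 (derivAlong (pullback ℝ T v) (derivAlong (pullback ℝ T v) G) y)
      = derivAlong v (derivAlong v F) (T y) := by
  rw [← h.fst_pullback_lieBracket hF.isOpen hmaps hF.smooth_v hF.smooth_lieBracket hF.vertical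
    (fun _ hz => h.fst_pullback_bracket hmaps hF hz) hy, h.fderiv_fst_pullback hy]
  exact fst_lieBracket_vertical hF.isOpen hF.smooth_v hF.smooth_lieBracket hF.vertical
    (fun _ hx => hF.fst_lieBracket hx) (hmaps hy)

theorem isNaturalField (h : IsCoordFeedback T ρ G F) (hmaps : MapsTo T T.source Ω)
    (hF : IsBracketFrame F Ω H v b k) :
    IsNaturalField G T.source (pullback ℝ T v) (b ∘ T) where
  isOpen := T.open_source
  smooth_F := (h.contDiffOn_pullback hmaps hF.smooth_H).fst.congr fun _ hy =>
    (h.fst_pullback_lift hmaps hF.fst_H hy).symm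
  smooth_v := h.contDiffOn_pullback hmaps hF.smooth_v
  smooth_b := hF.smooth_b.comp h.smooth hmaps
  vertical := fun y hy => by rw [h.fst_pullback_eq_iff hy, hF.vertical _ (hmaps hy), map_zero]
  indep := fun y hy => by
    apply wedge_ne_zero_of_map (l := fderiv ℝ ρ y.1)
    rw [h.transforms y hy, h.fderiv_derivAlong_pullback hmaps hF hy]
    exact hF.indep _ (hmaps hy)
  natural := fun y hy => by
    apply h.base.injective_fderiv (h.mem_base y hy)
    rw [h.fderiv_derivAlong_derivAlong_pullback hmaps hF hy, hF.natural _ (hmaps hy), map_sub,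
      map_neg, map_smul, h.transforms y hy, h.fderiv_derivAlong_pullback hmaps hF hy,
      Function.comp_apply]

theorem isBracketFrame (h : IsCoordFeedback T ρ G F) (hmaps : MapsTo T T.source Ω)
    (hF : IsBracketFrame F Ω H v b k) :
    IsBracketFrame G T.source (pullback ℝ T H) (pullback ℝ T v) (b ∘ T) (k ∘ T) where
  toIsNaturalField := h.isNaturalField hmaps hF
  smooth_H := h.contDiffOn_pullback hmaps hF.smooth_H
  smooth_k := hF.smooth_k.comp h.smooth hmaps
  fst_H := fun y hy => h.fst_pullback_lift hmaps hF.fst_H hy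
  curvature := fun y hy => by
    have hinv := h.isInvertible_fderiv hy
    have hZ := eqOn_lieBracket_pullback hF.isOpen T.open_source h.smooth hmaps hF.smooth_v
      hF.smooth_H
    have hHZ := eqOn_lieBracket_pullback hF.isOpen T.open_source h.smooth hmaps hF.smooth_H
      hF.smooth_lieBracket hy
    have hfst := fderiv_congr_of_eqOn T.open_source hZ hy
    rw [lieBracket] at hHZ ⊢
    rw [hZ hy, hfst, hHZ, pullback_eq_iff hinv, map_smul, VectorField.fderiv_pullback T v y hinv,
      hF.curvature _ (hmaps hy), Function.comp_apply]

theorem derivAlong_comp_pullback (h : IsCoordFeedback T ρ G F) (hmaps : MapsTo T T.source Ω)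
    (hF : IsBracketFrame F Ω H v b k) (hy : y ∈ T.source) :
    derivAlong (pullback ℝ T H) (b ∘ T) y = derivAlong H b (T y) :=
  _root_.derivAlong_comp_pullback (h.isInvertible_fderiv hy) (h.differentiableAt hy)
    (differentiableAt_of_contDiffOn hF.isOpen hF.smooth_b (hmaps hy))

end IsCoordFeedback

/-! ### Commuting systems -/

/-- The control `u` of the system `q' = F (q, u)` is such that the horizontal fields `F` and
`∂F/∂u` commute; this is `Commuting` for a set of pairs `(q, u)` that need not be a product. -/
def CommutesOn (F : Plane × ℝ → Plane) (Ω : Set (Plane × ℝ)) : Prop :=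
  ∀ x ∈ Ω, fderiv ℝ (dU F) x (F x, 0) = fderiv ℝ F x (dU F x, 0)

section Commuting

variable {F : Plane × ℝ → Plane} {Ω Ω' : Set (Plane × ℝ)} {H v H' v' : Plane × ℝ → Plane × ℝ}
  {b k b' k' : Plane × ℝ → ℝ} {x : Plane × ℝ}

theorem CommutesOn.mono (h : CommutesOn F Ω) (hs : Ω' ⊆ Ω) : CommutesOn F Ω' :=
  fun x hx => h x (hs hx)

theorem commuting_iff_commutesOn {O : Set Plane} {V : Set ℝ} (hO : IsOpen O) (hV : IsOpen V)
    (hF : ContDiffOn ℝ ∞ F (O ×ˢ V)) : Commuting F O V ↔ CommutesOn F (O ×ˢ V) := by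
  have hΩ := hO.prod hV
  have hslice {q : Plane} {u : ℝ} (hx : (q, u) ∈ O ×ˢ V) :
      lieBracket ℝ (fun y => F (y, u)) (fun y => dU F (y, u)) q
        = fderiv ℝ (dU F) (q, u) (F (q, u), 0) - fderiv ℝ F (q, u) (dU F (q, u), 0) := by
    rw [lieBracket,
      fderiv_partial_fst (differentiableAt_of_contDiffOn hΩ (contDiffOn_dU hΩ hF) hx),
      fderiv_partial_fst (differentiableAt_of_contDiffOn hΩ hF hx)]
  constructor
  · rintro h ⟨q, u⟩ hx
    rw [← sub_eq_zero, ← hslice hx]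
    exact h q hx.1 u hx.2
  · intro h q hq u hu
    rw [hslice ⟨hq, hu⟩, h _ ⟨hq, hu⟩, sub_self]

namespace IsNaturalField

theorem sq_snd_mul_wedge_dU (h : IsNaturalField F Ω v b) (hx : x ∈ Ω) :
    (v x).2 ^ 2 * wedge (dU F x) (dU (dU F) x) = wedge (F x) (dU F x) := by
  have hnat := congrArg (wedge (dU F x))
    ((derivAlong_derivAlong_vertical h.isOpen h.smooth_F h.smooth_v h.vertical hx).symm.trans
      (h.natural x hx))
  simp only [h.derivAlong_eq hx, wedge_add_right, wedge_sub_right, wedge_smul_right, wedge_self,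
    wedge_neg_right, mul_zero, zero_add, sub_zero] at hnat
  rw [hnat, wedge_swap, neg_neg]

theorem wedge_dU_dU_ne_zero (h : IsNaturalField F Ω v b) (hx : x ∈ Ω) :
    wedge (dU F x) (dU (dU F) x) ≠ 0 := by
  have hind := h.wedge_dU_ne_zero hx
  rw [← h.sq_snd_mul_wedge_dU hx] at hind
  exact right_ne_zero_of_mul hind

theorem sq_snd_eq (h : IsNaturalField F Ω v b) (h' : IsNaturalField F Ω v' b') (hx : x ∈ Ω) :
    (v x).2 ^ 2 = (v' x).2 ^ 2 :=
  mul_right_cancel₀ (h.wedge_dU_dU_ne_zero hx)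
    ((h.sq_snd_mul_wedge_dU hx).trans (h'.sq_snd_mul_wedge_dU hx).symm)

end IsNaturalField

theorem eq_zero_of_smul_add_smul_eq_zero {a a' : Plane} {r s : ℝ} (h : wedge a a' ≠ 0)
    (hrs : r • a + s • a' = 0) : r = 0 ∧ s = 0 := by
  have hr := congrArg (fun c => wedge c a') hrs
  have hs := congrArg (wedge a) hrs
  simp only [wedge_add_left, wedge_smul_left, wedge_self, mul_zero, add_zero,
    wedge_zero_left] at hr
  simp only [wedge_add_right, wedge_smul_right, wedge_self, mul_zero, zero_add,
    wedge_zero_right] at hs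
  exact ⟨(mul_eq_zero.1 hr).resolve_right h, (mul_eq_zero.1 hs).resolve_right h⟩

namespace IsBracketFrame

variable (h : IsBracketFrame F Ω H v b k) (hcomm : CommutesOn F Ω)

include h hcomm

theorem snd_lift_eq_zero_and_derivAlong_snd (hx : x ∈ Ω) :
    (H x).2 = 0 ∧ derivAlong H (fun y => (v y).2) x = (lieBracket ℝ v H x).2 := by
  have hFd := differentiableAt_of_contDiffOn h.isOpen h.smooth_F hx
  have hUd := differentiableAt_of_contDiffOn h.isOpen (contDiffOn_dU h.isOpen h.smooth_F) hx
  have hvd := differentiableAt_of_contDiffOn h.isOpen h.smooth_v.snd hx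
  have hleft : derivAlong H (derivAlong v F) x
      = derivAlong H (fun y => (v y).2) x • dU F x
        + (v x).2 • (fderiv ℝ (dU F) x (F x, 0) + (H x).2 • dU (dU F) x) := by
    rw [derivAlong_congr h.isOpen (eqOn_refl H Ω) (fun y hy => h.derivAlong_eq hy) hx, derivAlong,
      fderiv_fun_smul hvd hUd, ← h.fst_H x hx, ← fderiv_eq_horizontal_add hUd, add_comm]
    rfl
  have hright : derivAlong (lieBracket ℝ v H) F x
      = (v x).2 • fderiv ℝ F x (dU F x, 0) + (lieBracket ℝ v H x).2 • dU F x := by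
    have hZ1 : (lieBracket ℝ v H x).1 = (v x).2 • dU F x :=
      (h.fst_lieBracket hx).trans (h.derivAlong_eq hx)
    rw [derivAlong, fderiv_eq_horizontal_add hFd, hZ1, ← map_smul, Prod.smul_mk, smul_zero]
  have hcurv := h.fst_curvature hx
  rw [hleft, hright, hcomm x hx, ← sub_eq_zero] at hcurv
  obtain ⟨hsub, hmul⟩ := eq_zero_of_smul_add_smul_eq_zero (h.wedge_dU_dU_ne_zero hx)
    (r := derivAlong H (fun y => (v y).2) x - (lieBracket ℝ v H x).2) (s := (v x).2 * (H x).2)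
    (by rw [← hcurv]; module)
  exact ⟨(mul_eq_zero.1 hmul).resolve_left (h.snd_ne_zero hx), sub_eq_zero.1 hsub⟩

theorem snd_lift_eq_zero (hx : x ∈ Ω) : (H x).2 = 0 :=
  (h.snd_lift_eq_zero_and_derivAlong_snd hcomm hx).1

theorem snd_lieBracket_eq_zero (hx : x ∈ Ω) : (lieBracket ℝ v H x).2 = 0 := by
  have hsnd := snd_lieBracket (differentiableAt_of_contDiffOn h.isOpen h.smooth_v hx)
    (differentiableAt_of_contDiffOn h.isOpen h.smooth_H hx)
  rw [(h.snd_lift_eq_zero_and_derivAlong_snd hcomm hx).2, derivAlong,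
    fderiv_eq_zero_of_eqOn_const h.isOpen (fun y hy => h.snd_lift_eq_zero hcomm hy) hx,
    zero_apply] at hsnd
  linarith

theorem curvature_eq_zero (hx : x ∈ Ω) : k x = 0 := by
  have hsnd := snd_lieBracket (differentiableAt_of_contDiffOn h.isOpen h.smooth_H hx)
    (differentiableAt_of_contDiffOn h.isOpen h.smooth_lieBracket hx)
  rw [h.curvature x hx, derivAlong, derivAlong,
    fderiv_eq_zero_of_eqOn_const h.isOpen (fun y hy => h.snd_lieBracket_eq_zero hcomm hy) hx,
    fderiv_eq_zero_of_eqOn_const h.isOpen (fun y hy => h.snd_lift_eq_zero hcomm hy) hx,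
    zero_apply, zero_apply, sub_zero, Prod.smul_snd] at hsnd
  exact (smul_eq_zero.1 hsnd).resolve_right (h.snd_ne_zero hx)

theorem derivAlong_b_eq_zero (hv : ∀ x ∈ Ω, (v x).2 ^ 2 = 1) (hx : x ∈ Ω) :
    derivAlong H b x = 0 := by
  have hvd := differentiableAt_of_contDiffOn h.isOpen h.smooth_v.snd hx
  have hdv : fderiv ℝ (fun y => (v y).2) x = 0 := by
    have hsq := fderiv_eq_zero_of_eqOn_const h.isOpen hv hx
    rw [fderiv_fun_pow 2 hvd] at hsq
    simpa [h.snd_ne_zero hx] using hsq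
  have hZZ : (lieBracket ℝ v (lieBracket ℝ v H) x).2 = 0 := by
    rw [snd_lieBracket (differentiableAt_of_contDiffOn h.isOpen h.smooth_v hx)
      (differentiableAt_of_contDiffOn h.isOpen h.smooth_lieBracket hx), derivAlong, derivAlong,
      fderiv_eq_zero_of_eqOn_const h.isOpen (fun y hy => h.snd_lieBracket_eq_zero hcomm hy) hx,
      hdv, zero_apply, zero_apply, sub_zero]
  have hdefect := h.snd_verticalDefect hx
  simp only [verticalDefect, Pi.add_apply, Prod.snd_add, Prod.smul_snd, hZZ,
    h.snd_lift_eq_zero hcomm hx, h.snd_lieBracket_eq_zero hcomm hx, smul_zero, add_zero] at hdefect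
  exact (mul_eq_zero.1 (neg_eq_zero.1 hdefect.symm)).resolve_right (h.snd_ne_zero hx)

end IsBracketFrame

theorem lieBracket_control_horizontal {K : Plane × ℝ → Plane} (hΩ : IsOpen Ω)
    (hK : ContDiffOn ℝ ∞ K Ω) :
    EqOn (lieBracket ℝ (fun _ => ((0 : Plane), (1 : ℝ))) (fun x => (K x, (0 : ℝ))))
      (fun x => (dU K x, 0)) Ω := by
  intro x hx
  have hKs : ContDiffOn ℝ ∞ (fun x => (K x, (0 : ℝ))) Ω := hK.prodMk contDiffOn_const
  ext1
  · exact (fst_lieBracket_vertical hΩ contDiffOn_const hKs (fun _ _ => rfl) (fun _ _ => rfl)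
      hx).trans (eqOn_dU_derivAlong hΩ hK hx).symm
  · rw [snd_lieBracket (differentiableAt_const _) (differentiableAt_of_contDiffOn hΩ hKs hx)]
    simp [derivAlong]

theorem lieBracket_horizontal {K L : Plane × ℝ → Plane} (hΩ : IsOpen Ω)
    (hK : ContDiffOn ℝ ∞ K Ω) (hL : ContDiffOn ℝ ∞ L Ω) (hx : x ∈ Ω) :
    lieBracket ℝ (fun x => (K x, (0 : ℝ))) (fun x => (L x, (0 : ℝ))) x
      = (fderiv ℝ L x (K x, 0) - fderiv ℝ K x (L x, 0), 0) := by
  have hKd := differentiableAt_of_contDiffOn hΩ (hK.prodMk (contDiffOn_const (c := (0 : ℝ)))) hx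
  have hLd := differentiableAt_of_contDiffOn hΩ (hL.prodMk (contDiffOn_const (c := (0 : ℝ)))) hx
  ext1
  · exact fst_lieBracket hKd hLd
  · rw [snd_lieBracket hKd hLd]
    simp [derivAlong]

theorem IsNaturalField.isBracketFrame_of_commutesOn
    (h : IsNaturalField F Ω (fun _ => (0, 1)) b) (hcomm : CommutesOn F Ω) :
    IsBracketFrame F Ω (fun x => (F x, 0)) (fun _ => (0, 1)) b (fun _ => 0) where
  toIsNaturalField := h
  smooth_H := h.smooth_F.prodMk contDiffOn_const
  smooth_k := contDiffOn_const
  fst_H := fun _ _ => rfl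
  curvature := fun x hx => by
    have hZ := lieBracket_control_horizontal h.isOpen h.smooth_F
    have hU := contDiffOn_dU h.isOpen h.smooth_F
    rw [lieBracket, hZ hx, fderiv_congr_of_eqOn h.isOpen hZ hx]
    refine (lieBracket_horizontal h.isOpen h.smooth_F hU hx).trans ?_
    rw [hcomm x hx, sub_self, zero_smul, Prod.mk_zero_zero]

theorem IsNaturalControl.exists_isBracketFrame {O : Set Plane} {V : Set ℝ} (hO : IsOpen O)
    (hV : IsOpen V) (hF : ContDiffOn ℝ ∞ F (O ×ˢ V)) (h : IsNaturalControl F O V) :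
    ∃ H b k, IsBracketFrame F (O ×ˢ V) H (fun _ => (0, 1)) b k := by
  obtain ⟨p, H, b, k, hframe⟩ := h
  exact ⟨H, b, k, hframe.isBracketFrame hO hV hF⟩

theorem IsNaturalField.isNaturalControl_of_commutesOn {O : Set Plane} {V : Set ℝ}
    (hO : IsOpen O) (hV : IsOpen V) (h : IsNaturalField F (O ×ˢ V) (fun _ => (0, 1)) b)
    (hcomm : CommutesOn F (O ×ˢ V)) : IsNaturalControl F O V := by
  obtain ⟨p, hp⟩ := (h.isBracketFrame_of_commutesOn hcomm).exists_isMovingFrame hO hV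
  exact ⟨p, _, b, _, hp⟩

end Commuting

/-! ### Natural control of flat systems -/

section FlatSystems

theorem fderiv_form_sub_swap {E G : Type*} [NormedAddCommGroup E] [NormedSpace ℝ E]
    [NormedAddCommGroup G] [NormedSpace ℝ G] {Ω : Set E} {θ : E → E →L[ℝ] G} {X Y : E → E}
    {r s : G} (hΩ : IsOpen Ω) (hθ : ContDiffOn ℝ ∞ θ Ω) (hX : ContDiffOn ℝ ∞ X Ω)
    (hY : ContDiffOn ℝ ∞ Y Ω) (hr : ∀ x ∈ Ω, θ x (X x) = r) (hs : ∀ x ∈ Ω, θ x (Y x) = s)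
    {x : E} (hx : x ∈ Ω) :
    fderiv ℝ θ x (X x) (Y x) - fderiv ℝ θ x (Y x) (X x) = -θ x (lieBracket ℝ X Y x) := by
  rw [fderiv_apply_of_pairing_const hΩ hθ hY hs hx, fderiv_apply_of_pairing_const hΩ hθ hX hr hx,
    lieBracket, map_sub]
  abel

namespace IsBracketFrame

variable {F : Plane × ℝ → Plane} {Ω : Set (Plane × ℝ)} {H v : Plane × ℝ → Plane × ℝ}
  {b k : Plane × ℝ → ℝ} {x : Plane × ℝ}

theorem lieBracket_lieBracket_of_derivAlong_b_eq_zero (h : IsBracketFrame F Ω H v b k)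
    (hb : ∀ x ∈ Ω, derivAlong H b x = 0) (hx : x ∈ Ω) :
    lieBracket ℝ v (lieBracket ℝ v H) x = -H x - b x • lieBracket ℝ v H x := by
  have hdefect : verticalDefect H v b x = 0 := by
    ext1
    · exact h.toIsNaturalField.fst_verticalDefect h.smooth_H h.fst_H hx
    · rw [h.snd_verticalDefect hx, hb x hx, zero_mul, neg_zero, Prod.snd_zero]
  have hsum : lieBracket ℝ v (lieBracket ℝ v H) x + (H x + b x • lieBracket ℝ v H x) = 0 := by
    rw [← hdefect, ← add_assoc]
    rfl
  rw [eq_neg_of_add_eq_zero_left hsum, neg_add, sub_eq_add_neg]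

theorem exists_dual_form (h : IsBracketFrame F Ω H v b k) :
    ∃ θ : Plane × ℝ → Plane × ℝ →L[ℝ] ℝ, ContDiffOn ℝ ∞ θ Ω ∧
      (∀ x ∈ Ω, θ x (H x) = 0) ∧ (∀ x ∈ Ω, θ x (lieBracket ℝ v H x) = 0) ∧
      ∀ x ∈ Ω, θ x (v x) = 1 := by
  obtain ⟨p, hp⟩ := h.exists_isDualCovector
  let π := ContinuousLinearMap.fst ℝ Plane ℝ
  have hZ := h.smooth_lieBracket
  refine ⟨fun x => (v x).2⁻¹ • (ContinuousLinearMap.snd ℝ Plane ℝ - (H x).2 • (p x).comp π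
    - (lieBracket ℝ v H x).2 • (derivAlong v p x).comp π), ?_, fun x hx => ?_, fun x hx => ?_,
    fun x hx => ?_⟩
  · exact (h.smooth_v.snd.inv fun x hx => h.snd_ne_zero hx).smul
      ((contDiffOn_const.sub (h.smooth_H.snd.smul (hp.smooth_p.clm_comp contDiffOn_const))).sub
        (hZ.snd.smul (hp.smooth_derivAlong_covector.clm_comp contDiffOn_const)))
  · simp [π, h.fst_H x hx, hp.apply_self x hx, hp.derivAlong_apply_self hx]
  · have hfst : (lieBracket ℝ v H x).1 = derivAlong v F x := h.fst_lieBracket hx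
    simp [π, hfst, hp.apply_derivAlong x hx,
      hp.derivAlong_apply_derivAlong_of_vector h.natural hx]
  · simp [π, h.vertical x hx, h.snd_ne_zero hx]

theorem exists_eq_smul_add_smul_add_smul (h : IsBracketFrame F Ω H v b k) (hx : x ∈ Ω)
    (ξ : Plane × ℝ) : ∃ r s t : ℝ, ξ = r • H x + s • lieBracket ℝ v H x + t • v x := by
  have hfst : (lieBracket ℝ v H x).1 = derivAlong v F x := h.fst_lieBracket hx
  have hv := h.snd_ne_zero hx
  refine ⟨wedge ξ.1 (derivAlong v F x) / wedge (F x) (derivAlong v F x),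
    wedge (F x) ξ.1 / wedge (F x) (derivAlong v F x),
    (ξ.2 - wedge ξ.1 (derivAlong v F x) / wedge (F x) (derivAlong v F x) * (H x).2
      - wedge (F x) ξ.1 / wedge (F x) (derivAlong v F x) * (lieBracket ℝ v H x).2) / (v x).2, ?_⟩
  ext1
  · simp only [Prod.fst_add, Prod.smul_fst, h.fst_H x hx, h.vertical x hx, hfst, smul_zero,
      add_zero]
    exact eq_smul_add_smul (h.indep x hx) ξ.1
  · simp only [Prod.snd_add, Prod.smul_snd, smul_eq_mul, div_mul_cancel₀ _ hv]
    ring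

section Flat

variable (hk : ∀ x ∈ Ω, k x = 0) (hb : ∀ x ∈ Ω, derivAlong H b x = 0)
include hk hb

-- When `k` and `D_H b` vanish, `H` and `[v, H]` span an integrable distribution preserved by `v`,
-- so the form dual to `v` is closed.
theorem exists_closed_dual_form (h : IsBracketFrame F Ω H v b k) :
    ∃ θ : Plane × ℝ → Plane × ℝ →L[ℝ] ℝ, ContDiffOn ℝ ∞ θ Ω ∧
      (∀ x ∈ Ω, θ x (H x) = 0 ∧ θ x (v x) = 1) ∧
      ∀ x ∈ Ω, ∀ ξ η, fderiv ℝ θ x ξ η = fderiv ℝ θ x η ξ := by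
  obtain ⟨θ, hθ, hH, hZ, hv⟩ := h.exists_dual_form
  refine ⟨θ, hθ, fun x hx => ⟨hH x hx, hv x hx⟩, fun x hx ξ η => ?_⟩
  have hvH := fderiv_form_sub_swap h.isOpen hθ h.smooth_v h.smooth_H hv hH hx
  have hHZ := fderiv_form_sub_swap h.isOpen hθ h.smooth_H h.smooth_lieBracket hH hZ hx
  have hvZ := fderiv_form_sub_swap h.isOpen hθ h.smooth_v h.smooth_lieBracket hv hZ hx
  rw [hZ x hx, neg_zero] at hvH
  rw [h.curvature x hx, hk x hx, zero_smul, map_zero, neg_zero] at hHZ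
  rw [h.lieBracket_lieBracket_of_derivAlong_b_eq_zero hb hx, map_sub, map_neg, map_smul, hH x hx,
    hZ x hx, neg_zero, smul_zero, sub_zero, neg_zero] at hvZ
  obtain ⟨r, s, t, rfl⟩ := h.exists_eq_smul_add_smul_add_smul hx ξ
  obtain ⟨r', s', t', rfl⟩ := h.exists_eq_smul_add_smul_add_smul hx η
  simp only [map_add, map_smul, add_apply, smul_apply, smul_eq_mul]
  linear_combination (t * r' - r * t') * hvH + (r * s' - s * r') * hHZ + (t * s' - s * t') * hvZ

theorem exists_first_integral (h : IsBracketFrame F Ω H v b k) (hx : x ∈ Ω) :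
    ∃ (B : Set (Plane × ℝ)) (ψ : Plane × ℝ → ℝ), IsOpen B ∧ x ∈ B ∧ B ⊆ Ω ∧
      ContDiffOn ℝ ∞ ψ B ∧ ∀ y ∈ B, fderiv ℝ ψ y (H y) = 0 ∧ fderiv ℝ ψ y (v y) = 1 := by
  obtain ⟨θ, hθ, hval, hsymm⟩ := h.exists_closed_dual_form hk hb
  obtain ⟨ε, hε, hball⟩ := Metric.isOpen_iff.1 h.isOpen x hx
  obtain ⟨ψ, hψ⟩ := (convex_ball x ε).exists_forall_hasFDerivAt_of_fderiv_symmetric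
    Metric.isOpen_ball (fun y hy => (differentiableAt_of_contDiffOn h.isOpen hθ
      (hball hy)).differentiableWithinAt) (fun y hy => hsymm y (hball hy))
  refine ⟨Metric.ball x ε, ψ, Metric.isOpen_ball, Metric.mem_ball_self hε, hball, ?_,
    fun y hy => ?_⟩
  · rw [contDiffOn_infty_iff_fderiv_of_isOpen Metric.isOpen_ball]
    exact ⟨fun y hy => (hψ y hy).differentiableAt.differentiableWithinAt,
      (hθ.mono hball).congr fun y hy => (hψ y hy).fderiv⟩
  · rw [(hψ y hy).fderiv]
    exact hval y (hball hy)

end Flat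

theorem congr (h : IsBracketFrame F Ω H v b k) {H' v' : Plane × ℝ → Plane × ℝ}
    (hH : EqOn H' H Ω) (hv : EqOn v' v Ω) : IsBracketFrame F Ω H' v' b k := by
  have hDv := derivAlong_congr h.isOpen hv (eqOn_refl F Ω)
  have hbracket {X X' Y Y' : Plane × ℝ → Plane × ℝ} (hX : EqOn X' X Ω) (hY : EqOn Y' Y Ω) :
      EqOn (lieBracket ℝ X' Y') (lieBracket ℝ X Y) Ω := fun x hx =>
    ((hX.eventuallyEq_of_mem (h.isOpen.mem_nhds hx)).lieBracket_vectorField_eq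
      (hY.eventuallyEq_of_mem (h.isOpen.mem_nhds hx)))
  refine ⟨⟨h.isOpen, h.smooth_F, h.smooth_v.congr hv, h.smooth_b, fun x hx => ?_, fun x hx => ?_,
    fun x hx => ?_⟩, h.smooth_H.congr hH, h.smooth_k, fun x hx => ?_, fun x hx => ?_⟩
  · rw [hv hx, h.vertical x hx]
  · rw [hDv hx]
    exact h.indep x hx
  · rw [hDv hx, derivAlong_congr h.isOpen hv hDv hx, h.natural x hx]
  · rw [hH hx, h.fst_H x hx]
  · rw [hbracket hH (hbracket hv hH) hx, hv hx, h.curvature x hx]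

theorem commutesOn (h : IsBracketFrame F Ω (fun x => (F x, 0)) (fun _ => (0, 1)) b k) :
    CommutesOn F Ω := by
  intro x hx
  have hDF := eqOn_dU_derivAlong h.isOpen h.smooth_F
  have hcurv := h.fst_curvature hx
  rw [derivAlong, ← fderiv_congr_of_eqOn h.isOpen hDF hx, derivAlong,
    lieBracket_control_horizontal h.isOpen h.smooth_F hx] at hcurv
  exact hcurv

end IsBracketFrame

namespace IsSmoothDiffeo

variable {E F G : Type*} [NormedAddCommGroup E] [NormedSpace ℝ E] [NormedAddCommGroup F]
  [NormedSpace ℝ F] [NormedAddCommGroup G] [NormedSpace ℝ G]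

theorem restrOpen {ρ : OpenPartialHomeomorph E F} (h : IsSmoothDiffeo ρ) {s : Set E}
    (hs : IsOpen s) : IsSmoothDiffeo (ρ.restrOpen s hs) where
  smooth := h.smooth.mono inter_subset_left
  smooth_symm := h.smooth_symm.mono inter_subset_left

theorem exists_target_eq_prod {ρ : OpenPartialHomeomorph E (F × G)} (h : IsSmoothDiffeo ρ)
    {x : E} (hx : x ∈ ρ.source) :
    ∃ (Θ : OpenPartialHomeomorph E (F × G)) (O : Set F) (V : Set G), IsOpen O ∧ IsOpen V ∧
      IsSmoothDiffeo Θ ∧ x ∈ Θ.source ∧ Θ.source ⊆ ρ.source ∧ Θ.target = O ×ˢ V ∧ ⇑Θ = ρ := by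
  obtain ⟨O, V, hO, hxO, hV, hxV, hOV⟩ :=
    mem_nhds_prod_iff'.1 (ρ.open_target.mem_nhds (ρ.map_source hx))
  refine ⟨(ρ.symm.restrOpen (O ×ˢ V) (hO.prod hV)).symm, O, V, hO, hV,
    (h.symm.restrOpen (hO.prod hV)).symm, ?_, inter_subset_left, inter_eq_right.2 hOV, rfl⟩
  exact ⟨hx, hxO, hxV⟩

end IsSmoothDiffeo

section Straightening

variable {F : Plane × ℝ → Plane} {Ω : Set (Plane × ℝ)} {H v : Plane × ℝ → Plane × ℝ}
  {b k : Plane × ℝ → ℝ} {x : Plane × ℝ} {ψ : Plane × ℝ → ℝ}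

theorem fderiv_prodMk_fst_apply (hψ : DifferentiableAt ℝ ψ x) (ξ : Plane × ℝ) :
    fderiv ℝ (fun y : Plane × ℝ => (y.1, ψ y)) x ξ = (ξ.1, fderiv ℝ ψ x ξ) := by
  rw [(hasFDerivAt_fst.prodMk hψ.hasFDerivAt).fderiv]
  rfl

theorem isInvertible_fderiv_prodMk_fst (hψ : DifferentiableAt ℝ ψ x) {w : Plane × ℝ}
    (hw : w.1 = 0) (hψw : fderiv ℝ ψ x w = 1) :
    (fderiv ℝ (fun y : Plane × ℝ => (y.1, ψ y)) x).IsInvertible := by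
  apply isInvertible_of_injective
  rw [injective_iff_map_eq_zero]
  intro ξ hξ
  rw [fderiv_prodMk_fst_apply hψ, Prod.mk_eq_zero] at hξ
  have hw2 : w.2 ≠ 0 := fun hw2 => by
    rw [show w = 0 from Prod.ext hw hw2, map_zero] at hψw
    exact zero_ne_one hψw
  have hξw : ξ = (ξ.2 / w.2) • w := by
    ext1
    · rw [Prod.smul_fst, hw, smul_zero, hξ.1]
    · rw [Prod.smul_snd, smul_eq_mul, div_mul_cancel₀ _ hw2]
  have hcoeff := hξ.2
  rw [hξw, map_smul, hψw, smul_eq_mul, mul_one] at hcoeff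
  rw [hξw, hcoeff, zero_smul]

theorem isCoordFeedback_ofSet {T : OpenPartialHomeomorph (Plane × ℝ) (Plane × ℝ)}
    {G : Plane × ℝ → Plane} {O : Set Plane} (hO : IsOpen O) (h : IsSmoothDiffeo T)
    (hmem : ∀ y ∈ T.source, y.1 ∈ O) (hfst : ∀ y ∈ T.source, (T y).1 = y.1)
    (hGF : ∀ y ∈ T.source, G y = F (T y)) :
    IsCoordFeedback T (OpenPartialHomeomorph.ofSet O hO) G F where
  toIsSmoothDiffeo := h
  base := ⟨contDiffOn_id, contDiffOn_id⟩
  mem_base := hmem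
  triangular := hfst
  transforms := fun y hy => by
    rw [OpenPartialHomeomorph.ofSet_apply, fderiv_id, ContinuousLinearMap.id_apply, hGF y hy]

namespace IsBracketFrame

theorem exists_natural_control (h : IsBracketFrame F Ω H v b k) (hk : ∀ x ∈ Ω, k x = 0)
    (hb : ∀ x ∈ Ω, derivAlong H b x = 0) (hx : x ∈ Ω) :
    ∃ (Θ : OpenPartialHomeomorph (Plane × ℝ) (Plane × ℝ)) (O : Set Plane) (V : Set ℝ),
      IsOpen O ∧ IsOpen V ∧ IsSmoothDiffeo Θ ∧ x ∈ Θ.source ∧ Θ.source ⊆ Ω ∧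
      Θ.target = O ×ˢ V ∧ (∀ y ∈ Θ.source, (Θ y).1 = y.1) ∧
      IsNaturalField (F ∘ Θ.symm) (O ×ˢ V) (fun _ => (0, 1)) (b ∘ Θ.symm) ∧
      CommutesOn (F ∘ Θ.symm) (O ×ˢ V) := by
  obtain ⟨B, ψ, hB, hxB, hBΩ, hψ, hval⟩ := h.exists_first_integral hk hb hx
  have hψd {y} (hy : y ∈ B) := differentiableAt_of_contDiffOn hB hψ hy
  obtain ⟨ρ, hρ, hρx, hρB, hρcoe⟩ := exists_isSmoothDiffeo_of_isInvertible hB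
    (contDiff_fst.contDiffOn.prodMk hψ) (fun y hy => isInvertible_fderiv_prodMk_fst (hψd hy)
      (h.vertical y (hBΩ hy)) (hval y hy).2) hxB
  obtain ⟨Θ, O, V, hO, hV, hΘ, hΘx, hΘρ, hΘt, hΘcoe⟩ := hρ.exists_target_eq_prod hρx
  have hcoe : ⇑Θ = fun y => (y.1, ψ y) := hΘcoe.trans hρcoe
  have hΘB : Θ.source ⊆ B := hΘρ.trans hρB
  have hfst : ∀ y ∈ Θ.source, (Θ y).1 = y.1 := fun y _ => by rw [hcoe]
  have hfst_symm (y) (hy : y ∈ Θ.target) : (Θ.symm y).1 = y.1 := by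
    rw [← hfst _ (Θ.map_target hy), Θ.right_inv hy]
  have hframe := (isCoordFeedback_ofSet isOpen_univ hΘ.symm (fun _ _ => mem_univ _) hfst_symm
    fun _ _ => rfl).isBracketFrame (fun y hy => hBΩ (hΘB (Θ.map_target hy))) h
  rw [Θ.symm_source, hΘt] at hframe
  have hmaps {y} (hy : y ∈ O ×ˢ V) : Θ.symm y ∈ Ω := hBΩ (hΘB (Θ.map_target (hΘt ▸ hy)))
  have hpullback {X : Plane × ℝ → Plane × ℝ} {a : Plane} {c : ℝ} {y : Plane × ℝ}
      (hy : y ∈ O ×ˢ V) (hXa : (X (Θ.symm y)).1 = a) (hXc : ∀ z ∈ B, fderiv ℝ ψ z (X z) = c) :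
      (a, c) = VectorField.pullback ℝ Θ.symm X y := by
    subst hXa
    have hy' : y ∈ Θ.target := hΘt ▸ hy
    have hyB := hΘB (Θ.map_target hy')
    refine ((pullback_eq_iff (hΘ.symm.isInvertible_fderiv hy')).2 ?_).symm
    have hinv := hΘ.fderiv_symm_fderiv (Θ.map_target hy') (X (Θ.symm y))
    rwa [Θ.right_inv hy', hcoe, fderiv_prodMk_fst_apply (hψd hyB), hXc _ hyB] at hinv
  have hflat := hframe.congr (H' := fun y => (F (Θ.symm y), 0)) (v' := fun _ => (0, 1))
    (fun y hy => hpullback hy (h.fst_H _ (hmaps hy)) fun z hz => (hval z hz).1)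
    (fun y hy => hpullback hy (h.vertical _ (hmaps hy)) fun z hz => (hval z hz).2)
  exact ⟨Θ, O, V, hO, hV, hΘ, hΘx, hΘB.trans hBΩ, hΘt, hfst, hflat.toIsNaturalField,
    hflat.commutesOn⟩

end IsBracketFrame

end Straightening

end FlatSystems

/-! ### Systems straightened by a generated family -/

section PartialDerivative

variable {E F G : Type*} [NormedAddCommGroup E] [NormedSpace ℝ E] [NormedAddCommGroup F]
  [NormedSpace ℝ F] [NormedAddCommGroup G] [NormedSpace ℝ G] {Ω : Set (E × F)} {f : E × F → G}

theorem eqOn_fderiv_partial_fst (hΩ : IsOpen Ω) (hf : ContDiffOn ℝ ∞ f Ω) :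
    EqOn (fun x => fderiv ℝ (fun y => f (y, x.2)) x.1)
      (fun x => (fderiv ℝ f x).comp (ContinuousLinearMap.inl ℝ E F)) Ω := by
  intro x hx
  ext ξ
  exact fderiv_partial_fst (differentiableAt_of_contDiffOn hΩ hf hx) ξ

theorem contDiffOn_fderiv_partial_fst (hΩ : IsOpen Ω) (hf : ContDiffOn ℝ ∞ f Ω) :
    ContDiffOn ℝ ∞ (fun x : E × F => fderiv ℝ (fun y => f (y, x.2)) x.1) Ω :=
  ((contDiffOn_fderiv hΩ hf).clm_comp contDiffOn_const).congr (eqOn_fderiv_partial_fst hΩ hf)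

theorem fderiv_fderiv_partial_fst (hΩ : IsOpen Ω) (hf : ContDiffOn ℝ ∞ f Ω) {x : E × F}
    (hx : x ∈ Ω) (ζ : E × F) (ξ : E) :
    fderiv ℝ (fun x : E × F => fderiv ℝ (fun y => f (y, x.2)) x.1) x ζ ξ
      = fderiv ℝ (fderiv ℝ f) x ζ (ξ, 0) := by
  have hcomp : HasFDerivAt (fun x => (fderiv ℝ f x).comp (ContinuousLinearMap.inl ℝ E F)) _ x :=
    (differentiableAt_of_contDiffOn hΩ (contDiffOn_fderiv hΩ hf) hx).hasFDerivAt.clm_comp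
      (hasFDerivAt_const (ContinuousLinearMap.inl ℝ E F) x)
  rw [fderiv_congr_of_eqOn hΩ (eqOn_fderiv_partial_fst hΩ hf) hx, hcomp.fderiv]
  simp

end PartialDerivative

/-- The differential `T_q P_u` of the maps of a family, as a function of `x = (q, u)`. -/
noncomputable def stateDeriv (P : ℝ → Plane → Plane) (x : Plane × ℝ) : Plane →L[ℝ] Plane :=
  fderiv ℝ (P x.2) x.1

/-- The differential in the state of the field `fieldX a₁ a₂ u`, where `β` stands for the
derivative of `a₂ (u, ·)`. -/
noncomputable def fieldXDeriv (β : ℝ) : Plane →L[ℝ] Plane :=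
  (EuclideanSpace.proj 1).smulRight e₁
    + (β • EuclideanSpace.proj 1 - EuclideanSpace.proj 0 : Coplane).smulRight e₂

theorem fieldXDeriv_e₁ (β : ℝ) : fieldXDeriv β e₁ = -e₂ := by
  simp [fieldXDeriv, e₁]

theorem fieldXDeriv_e₂ (β : ℝ) : fieldXDeriv β e₂ = e₁ + β • e₂ := by
  simp [fieldXDeriv, e₂]

theorem hasFDerivAt_fieldX {a₁ : ℝ → ℝ} {a₂ : ℝ × ℝ → ℝ} {u : ℝ} {q : Plane}
    (h : DifferentiableAt ℝ a₂ (u, q 1)) :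
    HasFDerivAt (fieldX a₁ a₂ u) (fieldXDeriv (fderiv ℝ a₂ (u, q 1) (0, 1))) q := by
  have hcoord (i : Fin 2) :
      HasFDerivAt (fun y : Plane => y i) (EuclideanSpace.proj i : Coplane) q :=
    (EuclideanSpace.proj (𝕜 := ℝ) i).hasFDerivAt
  have ha₂ : HasFDerivAt (fun y : Plane => a₂ (u, y 1))
      (fderiv ℝ a₂ (u, q 1) (0, 1) • (EuclideanSpace.proj 1 : Coplane)) q := by
    have hslice : HasDerivAt (fun t => a₂ (u, t)) (fderiv ℝ a₂ (u, q 1) (0, 1)) (q 1) :=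
      HasFDerivAt.comp_hasDerivAt (f := fun t => (u, t)) (q 1) h.hasFDerivAt
        ((hasDerivAt_const _ u).prodMk (hasDerivAt_id _))
    exact HasDerivAt.comp_hasFDerivAt q hslice (hcoord 1)
  have hsum := (((hcoord 1).const_add (a₁ u)).smul_const e₁).fun_add
    ((ha₂.fun_sub (hcoord 0)).smul_const e₂)
  refine hsum.congr_of_eventuallyEq (Eventually.of_forall fun y => ?_)
  simpa [fieldX] using plane_eq_smul_add_smul (fieldX a₁ a₂ u y)

namespace IsGeneratedFamily

variable {a₁ : ℝ → ℝ} {a₂ : ℝ × ℝ → ℝ} {P : ℝ → Plane → Plane} {O : Set Plane} {V : Set ℝ}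
  {G : Plane × ℝ → Plane} {x : Plane × ℝ}

theorem isOpen_prod (h : IsGeneratedFamily a₁ a₂ P O V) : IsOpen (O ×ˢ V) :=
  h.isOpen_O.prod h.isOpen_V

theorem contDiffOn_stateDeriv (h : IsGeneratedFamily a₁ a₂ P O V) :
    ContDiffOn ℝ ∞ (stateDeriv P) (O ×ˢ V) :=
  contDiffOn_fderiv_partial_fst h.isOpen_prod h.smooth_P

theorem differentiableAt (h : IsGeneratedFamily a₁ a₂ P O V) (hx : x ∈ O ×ˢ V) :
    DifferentiableAt ℝ (P x.2) x.1 :=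
  (differentiableAt_of_contDiffOn h.isOpen_prod h.smooth_P hx).comp x.1
    (f := fun y : Plane => (y, x.2)) (by fun_prop)

theorem injective_stateDeriv (h : IsGeneratedFamily a₁ a₂ P O V) (hx : x ∈ O ×ˢ V) :
    Function.Injective (stateDeriv P x) :=
  (h.bijective x.1 hx.1 x.2 hx.2).1

theorem eqOn_fderiv_control (h : IsGeneratedFamily a₁ a₂ P O V) :
    EqOn (derivAlong (fun _ => (0, 1)) fun x : Plane × ℝ => P x.2 x.1)
      (fun x => fieldX a₁ a₂ x.2 (P x.2 x.1)) (O ×ˢ V) := fun x hx =>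
  (hasDerivAt_control (differentiableAt_of_contDiffOn h.isOpen_prod h.smooth_P hx)).unique
    (h.generated x.1 hx.1 x.2 hx.2)

theorem fderiv_stateDeriv_horizontal_comm (h : IsGeneratedFamily a₁ a₂ P O V)
    (hx : x ∈ O ×ˢ V) (ξ η : Plane) :
    fderiv ℝ (stateDeriv P) x (ξ, 0) η = fderiv ℝ (stateDeriv P) x (η, 0) ξ := by
  have hstate := fderiv_fderiv_partial_fst h.isOpen_prod h.smooth_P hx
  exact (hstate (ξ, 0) η).trans
    ((fderiv_fderiv_comm h.isOpen_prod h.smooth_P hx _ _).trans (hstate (η, 0) ξ).symm)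

-- The linearization of `dP_u/du = X_u ∘ P_u`.
theorem exists_fderiv_stateDeriv_control (h : IsGeneratedFamily a₁ a₂ P O V) :
    ∃ β : Plane × ℝ → ℝ, ContDiffOn ℝ ∞ β (O ×ˢ V) ∧ ∀ x ∈ O ×ˢ V, ∀ ξ,
      fderiv ℝ (stateDeriv P) x (0, 1) ξ = fieldXDeriv (β x) (stateDeriv P x ξ) := by
  obtain ⟨D, hD, ha₂, hmem⟩ := h.smooth_a₂
  let Φ (x : Plane × ℝ) : Plane := P x.2 x.1
  have hpair : ContDiffOn ℝ ∞ (fun x => (x.2, Φ x 1)) (O ×ˢ V) :=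
    contDiff_snd.contDiffOn.prodMk
      ((EuclideanSpace.proj (𝕜 := ℝ) (1 : Fin 2)).contDiff.comp_contDiffOn h.smooth_P)
  have hmaps : MapsTo (fun x => (x.2, Φ x 1)) (O ×ˢ V) D := fun x hx => hmem x.1 hx.1 x.2 hx.2
  refine ⟨fun x => fderiv ℝ a₂ (x.2, Φ x 1) (0, 1),
    ((contDiffOn_fderiv hD ha₂).comp hpair hmaps).clm_apply contDiffOn_const, fun x hx ξ => ?_⟩
  have hfield : ContDiffOn ℝ ∞ (fun x : Plane × ℝ => fieldX a₁ a₂ x.2 (Φ x)) (O ×ˢ V) :=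
    (contDiffOn_derivAlong h.isOpen_prod contDiffOn_const h.smooth_P).congr
      h.eqOn_fderiv_control.symm
  have hchain := (hasFDerivAt_fieldX (a₁ := a₁)
    (differentiableAt_of_contDiffOn hD ha₂ (hmaps hx))).comp x.1 (h.differentiableAt hx).hasFDerivAt
  calc fderiv ℝ (stateDeriv P) x (0, 1) ξ = fderiv ℝ (fderiv ℝ Φ) x (ξ, 0) (0, 1) :=
        (fderiv_fderiv_partial_fst h.isOpen_prod h.smooth_P hx _ _).trans
          (fderiv_fderiv_comm h.isOpen_prod h.smooth_P hx _ _)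
    _ = fderiv ℝ (fun x => fieldX a₁ a₂ x.2 (Φ x)) x (ξ, 0) := by
        rw [← fderiv_congr_of_eqOn h.isOpen_prod h.eqOn_fderiv_control hx, fderiv_derivAlong
          h.isOpen_prod contDiffOn_const h.smooth_P hx]
        simp [Φ]
    _ = fderiv ℝ (fun q => fieldX a₁ a₂ x.2 (P x.2 q)) x.1 ξ :=
        (fderiv_partial_fst (differentiableAt_of_contDiffOn h.isOpen_prod hfield hx) ξ).symm
    _ = fieldXDeriv (fderiv ℝ a₂ (x.2, Φ x 1) (0, 1)) (stateDeriv P x ξ) := by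
        rw [show (fun q => fieldX a₁ a₂ x.2 (P x.2 q)) = fieldX a₁ a₂ x.2 ∘ P x.2 from rfl,
          hchain.fderiv]
        rfl

section Straightened

variable (h : IsGeneratedFamily a₁ a₂ P O V)
include h

theorem stateDeriv_fderiv {c : Plane} (hG : ContDiffOn ℝ ∞ G (O ×ˢ V))
    (hc : ∀ x ∈ O ×ˢ V, stateDeriv P x (G x) = c) (hx : x ∈ O ×ˢ V) (ζ : Plane × ℝ) :
    stateDeriv P x (fderiv ℝ G x ζ) = -fderiv ℝ (stateDeriv P) x ζ (G x) := by
  rw [fderiv_apply_of_pairing_const h.isOpen_prod h.contDiffOn_stateDeriv hG hc hx, neg_neg]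

theorem stateDeriv_dU {c : Plane} (hG : ContDiffOn ℝ ∞ G (O ×ˢ V))
    (hc : ∀ x ∈ O ×ˢ V, stateDeriv P x (G x) = c) (hx : x ∈ O ×ˢ V) :
    stateDeriv P x (dU G x) = -fderiv ℝ (stateDeriv P) x (0, 1) (G x) := by
  rw [dU_eq_fderiv (differentiableAt_of_contDiffOn h.isOpen_prod hG hx),
    h.stateDeriv_fderiv hG hc hx]

variable (hG : ∀ x ∈ O ×ˢ V, stateDeriv P x (G x) = e₁)
include hG

theorem contDiffOn_straightened : ContDiffOn ℝ ∞ G (O ×ˢ V) := by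
  have hinv (x) (hx : x ∈ O ×ˢ V) : (stateDeriv P x).IsInvertible :=
    isInvertible_of_injective (h.injective_stateDeriv hx)
  have hsmooth : ContDiffOn ℝ ∞ (fun x => (stateDeriv P x).inverse e₁) (O ×ˢ V) :=
    ContDiffOn.clm_apply (fun x hx => (hinv x hx).contDiffAt_map_inverse.comp_contDiffWithinAt x
      (h.contDiffOn_stateDeriv x hx)) contDiffOn_const
  exact hsmooth.congr fun x hx => ((hinv x hx).inverse_apply_eq.2 (hG x hx).symm).symm

theorem stateDeriv_dU_straightened (hx : x ∈ O ×ˢ V) : stateDeriv P x (dU G x) = e₂ := by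
  obtain ⟨β, -, hβ⟩ := h.exists_fderiv_stateDeriv_control
  rw [h.stateDeriv_dU (h.contDiffOn_straightened hG) hG hx, hβ x hx, hG x hx, fieldXDeriv_e₁,
    neg_neg]

theorem straightens : Straightens P G O V := fun q hq u hu =>
  ⟨hG (q, u) ⟨hq, hu⟩, h.stateDeriv_dU_straightened hG (x := (q, u)) ⟨hq, hu⟩⟩

theorem commutesOn_straightened : CommutesOn G (O ×ˢ V) := by
  intro x hx
  have hGs := h.contDiffOn_straightened hG
  apply h.injective_stateDeriv hx
  rw [h.stateDeriv_fderiv (contDiffOn_dU h.isOpen_prod hGs)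
    (fun _ => h.stateDeriv_dU_straightened hG) hx, h.stateDeriv_fderiv hGs hG hx,
    h.fderiv_stateDeriv_horizontal_comm hx]

theorem exists_isNaturalField_straightened :
    ∃ b, IsNaturalField G (O ×ˢ V) (fun _ => (0, 1)) b := by
  obtain ⟨β, hβs, hβ⟩ := h.exists_fderiv_stateDeriv_control
  have hΩ := h.isOpen_prod
  have hGs := h.contDiffOn_straightened hG
  have hDG := (eqOn_dU_derivAlong hΩ hGs).symm
  have hDDG := (eqOn_dU_derivAlong hΩ (contDiffOn_dU hΩ hGs)).symm
  have hU {x} (hx : x ∈ O ×ˢ V) := h.stateDeriv_dU_straightened hG hx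
  refine ⟨β, hΩ, hGs, contDiffOn_const, hβs, fun _ _ => rfl, fun x hx => ?_, fun x hx => ?_⟩
  · rw [hDG hx]
    apply wedge_ne_zero_of_map (l := stateDeriv P x)
    rw [hG x hx, hU hx]
    simp [wedge, e₁, e₂]
  · rw [derivAlong_congr hΩ (eqOn_refl _ _) hDG hx, hDDG hx, hDG hx]
    apply h.injective_stateDeriv hx
    rw [h.stateDeriv_dU (contDiffOn_dU hΩ hGs) (fun _ => hU) hx, hβ x hx, hU hx, map_sub, map_neg,
      map_smul, hG x hx, hU hx, fieldXDeriv_e₂]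
    abel

theorem isNaturalControl_straightened : IsNaturalControl G O V := by
  obtain ⟨b, hb⟩ := h.exists_isNaturalField_straightened hG
  exact hb.isNaturalControl_of_commutesOn h.isOpen_O h.isOpen_V (h.commutesOn_straightened hG)

theorem commuting_straightened : Commuting G O V :=
  (commuting_iff_commutesOn h.isOpen_O h.isOpen_V (h.contDiffOn_straightened hG)).2
    (h.commutesOn_straightened hG)

end Straightened

end IsGeneratedFamily

/-! ### Parameter integrals and primitives of closed forms -/

section ParametricIntegral

open MeasureTheory

variable {E D G : Type*} [NormedAddCommGroup E] [NormedSpace ℝ E]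
  [NormedAddCommGroup D] [NormedSpace ℝ D] [NormedAddCommGroup G] [NormedSpace ℝ G]
  {s : Set E} {U : Set D} {f : E × D → G}

theorem contDiffOn_cutoff_smul (hs : IsOpen s) (hU : IsOpen U) (hf : ContDiffOn ℝ ∞ f (s ×ˢ U))
    {L : Set D} (hL : IsClosed L) (hLU : L ⊆ U) {χ : D → ℝ} (hχ : ContDiff ℝ ∞ χ)
    (hχ0 : ∀ t ∉ L, χ t = 0) : ContDiffOn ℝ ∞ (fun x => χ x.2 • f x) (s ×ˢ univ) := by
  rintro ⟨x, t⟩ ⟨hx, -⟩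
  apply ContDiffAt.contDiffWithinAt
  by_cases ht : t ∈ U
  · exact (hχ.comp contDiff_snd).contDiffAt.smul
      (hf.contDiffAt ((hs.prod hU).mem_nhds ⟨hx, ht⟩))
  · have hev : ∀ᶠ y in 𝓝 (x, t), y.2 ∉ L :=
      continuous_snd.continuousAt.eventually (hL.isOpen_compl.mem_nhds fun h => ht (hLU h))
    refine (contDiffAt_const (c := (0 : G))).congr_of_eventuallyEq ?_
    filter_upwards [hev] with y hy
    rw [hχ0 _ hy, zero_smul]

-- The integral is the value at `0` of the convolution of the indicator of `K` with the reflection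
-- of `f x`, cut off outside a neighbourhood of `K`.
theorem contDiffOn_setIntegral_param [FiniteDimensional ℝ D] [MeasurableSpace D] [BorelSpace D]
    {μ : Measure D} [IsLocallyFiniteMeasure μ] {K : Set D} (hs : IsOpen s) (hU : IsOpen U)
    (hK : IsCompact K) (hKU : K ⊆ U) (hf : ContDiffOn ℝ ∞ f (s ×ˢ U)) :
    ContDiffOn ℝ ∞ (fun x => ∫ t in K, f (x, t) ∂μ) s := by
  obtain ⟨L, hL, hKL, hLU⟩ := exists_compact_between hK hU hKU
  obtain ⟨χ, hχ1, hχ0, -⟩ := exists_contMDiffMap_one_nhds_of_subset_interior (n := ⊤) 𝓘(ℝ, D)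
    hK.isClosed hKL
  have hχs : ContDiff ℝ ∞ χ := χ.contMDiff.contDiff
  have hcut := contDiffOn_cutoff_smul hs hU hf hL.isClosed hLU hχs hχ0
  have hconv := contDiffOn_convolution_right_with_param_comp (n := ⊤) (μ := μ)
    (ContinuousLinearMap.lsmul ℝ ℝ) (contDiffOn_const (c := (0 : D)) (s := s)) hs hL.neg
    (g := fun x t => χ (-t) • f (x, -t))
    (fun x t _ ht => by rw [hχ0 _ ht, zero_smul])
    ((locallyIntegrable_const (1 : ℝ)).indicator hK.measurableSet)
    (hcut.comp (f := fun y : E × D => (y.1, -y.2)) (by fun_prop) fun y hy => ⟨hy.1, mem_univ _⟩)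
  refine hconv.congr fun x _ => ?_
  rw [convolution_def, ← integral_indicator hK.measurableSet]
  congr 1
  ext t
  by_cases ht : t ∈ K
  · simp [ht, hχ1.self_of_nhdsSet t ht]
  · simp [ht]

end ParametricIntegral

section Primitive

variable {E W G : Type*} [NormedAddCommGroup E] [NormedSpace ℝ E] [NormedAddCommGroup W]
  [NormedSpace ℝ W] [NormedAddCommGroup G] [NormedSpace ℝ G] {A : E × W → E →L[ℝ] G} {q₀ : E}
  {r : ℝ} {V : Set W}

theorem contDiffOn_curveIntegral_segment (hV : IsOpen V)
    (hA : ContDiffOn ℝ ∞ A (Metric.ball q₀ r ×ˢ V)) :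
    ContDiffOn ℝ ∞ (fun x : E × W => ∫ᶜ y in .segment q₀ x.1, A (y, x.2))
      (Metric.ball q₀ r ×ˢ V) := by
  rintro ⟨q, w⟩ ⟨hq, hw⟩
  obtain ⟨ρ, hqρ, hρr⟩ := exists_between (mem_ball_iff_norm.1 hq)
  have hρ : 0 < ρ := (norm_nonneg _).trans_lt hqρ
  have hmaps : MapsTo (fun z : (E × W) × ℝ => (AffineMap.lineMap q₀ z.1.1 z.2, z.1.2))
      ((Metric.ball q₀ ρ ×ˢ V) ×ˢ Metric.ball (0 : ℝ) (r / ρ)) (Metric.ball q₀ r ×ˢ V) := by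
    rintro ⟨⟨y, u⟩, t⟩ ⟨⟨hy, hu⟩, ht⟩
    rw [mem_ball_iff_norm] at hy
    rw [mem_ball_zero_iff] at ht
    refine ⟨mem_ball_iff_norm.2 ?_, hu⟩
    calc ‖AffineMap.lineMap q₀ y t - q₀‖ = ‖t‖ * ‖y - q₀‖ := by
          rw [AffineMap.lineMap_apply, vsub_eq_sub, vadd_eq_add, add_sub_cancel_right, norm_smul]
      _ < r / ρ * ρ := mul_lt_mul'' ht hy (norm_nonneg _) (norm_nonneg _)
      _ = r := div_mul_cancel₀ r hρ.ne'
  have hline : ContDiff ℝ ∞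
      (fun z : (E × W) × ℝ => ((AffineMap.lineMap q₀ z.1.1 z.2 : E), z.1.2)) := by
    simp only [AffineMap.lineMap_apply, vsub_eq_sub, vadd_eq_add]
    fun_prop
  have hintegral := contDiffOn_setIntegral_param (μ := MeasureTheory.volume)
    (Metric.isOpen_ball.prod hV) Metric.isOpen_ball isCompact_Icc
    (fun t (ht : t ∈ Icc (0 : ℝ) 1) => mem_ball_zero_iff.2 (by
      rw [Real.norm_of_nonneg ht.1]
      exact ht.2.trans_lt ((one_lt_div hρ).2 hρr)))
    ((hA.comp hline.contDiffOn hmaps).clm_apply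
      (g := fun z : (E × W) × ℝ => z.1.1 - q₀) (by fun_prop))
  have hopen : Metric.ball q₀ ρ ×ˢ V ∈ 𝓝 (q, w) :=
    (Metric.isOpen_ball.prod hV).mem_nhds ⟨mem_ball_iff_norm.2 hqρ, hw⟩
  refine ((hintegral.contDiffAt hopen).congr_of_eventuallyEq
    (Eventually.of_forall fun x => ?_)).contDiffWithinAt
  rw [curveIntegral_segment, intervalIntegral.integral_of_le zero_le_one,
    ← MeasureTheory.integral_Icc_eq_integral_Ioc]
  rfl

theorem exists_smooth_primitive [CompleteSpace G] (hr : 0 < r) (hV : IsOpen V)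
    (hA : ContDiffOn ℝ ∞ A (Metric.ball q₀ r ×ˢ V))
    (hsymm : ∀ x ∈ Metric.ball q₀ r ×ˢ V, ∀ ξ η, fderiv ℝ A x (ξ, 0) η = fderiv ℝ A x (η, 0) ξ) :
    ∃ P : W → E → G, ContDiffOn ℝ ∞ (fun x : E × W => P x.2 x.1) (Metric.ball q₀ r ×ˢ V) ∧
      (∀ q ∈ Metric.ball q₀ r, ∀ w ∈ V, HasFDerivAt (P w) (A (q, w)) q) ∧
      ∀ w, P w q₀ = 0 := by
  refine ⟨fun w q => ∫ᶜ y in .segment q₀ q, A (y, w),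
    contDiffOn_curveIntegral_segment hV hA, fun q hq w hw => ?_, fun w => by simp⟩
  have hAd {y} (hy : y ∈ Metric.ball q₀ r) : DifferentiableAt ℝ A (y, w) :=
    differentiableAt_of_contDiffOn (Metric.isOpen_ball.prod hV) hA ⟨hy, hw⟩
  have hslice {y} (hy : y ∈ Metric.ball q₀ r) : DifferentiableAt ℝ (fun y => A (y, w)) y :=
    DifferentiableAt.comp y (g := A) (f := fun y => (y, w)) (hAd hy) (by fun_prop)
  refine ((convex_ball q₀ r).hasFDerivWithinAt_curveIntegral_segment_of_hasFDerivWithinAt_symmetric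
    (fun y hy => (hslice hy).hasFDerivAt.hasFDerivWithinAt) (fun y hy ξ _ η _ => ?_)
    (Metric.mem_ball_self hr) hq).hasFDerivAt (Metric.isOpen_ball.mem_nhds hq)
  rw [fderiv_partial_fst (x := (y, w)) (hAd hy), fderiv_partial_fst (x := (y, w)) (hAd hy)]
  exact hsymm _ ⟨hy, hw⟩ ξ η

end Primitive

/-! ### Straightening commuting systems in a natural control -/

theorem wedge_e₁_e₂ : wedge e₁ e₂ ≠ 0 := by
  simp [wedge, e₁, e₂]

theorem IsNaturalField.dU_dU {F : Plane × ℝ → Plane} {Ω : Set (Plane × ℝ)} {b : Plane × ℝ → ℝ}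
    {x : Plane × ℝ} (h : IsNaturalField F Ω (fun _ => (0, 1)) b) (hx : x ∈ Ω) :
    dU (dU F) x = -F x - b x • dU F x := by
  have hU := eqOn_dU_derivAlong h.isOpen h.smooth_F
  rw [hU hx, ← h.natural x hx, eqOn_dU_derivAlong h.isOpen (contDiffOn_dU h.isOpen h.smooth_F) hx,
    derivAlong_congr h.isOpen (fun _ _ => rfl) hU hx]

/-- `A (q, u)` is the linear map of the plane that takes the frame `F (q, u)`, `∂F/∂u (q, u)` to
the standard frame. -/
structure IsStraighteningCoframe (A : Plane × ℝ → Plane →L[ℝ] Plane) (F : Plane × ℝ → Plane)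
    (Ω : Set (Plane × ℝ)) : Prop where
  smooth : ContDiffOn ℝ ∞ A Ω
  apply_field : ∀ x ∈ Ω, A x (F x) = e₁
  apply_dU : ∀ x ∈ Ω, A x (dU F x) = e₂

theorem exists_isStraighteningCoframe {F : Plane × ℝ → Plane} {Ω : Set (Plane × ℝ)}
    (hΩ : IsOpen Ω) (hF : ContDiffOn ℝ ∞ F Ω) (hind : ∀ x ∈ Ω, wedge (F x) (dU F x) ≠ 0) :
    ∃ A, IsStraighteningCoframe A F Ω := by
  have hU := contDiffOn_dU hΩ hF
  refine ⟨fun x => (wedge (F x) (dU F x))⁻¹ • ((wedgeL.flip (dU F x)).smulRight e₁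
    + (wedgeL (F x)).smulRight e₂), ?_, fun x hx => ?_, fun x hx => ?_⟩
  · exact ((contDiffOn_wedge hF hU).inv hind).smul
      (((wedgeL.flip.contDiff.comp_contDiffOn hU).smulRight contDiffOn_const).add
        ((wedgeL.contDiff.comp_contDiffOn hF).smulRight contDiffOn_const))
  · simp [wedgeL_apply, smul_smul, hind x hx]
  · simp [wedgeL_apply, smul_smul, hind x hx]

namespace IsStraighteningCoframe

variable {A : Plane × ℝ → Plane →L[ℝ] Plane} {F : Plane × ℝ → Plane} {Ω : Set (Plane × ℝ)}
  {b : Plane × ℝ → ℝ} {x : Plane × ℝ}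

theorem wedge_ne_zero (h : IsStraighteningCoframe A F Ω) (hx : x ∈ Ω) :
    wedge (F x) (dU F x) ≠ 0 := by
  apply wedge_ne_zero_of_map (l := A x)
  rw [h.apply_field x hx, h.apply_dU x hx]
  exact wedge_e₁_e₂

theorem injective (h : IsStraighteningCoframe A F Ω) (hx : x ∈ Ω) : Function.Injective (A x) := by
  rw [injective_iff_map_eq_zero]
  intro ξ hξ
  rw [eq_smul_add_smul (h.wedge_ne_zero hx) ξ] at hξ ⊢
  rw [map_add, map_smul, map_smul, h.apply_field x hx, h.apply_dU x hx] at hξ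
  obtain ⟨hr, hs⟩ := eq_zero_of_smul_add_smul_eq_zero wedge_e₁_e₂ hξ
  rw [hr, hs, zero_smul, zero_smul, add_zero]

theorem mono (h : IsStraighteningCoframe A F Ω) {Ω' : Set (Plane × ℝ)} (hs : Ω' ⊆ Ω) :
    IsStraighteningCoframe A F Ω' where
  smooth := h.smooth.mono hs
  apply_field := fun x hx => h.apply_field x (hs hx)
  apply_dU := fun x hx => h.apply_dU x (hs hx)

theorem congr (h : IsStraighteningCoframe A F Ω) {A' : Plane × ℝ → Plane →L[ℝ] Plane}
    (hA : EqOn A' A Ω) : IsStraighteningCoframe A' F Ω where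
  smooth := h.smooth.congr hA
  apply_field := fun x hx => by rw [hA hx, h.apply_field x hx]
  apply_dU := fun x hx => by rw [hA hx, h.apply_dU x hx]

theorem fderiv_apply_field (h : IsStraighteningCoframe A F Ω) (hΩ : IsOpen Ω)
    (hF : ContDiffOn ℝ ∞ F Ω) (hx : x ∈ Ω) (ζ : Plane × ℝ) :
    fderiv ℝ A x ζ (F x) = -A x (fderiv ℝ F x ζ) :=
  fderiv_apply_of_pairing_const hΩ h.smooth hF h.apply_field hx ζ

theorem fderiv_apply_dU (h : IsStraighteningCoframe A F Ω) (hΩ : IsOpen Ω)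
    (hF : ContDiffOn ℝ ∞ F Ω) (hx : x ∈ Ω) (ζ : Plane × ℝ) :
    fderiv ℝ A x ζ (dU F x) = -A x (fderiv ℝ (dU F) x ζ) :=
  fderiv_apply_of_pairing_const hΩ h.smooth (contDiffOn_dU hΩ hF) h.apply_dU hx ζ

theorem fderiv_horizontal_comm (h : IsStraighteningCoframe A F Ω) (hΩ : IsOpen Ω)
    (hF : ContDiffOn ℝ ∞ F Ω) (hcomm : CommutesOn F Ω) (hx : x ∈ Ω) (ξ η : Plane) :
    fderiv ℝ A x (ξ, 0) η = fderiv ℝ A x (η, 0) ξ := by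
  have hframe : fderiv ℝ A x (F x, 0) (dU F x) = fderiv ℝ A x (dU F x, 0) (F x) := by
    rw [h.fderiv_apply_dU hΩ hF hx, h.fderiv_apply_field hΩ hF hx, hcomm x hx]
  have hpair (r s : ℝ) (y z : Plane) :
      ((r • y + s • z, 0) : Plane × ℝ) = r • (y, 0) + s • (z, 0) := by
    ext1 <;> simp
  rw [eq_smul_add_smul (h.wedge_ne_zero hx) ξ, eq_smul_add_smul (h.wedge_ne_zero hx) η]
  simp only [hpair, map_add, map_smul, add_apply, smul_apply, hframe]
  module

theorem fderiv_control (h : IsStraighteningCoframe A F Ω)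
    (hF : IsNaturalField F Ω (fun _ => (0, 1)) b) (hx : x ∈ Ω) (ξ : Plane) :
    fderiv ℝ A x (0, 1) ξ = fieldXDeriv (b x) (A x ξ) := by
  have hUs := contDiffOn_dU hF.isOpen hF.smooth_F
  refine congrArg (· ξ) (clm_ext_of_wedge (h.wedge_ne_zero hx)
    (p' := (fieldXDeriv (b x)).comp (A x)) ?_ ?_)
  · rw [h.fderiv_apply_field hF.isOpen hF.smooth_F hx,
      ← dU_eq_fderiv (differentiableAt_of_contDiffOn hF.isOpen hF.smooth_F hx),
      ContinuousLinearMap.comp_apply, h.apply_field x hx, h.apply_dU x hx, fieldXDeriv_e₁]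
  · rw [h.fderiv_apply_dU hF.isOpen hF.smooth_F hx,
      ← dU_eq_fderiv (differentiableAt_of_contDiffOn hF.isOpen hUs hx), hF.dU_dU hx, map_sub,
      map_neg, map_smul, ContinuousLinearMap.comp_apply, h.apply_field x hx, h.apply_dU x hx,
      fieldXDeriv_e₂]
    abel

end IsStraighteningCoframe

section ReducedFunction

-- `f` is constant on the segments from `y` to its projection along `e₁`.
theorem exists_eq_of_fderiv_e₁_eq_zero {f : Plane × ℝ → ℝ} {T : Set (Plane × ℝ)} (hT : IsOpen T)
    (hf : ContDiffOn ℝ ∞ f T) (hf₁ : ∀ y ∈ T, fderiv ℝ f y (e₁, 0) = 0) {y₀ : Plane × ℝ}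
    (hy₀ : y₀ ∈ T) :
    ∃ (S : Set (Plane × ℝ)) (D : Set (ℝ × ℝ)) (a : ℝ × ℝ → ℝ), IsOpen S ∧ y₀ ∈ S ∧ S ⊆ T ∧
      IsOpen D ∧ ContDiffOn ℝ ∞ a D ∧ ∀ y ∈ S, (y.2, y.1 1) ∈ D ∧ f y = a (y.2, y.1 1) := by
  obtain ⟨ε, hε, hball⟩ := Metric.isOpen_iff.1 hT y₀ hy₀
  let ι (z : ℝ × ℝ) : Plane × ℝ := (y₀.1 0 • e₁ + z.2 • e₂, z.1)
  have hι : ContDiff ℝ ∞ ι := by fun_prop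
  refine ⟨Metric.ball y₀ ε, ι ⁻¹' T, f ∘ ι, Metric.isOpen_ball, Metric.mem_ball_self hε, hball,
    hT.preimage hι.continuous, hf.comp hι.contDiffOn Subset.rfl, fun y hy => ?_⟩
  let π : Plane × ℝ := ι (y.2, y.1 1)
  have hsub : y - π = (y.1 0 - y₀.1 0) • ((e₁, 0) : Plane × ℝ) := by
    nth_rewrite 1 [← Prod.mk.eta (p := y)]
    nth_rewrite 1 [plane_eq_smul_add_smul y.1]
    ext1
    · simp only [π, ι, Prod.fst_sub, Prod.smul_fst]
      module
    · simp [π, ι]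
  have hπ : π ∈ Metric.ball y₀ ε := by
    rw [← ball_prod_same] at hy ⊢
    refine ⟨mem_ball_iff_norm.2 (lt_of_le_of_lt ?_ (mem_ball_iff_norm.1 hy.1)), hy.2⟩
    have hproj : π.1 - y₀.1 = (y.1 - y₀.1) 1 • e₂ := by
      nth_rewrite 1 [plane_eq_smul_add_smul y₀.1]
      simp only [π, ι, PiLp.sub_apply]
      module
    have hnorm : ‖e₂‖ = 1 := by simp [e₂, EuclideanSpace.norm_eq]
    rw [hproj, norm_smul, hnorm, mul_one]
    exact PiLp.norm_apply_le (y.1 - y₀.1) 1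
  obtain ⟨z, hz, hzd⟩ := domain_mvt (f := f) (f' := fun z => fderiv ℝ f z)
    (fun z hz => (differentiableAt_of_contDiffOn hT hf
      (hball hz)).hasFDerivAt.hasFDerivWithinAt) (convex_ball y₀ ε) hπ hy
  have hzT := hball ((convex_ball y₀ ε).segment_subset hπ hy hz)
  rw [hsub, map_smul, hf₁ z hzT, smul_zero] at hzd
  exact ⟨hball hπ, sub_eq_zero.1 hzd⟩

theorem isInvertible_fderiv_prodMk_snd {Φ : Plane × ℝ → Plane} {x : Plane × ℝ}
    (hΦ : DifferentiableAt ℝ Φ x) (hinj : ∀ ξ : Plane, fderiv ℝ Φ x (ξ, 0) = 0 → ξ = 0) :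
    (fderiv ℝ (fun y => (Φ y, y.2)) x).IsInvertible := by
  rw [(hΦ.hasFDerivAt.prodMk hasFDerivAt_snd).fderiv]
  apply isInvertible_of_injective
  rw [injective_iff_map_eq_zero]
  rintro ⟨ξ, t⟩ hξ
  obtain ⟨hΦξ, rfl⟩ : fderiv ℝ Φ x (ξ, t) = 0 ∧ t = 0 := Prod.mk_eq_zero.1 hξ
  rw [hinj ξ hΦξ, Prod.mk_zero_zero]

theorem exists_reduced_function {Φ G : Plane × ℝ → Plane} {R : Plane × ℝ → ℝ}
    {Ω : Set (Plane × ℝ)} {x₀ : Plane × ℝ} (hΩ : IsOpen Ω) (hΦ : ContDiffOn ℝ ∞ Φ Ω)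
    (hR : ContDiffOn ℝ ∞ R Ω) (hinj : ∀ x ∈ Ω, ∀ ξ : Plane, fderiv ℝ Φ x (ξ, 0) = 0 → ξ = 0)
    (hG : ∀ x ∈ Ω, fderiv ℝ Φ x (G x, 0) = e₁) (hRG : ∀ x ∈ Ω, fderiv ℝ R x (G x, 0) = 0)
    (hx₀ : x₀ ∈ Ω) :
    ∃ (S : Set (Plane × ℝ)) (D : Set (ℝ × ℝ)) (a : ℝ × ℝ → ℝ), IsOpen S ∧ x₀ ∈ S ∧ S ⊆ Ω ∧
      InjOn (fun x => (Φ x, x.2)) S ∧ IsOpen D ∧ ContDiffOn ℝ ∞ a D ∧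
      ∀ x ∈ S, (x.2, Φ x 1) ∈ D ∧ R x = a (x.2, Φ x 1) := by
  have hΦd {x} (hx : x ∈ Ω) := differentiableAt_of_contDiffOn hΩ hΦ hx
  obtain ⟨ρ, hρ, hρx, hρΩ, hρcoe⟩ := exists_isSmoothDiffeo_of_isInvertible hΩ
    (hΦ.prodMk contDiff_snd.contDiffOn)
    (fun x hx => isInvertible_fderiv_prodMk_snd (hΦd hx) (hinj x hx)) hx₀
  have hmaps : MapsTo ρ.symm ρ.target Ω := fun y hy => hρΩ (ρ.map_target hy)
  have hstraight : ∀ y ∈ ρ.target, fderiv ℝ (R ∘ ρ.symm) y (e₁, 0) = 0 := by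
    intro y hy
    have hinv := hρ.fderiv_symm_fderiv (ρ.map_target hy) (G (ρ.symm y), 0)
    rw [ρ.right_inv hy, hρcoe,
      ((hΦd (hmaps hy)).hasFDerivAt.prodMk hasFDerivAt_snd).fderiv] at hinv
    rw [fderiv_comp y (differentiableAt_of_contDiffOn hΩ hR (hmaps hy))
      (hρ.symm.differentiableAt hy), ContinuousLinearMap.comp_apply,
      show ((e₁, 0) : Plane × ℝ) = (fderiv ℝ Φ (ρ.symm y) (G (ρ.symm y), 0), 0) by
        rw [hG _ (hmaps hy)]]
    exact (congrArg _ hinv).trans (hRG _ (hmaps hy))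
  obtain ⟨S, D, a, hS, hxS, -, hD, ha, hRa⟩ := exists_eq_of_fderiv_e₁_eq_zero ρ.open_target
    (hR.comp hρ.smooth_symm hmaps) hstraight (ρ.map_source hρx)
  refine ⟨ρ.source ∩ ρ ⁻¹' S, D, a, ρ.isOpen_inter_preimage hS, ⟨hρx, hxS⟩,
    inter_subset_left.trans hρΩ, hρcoe ▸ ρ.injOn.mono inter_subset_left, hD, ha, ?_⟩
  rintro x ⟨hx, hxS⟩
  have hRx := hRa (ρ x) hxS
  rwa [Function.comp_apply, ρ.left_inv hx, hρcoe] at hRx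

end ReducedFunction

theorem fieldXDeriv_apply_zero (β : ℝ) (ξ : Plane) : fieldXDeriv β ξ 0 = ξ 1 := by
  simp [fieldXDeriv, e₁, e₂]

theorem fieldXDeriv_apply_one (β : ℝ) (ξ : Plane) : fieldXDeriv β ξ 1 = β * ξ 1 - ξ 0 := by
  simp [fieldXDeriv, e₁, e₂]

theorem eq_of_fderiv_horizontal_eq_zero {E F G : Type*} [NormedAddCommGroup E] [NormedSpace ℝ E]
    [NormedAddCommGroup F] [NormedSpace ℝ F] [NormedAddCommGroup G] [NormedSpace ℝ G]
    {f : E × F → G} {B : Set E} {w : F} (hB : IsOpen B) (hconv : Convex ℝ B)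
    (hf : ∀ q ∈ B, DifferentiableAt ℝ f (q, w))
    (hf₀ : ∀ q ∈ B, ∀ ξ, fderiv ℝ f (q, w) (ξ, 0) = 0) {q q' : E} (hq : q ∈ B) (hq' : q' ∈ B) :
    f (q, w) = f (q', w) := by
  refine hB.is_const_of_fderiv_eq_zero (𝕜 := ℝ) (f := fun y => f (y, w)) hconv.isPreconnected
    (fun y hy => ?_) (fun y hy => ?_) hq hq'
  · exact ((hf y hy).comp y (f := fun y => (y, w)) (by fun_prop)).differentiableWithinAt
  · ext ξ
    exact (fderiv_partial_fst (x := (y, w)) (hf y hy) ξ).trans (hf₀ y hy ξ)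

theorem contDiffOn_coord {E : Type*} [NormedAddCommGroup E] [NormedSpace ℝ E] {f : E → Plane}
    {s : Set E} (hf : ContDiffOn ℝ ∞ f s) (i : Fin 2) : ContDiffOn ℝ ∞ (fun x => f x i) s :=
  (EuclideanSpace.proj (𝕜 := ℝ) i).contDiff.comp_contDiffOn hf

theorem hasFDerivAt_coord {E : Type*} [NormedAddCommGroup E] [NormedSpace ℝ E] {f : E → Plane}
    {x : E} (hf : DifferentiableAt ℝ f x) (i : Fin 2) :
    HasFDerivAt (fun y => f y i) ((EuclideanSpace.proj i : Coplane).comp (fderiv ℝ f x)) x :=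
  (EuclideanSpace.proj (𝕜 := ℝ) i).hasFDerivAt.comp x hf.hasFDerivAt

theorem fderiv_dU_horizontal {F : Plane × ℝ → Plane} {Ω : Set (Plane × ℝ)} {x : Plane × ℝ}
    (hΩ : IsOpen Ω) (hF : ContDiffOn ℝ ∞ F Ω) (hx : x ∈ Ω) (ξ : Plane) :
    fderiv ℝ (dU F) x (ξ, 0)
      = fderiv ℝ (fun x : Plane × ℝ => fderiv ℝ (fun y => F (y, x.2)) x.1) x (0, 1) ξ := by
  rw [fderiv_congr_of_eqOn hΩ (eqOn_dU_derivAlong hΩ hF) hx,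
    fderiv_derivAlong hΩ contDiffOn_const hF hx, fderiv_fderiv_partial_fst hΩ hF hx,
    fderiv_fderiv_comm hΩ hF hx]
  simp

/-- A family of maps of the plane as one map of `x = (q, u)`. -/
abbrev jointMap (P : ℝ → Plane → Plane) (x : Plane × ℝ) : Plane := P x.2 x.1

theorem exists_isStraighteningCoframe_stateDeriv {G : Plane × ℝ → Plane} {O : Set Plane}
    {V : Set ℝ} (hO : IsOpen O) (hV : IsOpen V) (hG : ContDiffOn ℝ ∞ G (O ×ˢ V))
    (hind : ∀ x ∈ O ×ˢ V, wedge (G x) (dU G x) ≠ 0) (hcomm : CommutesOn G (O ×ˢ V)) {q₀ : Plane}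
    (hq₀ : q₀ ∈ O) :
    ∃ r > 0, Metric.ball q₀ r ⊆ O ∧ ∃ P : ℝ → Plane → Plane,
      ContDiffOn ℝ ∞ (jointMap P) (Metric.ball q₀ r ×ˢ V) ∧
      IsStraighteningCoframe (stateDeriv P) G (Metric.ball q₀ r ×ˢ V) ∧ ∀ w, P w q₀ = q₀ := by
  have hOV := hO.prod hV
  obtain ⟨A, hA⟩ := exists_isStraighteningCoframe hOV hG hind
  obtain ⟨r, hr, hrO⟩ := Metric.isOpen_iff.1 hO q₀ hq₀
  have hsub : Metric.ball q₀ r ×ˢ V ⊆ O ×ˢ V := prod_mono hrO Subset.rfl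
  obtain ⟨P, hP, hPA, hP₀⟩ := exists_smooth_primitive hr hV (hA.smooth.mono hsub)
    fun x hx => hA.fderiv_horizontal_comm hOV hG hcomm (hsub hx)
  refine ⟨r, hr, hrO, fun w q => q₀ + P w q, contDiffOn_const.add hP, (hA.mono hsub).congr ?_,
    fun w => add_eq_left.2 (hP₀ w)⟩
  exact fun x hx => ((hPA x.1 hx.1 x.2 hx.2).const_add q₀).fderiv

namespace IsStraighteningCoframe

variable {P : ℝ → Plane → Plane} {G : Plane × ℝ → Plane} {b : Plane × ℝ → ℝ}

section OpenSet

variable {Ω : Set (Plane × ℝ)} {x : Plane × ℝ}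

theorem fderiv_dU_jointMap (h : IsStraighteningCoframe (stateDeriv P) G Ω)
    (hP : ContDiffOn ℝ ∞ (jointMap P) Ω) (hG : IsNaturalField G Ω (fun _ => (0, 1)) b)
    (hx : x ∈ Ω) (ξ : Plane) :
    fderiv ℝ (dU (jointMap P)) x (ξ, 0) = fieldXDeriv (b x) (stateDeriv P x ξ) :=
  (fderiv_dU_horizontal hG.isOpen hP hx ξ).trans (h.fderiv_control hG hx ξ)

theorem fderiv_dU_coord_zero_sub (h : IsStraighteningCoframe (stateDeriv P) G Ω)
    (hP : ContDiffOn ℝ ∞ (jointMap P) Ω) (hG : IsNaturalField G Ω (fun _ => (0, 1)) b)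
    (hx : x ∈ Ω) (ξ : Plane) :
    fderiv ℝ (fun y => dU (jointMap P) y 0 - jointMap P y 1) x (ξ, 0) = 0 := by
  have hPd := differentiableAt_of_contDiffOn hG.isOpen hP hx
  have hUd := differentiableAt_of_contDiffOn hG.isOpen (contDiffOn_dU hG.isOpen hP) hx
  rw [((hasFDerivAt_coord hUd 0).fun_sub (hasFDerivAt_coord hPd 1)).fderiv]
  change fderiv ℝ (dU (jointMap P)) x (ξ, 0) 0 - fderiv ℝ (jointMap P) x (ξ, 0) 1 = 0
  rw [h.fderiv_dU_jointMap hP hG hx, fieldXDeriv_apply_zero, ← fderiv_partial_fst hPd]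
  exact sub_self _

theorem fderiv_dU_coord_one_add (h : IsStraighteningCoframe (stateDeriv P) G Ω)
    (hP : ContDiffOn ℝ ∞ (jointMap P) Ω) (hG : IsNaturalField G Ω (fun _ => (0, 1)) b)
    (hx : x ∈ Ω) : fderiv ℝ (fun y => dU (jointMap P) y 1 + jointMap P y 0) x (G x, 0) = 0 := by
  have hPd := differentiableAt_of_contDiffOn hG.isOpen hP hx
  have hUd := differentiableAt_of_contDiffOn hG.isOpen (contDiffOn_dU hG.isOpen hP) hx
  rw [((hasFDerivAt_coord hUd 1).fun_add (hasFDerivAt_coord hPd 0)).fderiv]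
  change fderiv ℝ (dU (jointMap P)) x (G x, 0) 1 + fderiv ℝ (jointMap P) x (G x, 0) 0 = 0
  rw [h.fderiv_dU_jointMap hP hG hx, fieldXDeriv_apply_one, ← fderiv_partial_fst hPd]
  change _ + stateDeriv P x (G x) 0 = 0
  rw [h.apply_field x hx]
  simp [e₁]

end OpenSet

section Product

variable {B O : Set Plane} {V : Set ℝ} {q₀ : Plane} {w₀ : ℝ}

theorem dU_coord_zero_eq (h : IsStraighteningCoframe (stateDeriv P) G (B ×ˢ V))
    (hB : IsOpen B) (hconv : Convex ℝ B) (hP : ContDiffOn ℝ ∞ (jointMap P) (B ×ˢ V))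
    (hG : IsNaturalField G (B ×ˢ V) (fun _ => (0, 1)) b) (hq₀ : q₀ ∈ B) {x : Plane × ℝ}
    (hx : x ∈ B ×ˢ V) :
    dU (jointMap P) x 0 = dU (jointMap P) (q₀, x.2) 0 - P x.2 q₀ 1 + jointMap P x 1 := by
  have hsmooth := (contDiffOn_coord (contDiffOn_dU hG.isOpen hP) 0).sub (contDiffOn_coord hP 1)
  exact eq_add_of_sub_eq (eq_of_fderiv_horizontal_eq_zero hB hconv
    (fun q hq => differentiableAt_of_contDiffOn hG.isOpen hsmooth ⟨hq, hx.2⟩)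
    (fun q hq => h.fderiv_dU_coord_zero_sub hP hG ⟨hq, hx.2⟩) hx.1 hq₀)

theorem eq_self_of_standard (h : IsStraighteningCoframe (stateDeriv P) G (B ×ˢ V))
    (hB : IsOpen B) (hV : IsOpen V) (hconv : Convex ℝ B)
    (hP : ContDiffOn ℝ ∞ (jointMap P) (B ×ˢ V)) (hq₀ : q₀ ∈ B) (hw₀ : w₀ ∈ V)
    (hP₀ : P w₀ q₀ = q₀) (hG : ∀ q ∈ B, G (q, w₀) = e₁ ∧ dU G (q, w₀) = e₂) {q : Plane}
    (hq : q ∈ B) : P w₀ q = q := by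
  have hPd {y} (hy : y ∈ B) : DifferentiableAt ℝ (jointMap P) (y, w₀) :=
    differentiableAt_of_contDiffOn (hB.prod hV) hP ⟨hy, hw₀⟩
  have hconst := eq_of_fderiv_horizontal_eq_zero (f := fun x => jointMap P x - x.1) hB hconv
    (w := w₀) (fun y hy => (hPd hy).sub differentiableAt_fst) (fun y hy ξ => ?_) hq hq₀
  · simpa only [jointMap, hP₀, sub_self, sub_eq_zero] using hconst
  have hid : stateDeriv P (y, w₀) = ContinuousLinearMap.id ℝ Plane := by
    have hfield := h.apply_field (y, w₀) ⟨hy, hw₀⟩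
    have hdU := h.apply_dU (y, w₀) ⟨hy, hw₀⟩
    rw [(hG y hy).1] at hfield
    rw [(hG y hy).2] at hdU
    exact clm_ext_of_wedge wedge_e₁_e₂ hfield hdU
  rw [((hPd hy).hasFDerivAt.fun_sub hasFDerivAt_fst).fderiv, sub_apply,
    ← fderiv_partial_fst (hPd hy)]
  exact sub_eq_zero.2 (congrArg (· ξ) hid)

theorem isGeneratedFamily (h : IsStraighteningCoframe (stateDeriv P) G (O ×ˢ V))
    (hO : IsOpen O) (hV : IsOpen V) (hP : ContDiffOn ℝ ∞ (jointMap P) (O ×ˢ V))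
    (hinj : InjOn (fun x => (jointMap P x, x.2)) (O ×ˢ V)) {a₁ : ℝ → ℝ} {a₂ : ℝ × ℝ → ℝ}
    {D : Set (ℝ × ℝ)} (ha₁ : ContDiffOn ℝ ∞ a₁ V) (hD : IsOpen D) (ha₂ : ContDiffOn ℝ ∞ a₂ D)
    (hzero : ∀ x ∈ O ×ˢ V, dU (jointMap P) x 0 = a₁ x.2 + jointMap P x 1)
    (hone : ∀ x ∈ O ×ˢ V, (x.2, jointMap P x 1) ∈ D ∧
      dU (jointMap P) x 1 + jointMap P x 0 = a₂ (x.2, jointMap P x 1)) :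
    IsGeneratedFamily a₁ a₂ P O V where
  isOpen_O := hO
  isOpen_V := hV
  smooth_a₁ := ha₁
  smooth_a₂ := ⟨D, hD, ha₂, fun q hq u hu => (hone (q, u) ⟨hq, hu⟩).1⟩
  smooth_P := hP
  injOn := fun u hu q hq q' hq' he => congrArg Prod.fst
    (hinj (mk_mem_prod hq hu) (mk_mem_prod hq' hu) (Prod.ext he rfl))
  bijective := fun q hq u hu => by
    obtain ⟨e, he⟩ := isInvertible_of_injective (h.injective (mk_mem_prod hq hu))
    change Function.Bijective (stateDeriv P (q, u))
    exact he ▸ e.bijective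
  generated := fun q hq u hu => by
    have hx : (q, u) ∈ O ×ˢ V := ⟨hq, hu⟩
    have hfield : fieldX a₁ a₂ u (P u q) = dU (jointMap P) (q, u) := by
      ext i
      fin_cases i
      · exact (hzero _ hx).symm
      · exact (eq_sub_of_add_eq (hone _ hx).2).symm
    have hPd := differentiableAt_of_contDiffOn (hO.prod hV) hP hx
    rw [hfield, dU_eq_fderiv hPd]
    exact hasDerivAt_control hPd

end Product

end IsStraighteningCoframe

theorem exists_generatedFamily {G : Plane × ℝ → Plane} {b : Plane × ℝ → ℝ} {O : Set Plane}
    {V : Set ℝ} (hO : IsOpen O) (hV : IsOpen V)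
    (hG : IsNaturalField G (O ×ˢ V) (fun _ => (0, 1)) b) (hcomm : CommutesOn G (O ×ˢ V))
    {q₀ : Plane} (hq₀ : q₀ ∈ O) {w₀ : ℝ} (hw₀ : w₀ ∈ V) :
    ∃ O' ⊆ O, ∃ V' ⊆ V, q₀ ∈ O' ∧ w₀ ∈ V' ∧
      ∃ a₁ a₂ P, IsGeneratedFamily a₁ a₂ P O' V' ∧ Straightens P G O' V' ∧
        ((∀ q ∈ O, G (q, w₀) = e₁ ∧ dU G (q, w₀) = e₂) → ∀ q ∈ O', P w₀ q = q) := by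
  obtain ⟨r, hr, hrO, P, hP, hA, hP₀⟩ := exists_isStraighteningCoframe_stateDeriv hO hV
    hG.smooth_F (fun x hx => hG.wedge_dU_ne_zero hx) hcomm hq₀
  set B := Metric.ball q₀ r
  have hB : IsOpen B := Metric.isOpen_ball
  have hqB : q₀ ∈ B := Metric.mem_ball_self hr
  replace hG := hG.mono (hB.prod hV) (prod_mono hrO Subset.rfl)
  have hU := contDiffOn_dU hG.isOpen hP
  have hPd {x} (hx : x ∈ B ×ˢ V) := differentiableAt_of_contDiffOn hG.isOpen hP hx
  have hstate {x} (hx : x ∈ B ×ˢ V) (ξ : Plane) :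
      fderiv ℝ (jointMap P) x (ξ, 0) = stateDeriv P x ξ :=
    (fderiv_partial_fst (hPd hx) ξ).symm
  obtain ⟨S, D, a₂, hS, hxS, hSB, hinj, hD, ha₂, hone⟩ := exists_reduced_function hG.isOpen hP
    ((contDiffOn_coord hU 1).add (contDiffOn_coord hP 0))
    (fun x hx ξ hξ => (map_eq_zero_iff _ (hA.injective hx)).1 (hstate hx ξ ▸ hξ))
    (fun x hx => (hstate hx _).trans (hA.apply_field x hx))
    (fun x hx => hA.fderiv_dU_coord_one_add hP hG hx) (mk_mem_prod hqB hw₀)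
  obtain ⟨O', V', hO', hqO', hV', hwV', hOV'⟩ := mem_nhds_prod_iff'.1 (hS.mem_nhds hxS)
  have hsub := hOV'.trans hSB
  have hOB : O' ⊆ B := fun q hq => (hsub (mk_mem_prod hq hwV')).1
  have hVV : V' ⊆ V := fun w hw => (hsub (mk_mem_prod hqO' hw)).2
  have ha₁ : ContDiffOn ℝ ∞ (fun w => dU (jointMap P) (q₀, w) 0 - P w q₀ 1) V' :=
    ((contDiffOn_coord hU 0).sub (contDiffOn_coord hP 1)).comp (f := fun w => (q₀, w))
      (ContDiff.contDiffOn (by fun_prop)) fun w hw => ⟨hqB, hVV hw⟩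
  refine ⟨O', hOB.trans hrO, V', hVV, hqO', hwV', _, a₂, P,
    (hA.mono hsub).isGeneratedFamily hO' hV' (hP.mono hsub) (hinj.mono hOV') ha₁ hD ha₂
      (fun x hx => hA.dU_coord_zero_eq hB (convex_ball q₀ r) hP hG hqB (hsub hx))
      (fun x hx => hone x (hOV' hx)), fun q hq w hw => ?_, fun hstd q hq => ?_⟩
  · exact ⟨hA.apply_field (q, w) (hsub ⟨hq, hw⟩), hA.apply_dU (q, w) (hsub ⟨hq, hw⟩)⟩
  · exact hA.eq_self_of_standard hB hV (convex_ball q₀ r) hP hqB hw₀ (hP₀ w₀)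
      (fun q hq => hstd q (hrO hq)) (hOB hq)

/-! ### Feedback transformations on manifolds -/

section Feedback

variable {M : Type*} [TopologicalSpace M] [ChartedSpace Plane M]
  {U : Type*} [TopologicalSpace U] [ChartedSpace ℝ U]
  {f : (q : M) → U → TangentSpace (𝓡 2) q} {q₀ q₁ : M} {u₀ u₁ : U}
  {Θ Θ₁ : OpenPartialHomeomorph (M × U) (Plane × ℝ)} {φ φ₁ : OpenPartialHomeomorph M Plane}
  {O O₁ : Set Plane} {V V₁ : Set ℝ} {F G : Plane × ℝ → Plane}

theorem isSmoothDiffeo_symm_trans {E H' N : Type*} [NormedAddCommGroup E] [NormedSpace ℝ E]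
    [TopologicalSpace H'] {I : ModelWithCorners ℝ E H'} [TopologicalSpace N] [ChartedSpace H' N]
    {E' : Type*} [NormedAddCommGroup E'] [NormedSpace ℝ E'] {ρ ρ₁ : OpenPartialHomeomorph N E'}
    (hρ : ContMDiffOn I 𝓘(ℝ, E') ∞ ρ ρ.source)
    (hρsymm : ContMDiffOn 𝓘(ℝ, E') I ∞ ρ.symm ρ.target)
    (hρ₁ : ContMDiffOn I 𝓘(ℝ, E') ∞ ρ₁ ρ₁.source)
    (hρ₁symm : ContMDiffOn 𝓘(ℝ, E') I ∞ ρ₁.symm ρ₁.target) :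
    IsSmoothDiffeo (ρ.symm.trans ρ₁) where
  smooth := contMDiffOn_iff_contDiffOn.1 <|
    hρ₁.comp (hρsymm.mono inter_subset_left) fun _ hx => hx.2
  smooth_symm := contMDiffOn_iff_contDiffOn.1 <|
    hρ.comp (hρ₁symm.mono inter_subset_left) fun _ hx => hx.2

theorem mfderiv_chart_trans (hφ : φ ∈ IsManifold.maximalAtlas (𝓡 2) ∞ M)
    {ρ : OpenPartialHomeomorph Plane Plane} (hρ : IsSmoothDiffeo ρ) {q : M} (hq : q ∈ φ.source)
    (hρq : φ q ∈ ρ.source) (ξ : TangentSpace (𝓡 2) q) :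
    mfderiv (𝓡 2) 𝓘(ℝ, Plane) (φ.trans ρ) q ξ
      = fderiv ℝ ρ (φ q) (mfderiv (𝓡 2) 𝓘(ℝ, Plane) φ q ξ) := by
  have hchain := mfderiv_comp q (hρ.differentiableAt hρq).mdifferentiableAt
    ((contMDiffAt_of_mem_maximalAtlas hφ hq).mdifferentiableAt (by simp))
  rw [mfderiv_eq_fderiv] at hchain
  exact congrArg (fun l => l ξ) hchain

theorem isSmoothDiffeo_chart_transition
    (hφ : φ ∈ IsManifold.maximalAtlas (𝓡 2) ∞ M) (hφ₁ : φ₁ ∈ IsManifold.maximalAtlas (𝓡 2) ∞ M) :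
    IsSmoothDiffeo (φ.symm.trans φ₁) :=
  isSmoothDiffeo_symm_trans (I := 𝓡 2) (contMDiffOn_of_mem_maximalAtlas hφ)
    (contMDiffOn_symm_of_mem_maximalAtlas hφ) (contMDiffOn_of_mem_maximalAtlas hφ₁)
    (contMDiffOn_symm_of_mem_maximalAtlas hφ₁)

theorem fderiv_chart_transition
    (hφ : φ ∈ IsManifold.maximalAtlas (𝓡 2) ∞ M) (hφ₁ : φ₁ ∈ IsManifold.maximalAtlas (𝓡 2) ∞ M)
    {q : M} (hq : q ∈ φ.source) (hq₁ : q ∈ φ₁.source) (ξ : TangentSpace (𝓡 2) q) :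
    fderiv ℝ (φ.symm.trans φ₁) (φ q) (mfderiv (𝓡 2) 𝓘(ℝ, Plane) φ q ξ)
      = mfderiv (𝓡 2) 𝓘(ℝ, Plane) φ₁ q ξ := by
  have hφq : φ q ∈ (φ.symm.trans φ₁).source :=
    ⟨φ.map_source hq, (congrArg (· ∈ φ₁.source) (φ.left_inv hq)).mpr hq₁⟩
  rw [← mfderiv_chart_trans hφ (isSmoothDiffeo_chart_transition hφ hφ₁) hq hφq]
  have hgerm : φ.trans (φ.symm.trans φ₁) =ᶠ[𝓝 q] φ₁ := by
    filter_upwards [φ.open_source.mem_nhds hq] with z hz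
    exact congrArg φ₁ (φ.left_inv hz)
  exact congrArg (fun l : Plane →L[ℝ] Plane => l ξ) hgerm.mfderiv_eq

theorem chart_trans_mem_maximalAtlas [IsManifold (𝓡 2) ∞ M]
    (hφ : φ ∈ IsManifold.maximalAtlas (𝓡 2) ∞ M) {ρ : OpenPartialHomeomorph Plane Plane}
    (hρ : IsSmoothDiffeo ρ) : φ.trans ρ ∈ IsManifold.maximalAtlas (𝓡 2) ∞ M := by
  rw [IsManifold.mem_maximalAtlas_iff_contMDiffOn]
  exact ⟨hρ.smooth.contMDiffOn.comp
      ((contMDiffOn_of_mem_maximalAtlas hφ).mono inter_subset_left) fun x hx => hx.2,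
    (contMDiffOn_symm_of_mem_maximalAtlas hφ).comp
      (hρ.smooth_symm.contMDiffOn.mono inter_subset_left) fun x hx => hx.2⟩

theorem IsSmoothSystem.contDiffOn_chart [IsManifold (𝓡 2) ∞ M] (hf : IsSmoothSystem f)
    (hφ : φ ∈ IsManifold.maximalAtlas (𝓡 2) ∞ M) {s : Plane × ℝ → M × U} {Ω : Set (Plane × ℝ)}
    (hs : ContMDiffOn 𝓘(ℝ, Plane × ℝ) ((𝓡 2).prod 𝓘(ℝ, ℝ)) ∞ s Ω)
    (hmem : ∀ y ∈ Ω, (s y).1 ∈ φ.source) :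
    ContDiffOn ℝ ∞ (fun y => (mfderiv (𝓡 2) 𝓘(ℝ, Plane) φ (s y).1 (f (s y).1 (s y).2) : Plane))
      Ω := by
  have htangentMap := (contMDiffOn_of_mem_maximalAtlas hφ).contMDiffOn_tangentMapWithin (m := ∞)
    (by simp) φ.open_source.uniqueMDiffOn
  have hsystem : ContMDiffOn 𝓘(ℝ, Plane × ℝ) (𝓡 2).tangent ∞
      (fun y => (⟨(s y).1, f (s y).1 (s y).2⟩ : TangentBundle (𝓡 2) M)) Ω :=
    ContMDiff.comp_contMDiffOn hf hs
  have hvector := (contMDiff_snd_tangentBundle_modelSpace Plane 𝓘(ℝ, Plane)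
    (n := ∞)).comp_contMDiffOn (htangentMap.comp hsystem hmem)
  refine (contMDiffOn_iff_contDiffOn.1 hvector).congr fun y hy => ?_
  rw [← mfderivWithin_of_isOpen φ.open_source (hmem y hy)]
  rfl

theorem contMDiffOn_prod_symm {e : OpenPartialHomeomorph M Plane} {e' : OpenPartialHomeomorph U ℝ}
    (he : e ∈ IsManifold.maximalAtlas (𝓡 2) ∞ M)
    (he' : e' ∈ IsManifold.maximalAtlas 𝓘(ℝ, ℝ) ∞ U) :
    ContMDiffOn 𝓘(ℝ, Plane × ℝ) ((𝓡 2).prod 𝓘(ℝ, ℝ)) ∞ (e.prod e').symm (e.prod e').target :=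
  ((contMDiffOn_symm_of_mem_maximalAtlas he).comp contDiff_fst.contMDiff.contMDiffOn
    fun _ hx => hx.1).prodMk ((contMDiffOn_symm_of_mem_maximalAtlas he').comp
    contDiff_snd.contMDiff.contMDiffOn fun _ hx => hx.2)

theorem IsSmoothSystem.contDiffOn_localRep [IsManifold (𝓡 2) ∞ M] (hf : IsSmoothSystem f)
    {e : OpenPartialHomeomorph M Plane} {e' : OpenPartialHomeomorph U ℝ}
    (he : e ∈ IsManifold.maximalAtlas (𝓡 2) ∞ M)
    (he' : e' ∈ IsManifold.maximalAtlas 𝓘(ℝ, ℝ) ∞ U) :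
    ContDiffOn ℝ ∞ (localRep f e e') (e.target ×ˢ e'.target) :=
  hf.contDiffOn_chart he (contMDiffOn_prod_symm he he') fun _ hy => e.map_target hy.1

theorem isLocalFeedback_prod
    {e : OpenPartialHomeomorph M Plane} {e' : OpenPartialHomeomorph U ℝ}
    (he : e ∈ IsManifold.maximalAtlas (𝓡 2) ∞ M)
    (he' : e' ∈ IsManifold.maximalAtlas 𝓘(ℝ, ℝ) ∞ U) (hq : q₀ ∈ e.source) (hu : u₀ ∈ e'.source) :
    IsLocalFeedback f q₀ u₀ (e.prod e') e e.target e'.target (localRep f e e') where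
  mem_source := ⟨hq, hu⟩
  target_eq := rfl
  smooth := ((contMDiffOn_of_mem_maximalAtlas he).comp contMDiff_fst.contMDiffOn
    fun _ hx => hx.1).prodMk_space ((contMDiffOn_of_mem_maximalAtlas he').comp
    contMDiff_snd.contMDiffOn fun _ hx => hx.2)
  smooth_symm := contMDiffOn_prod_symm he he'
  chart := he
  chart_target := rfl
  triangular := fun _ hx => ⟨hx.1, rfl⟩
  transforms := fun x hx => by
    change _ = mfderiv (𝓡 2) 𝓘(ℝ, Plane) e (e.symm (e x.1)) (f (e.symm (e x.1)) (e'.symm (e' x.2)))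
    rw [e.left_inv hx.1, e'.left_inv hx.2]

namespace IsLocalFeedback

theorem isOpen_left (h : IsLocalFeedback f q₀ u₀ Θ φ O V G) : IsOpen O :=
  h.chart_target ▸ φ.open_target

theorem map_mem (h : IsLocalFeedback f q₀ u₀ Θ φ O V G) : Θ (q₀, u₀) ∈ O ×ˢ V :=
  h.target_eq ▸ Θ.map_source h.mem_source

theorem isOpen_right (h : IsLocalFeedback f q₀ u₀ Θ φ O V G) : IsOpen V := by
  have hslice : (fun w => ((Θ (q₀, u₀)).1, w)) ⁻¹' (O ×ˢ V) = V :=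
    mk_preimage_prod_right h.map_mem.1
  rw [← hslice, ← h.target_eq]
  exact Θ.open_target.preimage (by fun_prop)

theorem symm_transforms (h : IsLocalFeedback f q₀ u₀ Θ φ O V G) {y : Plane × ℝ}
    (hy : y ∈ Θ.target) :
    mfderiv (𝓡 2) 𝓘(ℝ, Plane) φ (Θ.symm y).1 (f (Θ.symm y).1 (Θ.symm y).2) = G y := by
  rw [h.transforms _ (Θ.map_target hy), Θ.right_inv hy]

theorem fst_eq (h : IsLocalFeedback f q₀ u₀ Θ φ O V G) {y : Plane × ℝ} (hy : y ∈ Θ.target) :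
    y.1 = φ (Θ.symm y).1 := by
  rw [← (h.triangular _ (Θ.map_target hy)).2, Θ.right_inv hy]

theorem contDiffOn [IsManifold (𝓡 2) ∞ M] (h : IsLocalFeedback f q₀ u₀ Θ φ O V G)
    (hf : IsSmoothSystem f) : ContDiffOn ℝ ∞ G (O ×ˢ V) := by
  rw [← h.target_eq]
  exact (hf.contDiffOn_chart h.chart h.smooth_symm fun y hy =>
    (h.triangular _ (Θ.map_target hy)).1).congr fun y hy => (h.symm_transforms hy).symm

theorem isCoordFeedback_transition (h : IsLocalFeedback f q₀ u₀ Θ φ O V G)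
    (h₁ : IsLocalFeedback f q₁ u₁ Θ₁ φ₁ O₁ V₁ F) :
    IsCoordFeedback (Θ.symm.trans Θ₁) (φ.symm.trans φ₁) G F where
  toIsSmoothDiffeo := isSmoothDiffeo_symm_trans h.smooth h.smooth_symm h₁.smooth h₁.smooth_symm
  base := isSmoothDiffeo_chart_transition h.chart h₁.chart
  mem_base := by
    rintro y ⟨hy, hy₁⟩
    have hbase := (h.triangular _ (Θ.map_target hy)).1
    rw [h.fst_eq hy]
    exact ⟨φ.map_source hbase,
      (congrArg (· ∈ φ₁.source) (φ.left_inv hbase)).mpr (h₁.triangular _ hy₁).1⟩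
  triangular := by
    rintro y ⟨hy, hy₁⟩
    have hbase := (h.triangular _ (Θ.map_target hy)).1
    rw [h.fst_eq hy]
    exact (h₁.triangular _ hy₁).2.trans (congrArg φ₁ (φ.left_inv hbase).symm)
  transforms := by
    rintro y ⟨hy, hy₁⟩
    rw [h.fst_eq hy, ← h.symm_transforms hy, fderiv_chart_transition h.chart h₁.chart
      (h.triangular _ (Θ.map_target hy)).1 (h₁.triangular _ hy₁).1]
    exact h₁.transforms _ hy₁

theorem exists_isBracketFrame_transition {H v : Plane × ℝ → Plane × ℝ} {b k : Plane × ℝ → ℝ}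
    (h : IsLocalFeedback f q₀ u₀ Θ φ O V G) (h₁ : IsLocalFeedback f q₀ u₀ Θ₁ φ₁ O₁ V₁ F)
    (hframe : IsBracketFrame F (O₁ ×ˢ V₁) H v b k) :
    ∃ Ω ⊆ O ×ˢ V, Θ (q₀, u₀) ∈ Ω ∧ ∃ H' v' b' k', IsBracketFrame G Ω H' v' b' k' ∧
      k' (Θ (q₀, u₀)) = k (Θ₁ (q₀, u₀)) ∧
      derivAlong H' b' (Θ (q₀, u₀)) = derivAlong H b (Θ₁ (q₀, u₀)) := by
  have hT := h.isCoordFeedback_transition h₁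
  have hleft : Θ.symm (Θ (q₀, u₀)) = (q₀, u₀) := Θ.left_inv h.mem_source
  have hTΘ : Θ.symm.trans Θ₁ (Θ (q₀, u₀)) = Θ₁ (q₀, u₀) := congrArg Θ₁ hleft
  have hmem : Θ (q₀, u₀) ∈ (Θ.symm.trans Θ₁).source :=
    ⟨Θ.map_source h.mem_source, (congrArg (· ∈ Θ₁.source) hleft).mpr h₁.mem_source⟩
  have hmaps : MapsTo (Θ.symm.trans Θ₁) (Θ.symm.trans Θ₁).source (O₁ ×ˢ V₁) := fun y hy =>
    h₁.target_eq ▸ Θ₁.map_source hy.2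
  refine ⟨_, fun y hy => h.target_eq ▸ hy.1, hmem, _, _, _, _, hT.isBracketFrame hmaps hframe,
    congrArg k hTΘ, ?_⟩
  rw [hT.derivAlong_comp_pullback hmaps hframe hmem, hTΘ]

theorem trans [IsManifold (𝓡 2) ∞ M] (h : IsLocalFeedback f q₀ u₀ Θ φ O V G)
    {Θ' : OpenPartialHomeomorph (Plane × ℝ) (Plane × ℝ)} {ρ : OpenPartialHomeomorph Plane Plane}
    (hΘ' : IsCoordFeedback Θ' ρ G F) (hmem : Θ (q₀, u₀) ∈ Θ'.source)
    (htarget : Θ'.target = ρ.target ×ˢ V₁) (hsub : Θ'.source ⊆ O ×ˢ V) (hρO : ρ.source ⊆ O) :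
    IsLocalFeedback f q₀ u₀ (Θ.trans Θ') (φ.trans ρ) ρ.target V₁ F where
  mem_source := ⟨h.mem_source, hmem⟩
  target_eq := by
    rw [← htarget, OpenPartialHomeomorph.trans_target]
    exact inter_eq_left.2 fun y hy => h.target_eq ▸ hsub (Θ'.map_target hy)
  smooth := hΘ'.smooth.contMDiffOn.comp (h.smooth.mono inter_subset_left) fun _ hx => hx.2
  smooth_symm := h.smooth_symm.comp
    (hΘ'.smooth_symm.contMDiffOn.mono inter_subset_left) fun _ hx => hx.2
  chart := chart_trans_mem_maximalAtlas h.chart hΘ'.base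
  chart_target := by
    rw [OpenPartialHomeomorph.trans_target]
    exact inter_eq_left.2 fun y hy => h.chart_target ▸ hρO (ρ.map_target hy)
  triangular := by
    rintro x ⟨hx, hx'⟩
    change Θ x ∈ Θ'.source at hx'
    have htri := h.triangular x hx
    have hbase := hΘ'.mem_base _ hx'
    rw [htri.2] at hbase
    exact ⟨⟨htri.1, hbase⟩, (hΘ'.triangular _ hx').trans (congrArg ρ htri.2)⟩
  transforms := by
    rintro x ⟨hx, hx'⟩
    change Θ x ∈ Θ'.source at hx'
    have htri := h.triangular x hx
    have hbase := hΘ'.mem_base _ hx'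
    have hF := hΘ'.transforms _ hx'
    rw [htri.2] at hbase hF
    rw [mfderiv_chart_trans h.chart hΘ'.base htri.1 hbase, h.transforms x hx]
    exact hF

end IsLocalFeedback

end Feedback

/-! ### Systems with vanishing invariants -/

theorem IsNaturalControl.exists_generatedFamily {G : Plane × ℝ → Plane} {O : Set Plane}
    {V : Set ℝ} (hO : IsOpen O) (hV : IsOpen V) (hG : ContDiffOn ℝ ∞ G (O ×ˢ V))
    (hnat : IsNaturalControl G O V) (hcomm : Commuting G O V) {q₀ : Plane} (hq₀ : q₀ ∈ O) {w₀ : ℝ}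
    (hw₀ : w₀ ∈ V) :
    ∃ O' ⊆ O, ∃ V' ⊆ V, q₀ ∈ O' ∧ w₀ ∈ V' ∧
      ∃ a₁ a₂ P, IsGeneratedFamily a₁ a₂ P O' V' ∧ Straightens P G O' V' ∧
        ((∀ q ∈ O, G (q, w₀) = e₁ ∧ dU G (q, w₀) = e₂) → ∀ q ∈ O', P w₀ q = q) := by
  obtain ⟨H, b, k, h⟩ := hnat.exists_isBracketFrame hO hV hG
  exact _root_.exists_generatedFamily hO hV h.toIsNaturalField
    ((commuting_iff_commutesOn hO hV hG).1 hcomm) hq₀ hw₀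

section BaseChange

variable {ρ : OpenPartialHomeomorph Plane Plane}

theorem IsSmoothDiffeo.isCoordFeedback_prod (h : IsSmoothDiffeo ρ) (G : Plane × ℝ → Plane)
    {V : Set ℝ} (hV : IsOpen V) :
    IsCoordFeedback (ρ.prod (OpenPartialHomeomorph.ofSet V hV)) ρ G
      (fun y => fderiv ℝ ρ (ρ.symm y.1) (G (ρ.symm y.1, y.2))) where
  smooth := (h.smooth.comp contDiff_fst.contDiffOn fun _ hx => hx.1).prodMk
    contDiff_snd.contDiffOn
  smooth_symm := (h.smooth_symm.comp contDiff_fst.contDiffOn fun _ hx => hx.1).prodMk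
    contDiff_snd.contDiffOn
  base := h
  mem_base := fun _ hy => hy.1
  triangular := fun _ _ => rfl
  transforms := fun y hy => by
    change _ = fderiv ℝ ρ (ρ.symm (ρ y.1)) (G (ρ.symm (ρ y.1), y.2))
    rw [ρ.left_inv hy.1]

namespace IsGeneratedFamily

variable {a₁ : ℝ → ℝ} {a₂ : ℝ × ℝ → ℝ} {P : ℝ → Plane → Plane} {O : Set Plane} {V : Set ℝ}
  (h : IsGeneratedFamily a₁ a₂ P O V) (hρ : IsSmoothDiffeo ρ) (hmaps : MapsTo ρ ρ.source O)
include h hρ hmaps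

theorem stateDeriv_comp {x : Plane × ℝ} (hx : x ∈ ρ.source ×ˢ V) :
    stateDeriv (fun w => P w ∘ ρ) x = (stateDeriv P (ρ x.1, x.2)).comp (fderiv ℝ ρ x.1) :=
  fderiv_comp x.1 (h.differentiableAt (x := (ρ x.1, x.2)) ⟨hmaps hx.1, hx.2⟩)
    (hρ.differentiableAt hx.1)

theorem comp : IsGeneratedFamily a₁ a₂ (fun w => P w ∘ ρ) ρ.source V where
  isOpen_O := ρ.open_source
  isOpen_V := h.isOpen_V
  smooth_a₁ := h.smooth_a₁
  smooth_a₂ := by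
    obtain ⟨D, hD, ha₂, hPD⟩ := h.smooth_a₂
    exact ⟨D, hD, ha₂, fun q hq => hPD (ρ q) (hmaps hq)⟩
  smooth_P := h.smooth_P.comp (f := fun x : Plane × ℝ => (ρ x.1, x.2))
    ((hρ.smooth.comp contDiff_fst.contDiffOn fun _ hx => hx.1).prodMk contDiff_snd.contDiffOn)
    fun _ hx => ⟨hmaps hx.1, hx.2⟩
  injOn := fun w hw => (h.injOn w hw).comp ρ.injOn hmaps
  bijective := fun q hq w hw => by
    have hchain := h.stateDeriv_comp hρ hmaps (x := (q, w)) ⟨hq, hw⟩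
    rw [stateDeriv] at hchain
    rw [hchain]
    exact (h.bijective (ρ q) (hmaps hq) w hw).comp (hρ.isInvertible_fderiv hq).bijective
  generated := fun q hq => h.generated (ρ q) (hmaps hq)

end IsGeneratedFamily

theorem Straightens.comp_symm {a₁ : ℝ → ℝ} {a₂ : ℝ × ℝ → ℝ} {P : ℝ → Plane → Plane}
    {G : Plane × ℝ → Plane} {V : Set ℝ} (hS : Straightens P G ρ.source V)
    (hP : IsGeneratedFamily a₁ a₂ P ρ.source V) (hρ : IsSmoothDiffeo ρ) :
    Straightens (fun w => P w ∘ ρ.symm)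
      (fun y => fderiv ℝ ρ (ρ.symm y.1) (G (ρ.symm y.1, y.2))) ρ.target V := by
  refine (hP.comp hρ.symm ρ.symm.mapsTo).straightens fun x hx => ?_
  have hinv := hρ.fderiv_symm_fderiv (ρ.map_target hx.1) (G (ρ.symm x.1, x.2))
  rw [ρ.right_inv hx.1] at hinv
  rw [hP.stateDeriv_comp hρ.symm ρ.symm.mapsTo hx, ContinuousLinearMap.comp_apply, hinv]
  exact (hS (ρ.symm x.1) (ρ.map_target hx.1) x.2 hx.2).1

end BaseChange

section Characterization

variable {M : Type*} [TopologicalSpace M] [ChartedSpace Plane M] [IsManifold (𝓡 2) ∞ M]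
  {U : Type*} [TopologicalSpace U] [ChartedSpace ℝ U]
  {f : (q : M) → U → TangentSpace (𝓡 2) q} {q₀ : M} {u₀ : U}

theorem hasInvariants (hf : IsSmoothSystem f) (hreg : IsRegularSystem f) : HasInvariants f := by
  intro e he e' he'
  obtain ⟨v, b, hv⟩ := exists_isNaturalField (e.open_target.prod e'.open_target)
    (hf.contDiffOn_localRep he he') (hreg e he e' he')
  obtain ⟨H, k, hframe⟩ := hv.exists_isBracketFrame
  obtain ⟨p, hp⟩ := hframe.exists_isMovingFrame e.open_target e'.open_target
  exact ⟨p, H, v, b, k, hp⟩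

namespace IsLocalFeedback

variable {Θ Θ₁ : OpenPartialHomeomorph (M × U) (Plane × ℝ)} {φ φ₁ : OpenPartialHomeomorph M Plane}
  {O O₁ : Set Plane} {V V₁ : Set ℝ} {F G : Plane × ℝ → Plane} {H v : Plane × ℝ → Plane × ℝ}
  {b k : Plane × ℝ → ℝ}

theorem curvature_eq_zero (hf : IsSmoothSystem f) (h : IsLocalFeedback f q₀ u₀ Θ φ O V G)
    (hcomm : Commuting G O V) (h₁ : IsLocalFeedback f q₀ u₀ Θ₁ φ₁ O₁ V₁ F)
    (hframe : IsBracketFrame F (O₁ ×ˢ V₁) H v b k) : k (Θ₁ (q₀, u₀)) = 0 := by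
  obtain ⟨Ω, hΩ, hmem, H', v', b', k', hframe', hk, -⟩ :=
    h.exists_isBracketFrame_transition h₁ hframe
  rw [commuting_iff_commutesOn h.isOpen_left h.isOpen_right (h.contDiffOn hf)] at hcomm
  rw [← hk, hframe'.curvature_eq_zero (hcomm.mono hΩ) hmem]

theorem derivAlong_b_eq_zero (hf : IsSmoothSystem f) (h : IsLocalFeedback f q₀ u₀ Θ φ O V G)
    (hnat : IsNaturalControl G O V) (hcomm : Commuting G O V)
    (h₁ : IsLocalFeedback f q₀ u₀ Θ₁ φ₁ O₁ V₁ F)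
    (hframe : IsBracketFrame F (O₁ ×ˢ V₁) H v b k) : derivAlong H b (Θ₁ (q₀, u₀)) = 0 := by
  obtain ⟨Ω, hΩ, hmem, H', v', b', k', hframe', -, hb⟩ :=
    h.exists_isBracketFrame_transition h₁ hframe
  obtain ⟨H'', b'', k'', hcontrol⟩ :=
    hnat.exists_isBracketFrame h.isOpen_left h.isOpen_right (h.contDiffOn hf)
  rw [commuting_iff_commutesOn h.isOpen_left h.isOpen_right (h.contDiffOn hf)] at hcomm
  have hunit (y) (hy : y ∈ Ω) : (v' y).2 ^ 2 = 1 := by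
    rw [hframe'.sq_snd_eq (hcontrol.toIsNaturalField.mono hframe'.isOpen hΩ) hy, one_pow]
  rw [← hb, hframe'.derivAlong_b_eq_zero (hcomm.mono hΩ) hunit hmem]

theorem exists_normalized (hf : IsSmoothSystem f) (h : IsLocalFeedback f q₀ u₀ Θ φ O V G)
    (hnat : IsNaturalControl G O V) (hcomm : Commuting G O V) :
    ∃ Θ φ O V G, IsLocalFeedback f q₀ u₀ Θ φ O V G ∧
      ∃ a₁ a₂ P, IsGeneratedFamily a₁ a₂ P O V ∧
        (∀ q ∈ O, P (Θ (q₀, u₀)).2 q = q) ∧ Straightens P G O V := by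
  obtain ⟨O', hO', V', hV', hq, hw, a₁, a₂, P, hP, hS, -⟩ :=
    hnat.exists_generatedFamily h.isOpen_left h.isOpen_right (h.contDiffOn hf) hcomm
      h.map_mem.1 h.map_mem.2
  set w₀ := (Θ (q₀, u₀)).2
  have hslice : ContDiffOn ℝ ∞ (P w₀) O' :=
    hP.smooth_P.comp (f := fun q => (q, w₀)) (ContDiff.contDiffOn (by fun_prop))
      fun q hq => ⟨hq, hw⟩
  obtain ⟨ρ, hρ, rfl, hρP⟩ := exists_isSmoothDiffeo_of_injOn hP.isOpen_O hslice (hP.injOn _ hw)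
    fun q hq => isInvertible_of_injective (hP.injective_stateDeriv (x := (q, w₀)) ⟨hq, hw⟩)
  refine ⟨_, _, _, _, _, h.trans (hρ.isCoordFeedback_prod G hP.isOpen_V) ⟨hq, hw⟩ rfl
    (prod_mono hO' hV') hO', a₁, a₂, _, hP.comp hρ.symm ρ.symm.mapsTo, fun q hq => ?_,
    hS.comp_symm hP hρ⟩
  change P w₀ (ρ.symm q) = q
  rw [← hρP, ρ.right_inv hq]

end IsLocalFeedback

theorem curvatureVanishes_of_commuting (hf : IsSmoothSystem f)
    (h : ∀ (q₀ : M) (u₀ : U), ∃ Θ φ O V G, IsLocalFeedback f q₀ u₀ Θ φ O V G ∧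
      Commuting G O V) : CurvatureVanishes f := by
  intro e he e' he' p H v b k hframe x hx
  obtain ⟨Θ, φ, O, V, G, hΘ, hcomm⟩ := h (e.symm x.1) (e'.symm x.2)
  have hk := hΘ.curvature_eq_zero hf hcomm
    (isLocalFeedback_prod he he' (e.map_target hx.1) (e'.map_target hx.2))
    (hframe.isBracketFrame e.open_target e'.open_target (hf.contDiffOn_localRep he he'))
  rwa [← OpenPartialHomeomorph.prod_symm_apply, (e.prod e').right_inv hx] at hk

theorem derivBVanishes_of_natural_commuting (hf : IsSmoothSystem f)
    (h : ∀ (q₀ : M) (u₀ : U), ∃ Θ φ O V G, IsLocalFeedback f q₀ u₀ Θ φ O V G ∧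
      IsNaturalControl G O V ∧ Commuting G O V) : DerivBVanishes f := by
  intro e he e' he' p H v b k hframe x hx
  obtain ⟨Θ, φ, O, V, G, hΘ, hnat, hcomm⟩ := h (e.symm x.1) (e'.symm x.2)
  have hb := hΘ.derivAlong_b_eq_zero hf hnat hcomm
    (isLocalFeedback_prod he he' (e.map_target hx.1) (e'.map_target hx.2))
    (hframe.isBracketFrame e.open_target e'.open_target (hf.contDiffOn_localRep he he'))
  rwa [← OpenPartialHomeomorph.prod_symm_apply, (e.prod e').right_inv hx] at hb

theorem vanish_of_natural_commuting (hf : IsSmoothSystem f)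
    (h : ∀ (q₀ : M) (u₀ : U), ∃ Θ φ O V G, IsLocalFeedback f q₀ u₀ Θ φ O V G ∧
      IsNaturalControl G O V ∧ Commuting G O V) : CurvatureVanishes f ∧ DerivBVanishes f :=
  ⟨curvatureVanishes_of_commuting hf fun q₀ u₀ =>
    let ⟨Θ, φ, O, V, G, hΘ, _, hcomm⟩ := h q₀ u₀
    ⟨Θ, φ, O, V, G, hΘ, hcomm⟩, derivBVanishes_of_natural_commuting hf h⟩

theorem exists_natural_commuting [IsManifold 𝓘(ℝ, ℝ) ∞ U] (hf : IsSmoothSystem f)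
    (hreg : IsRegularSystem f) (hk : CurvatureVanishes f) (hb : DerivBVanishes f) (q₀ : M)
    (u₀ : U) :
    ∃ Θ φ O V G, IsLocalFeedback f q₀ u₀ Θ φ O V G ∧
      IsNaturalControl G O V ∧ Commuting G O V := by
  set e := chartAt Plane q₀
  set e' := chartAt ℝ u₀
  have he : e ∈ IsManifold.maximalAtlas (𝓡 2) ∞ M := IsManifold.chart_mem_maximalAtlas q₀
  have he' : e' ∈ IsManifold.maximalAtlas 𝓘(ℝ, ℝ) ∞ U := IsManifold.chart_mem_maximalAtlas u₀
  have hcharts := isLocalFeedback_prod (f := f) he he' (mem_chart_source Plane q₀)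
    (mem_chart_source ℝ u₀)
  obtain ⟨p, H, v, b, k, hframe⟩ := hasInvariants hf hreg e he e' he'
  obtain ⟨Θ, O, V, hO, hV, hΘ, hx, hsub, htarget, hfst, hnat, hcomm⟩ :=
    (hframe.isBracketFrame e.open_target e'.open_target
      (hf.contDiffOn_localRep he he')).exists_natural_control
      (hk e he e' he' p H v b k hframe) (hb e he e' he' p H v b k hframe) hcharts.map_mem
  have hmaps {y} (hy : y ∈ Θ.source) : Θ y ∈ O ×ˢ V := htarget ▸ Θ.map_source hy
  have hOe : O ⊆ e.target := fun q hq => by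
    have hqw : (q, (Θ (e q₀, e' u₀)).2) ∈ Θ.target := htarget ▸ ⟨hq, (hmaps hx).2⟩
    have hq' := hfst _ (Θ.map_target hqw)
    rw [Θ.right_inv hqw] at hq'
    exact (congrArg (· ∈ e.target) hq').mpr (hsub (Θ.map_target hqw)).1
  have hfeedback := isCoordFeedback_ofSet (F := localRep f e e' ∘ Θ.symm) hO hΘ
    (fun y hy => hfst y hy ▸ (hmaps hy).1) hfst
    (fun y hy => congrArg (localRep f e e') (Θ.left_inv hy).symm)
  exact ⟨_, _, O, V, _, hcharts.trans hfeedback hx htarget hsub hOe,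
    hnat.isNaturalControl_of_commutesOn hO hV hcomm,
    (commuting_iff_commutesOn hO hV hnat.smooth_F).2 hcomm⟩

end Characterization

theorem theorem5 {M : Type*} [TopologicalSpace M] [ChartedSpace Plane M] [IsManifold (𝓡 2) ∞ M]
    {U : Type*} [TopologicalSpace U] [ChartedSpace ℝ U] [IsManifold 𝓘(ℝ, ℝ) ∞ U]
    (f : (q : M) → U → TangentSpace (𝓡 2) q)
    (hf : IsSmoothSystem f) (hreg : IsRegularSystem f) :
    -- the invariants are defined
    HasInvariants f ∧
    -- the characterization
    ((CurvatureVanishes f ∧ DerivBVanishes f) ↔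
      ∀ (q₀ : M) (u₀ : U), ∃ Θ φ O V G, IsLocalFeedback f q₀ u₀ Θ φ O V G ∧
        IsNaturalControl G O V ∧ Commuting G O V) ∧
    -- commutation in any control, natural or not, forces zero curvature
    ((∀ (q₀ : M) (u₀ : U), ∃ Θ φ O V G, IsLocalFeedback f q₀ u₀ Θ φ O V G ∧
        Commuting G O V) → CurvatureVanishes f) ∧
    -- normal form of these systems, in suitable local coordinates
    ((CurvatureVanishes f ∧ DerivBVanishes f) ↔
      ∀ (q₀ : M) (u₀ : U), ∃ Θ φ O V G, IsLocalFeedback f q₀ u₀ Θ φ O V G ∧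
        ∃ a₁ a₂ P, IsGeneratedFamily a₁ a₂ P O V ∧
          (∀ q ∈ O, P (Θ (q₀, u₀)).2 q = q) ∧ Straightens P G O V) ∧
    -- in arbitrary local coordinates, every system with commuting fields in a natural control is
    -- obtained from a generated family
    (∀ (O : Set Plane) (V : Set ℝ) (G : Plane × ℝ → Plane), IsOpen O → IsOpen V →
      ContDiffOn ℝ ∞ G (O ×ˢ V) → IsNaturalControl G O V → Commuting G O V →
      ∀ q₀ ∈ O, ∀ w₀ ∈ V, ∃ O' ⊆ O, ∃ V' ⊆ V, q₀ ∈ O' ∧ w₀ ∈ V' ∧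
        ∃ a₁ a₂ P, IsGeneratedFamily a₁ a₂ P O' V' ∧ Straightens P G O' V' ∧
          ((∀ q ∈ O, G (q, w₀) = e₁ ∧ dU G (q, w₀) = e₂) → ∀ q ∈ O', P w₀ q = q)) ∧
    -- conversely, every generated family gives such a system
    (∀ (O : Set Plane) (V : Set ℝ) (a₁ : ℝ → ℝ) (a₂ : ℝ × ℝ → ℝ) (P : ℝ → Plane → Plane)
      (G : Plane × ℝ → Plane), IsGeneratedFamily a₁ a₂ P O V →
      (∀ q ∈ O, ∀ w ∈ V, fderiv ℝ (P w) q (G (q, w)) = e₁) →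
      ContDiffOn ℝ ∞ G (O ×ˢ V) ∧ Straightens P G O V ∧ IsNaturalControl G O V ∧
        Commuting G O V) := by
  refine ⟨hasInvariants hf hreg, ⟨fun h => exists_natural_commuting hf hreg h.1 h.2,
    vanish_of_natural_commuting hf⟩, curvatureVanishes_of_commuting hf, ⟨fun h q₀ u₀ => ?_,
    fun h => vanish_of_natural_commuting hf fun q₀ u₀ => ?_⟩, ?_, ?_⟩
  · obtain ⟨Θ, φ, O, V, G, hΘ, hnat, hcomm⟩ := exists_natural_commuting hf hreg h.1 h.2 q₀ u₀
    exact hΘ.exists_normalized hf hnat hcomm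
  · obtain ⟨Θ, φ, O, V, G, hΘ, a₁, a₂, P, hP, -, hS⟩ := h q₀ u₀
    have hG : ∀ x ∈ O ×ˢ V, stateDeriv P x (G x) = e₁ := fun x hx => (hS x.1 hx.1 x.2 hx.2).1
    exact ⟨Θ, φ, O, V, G, hΘ, hP.isNaturalControl_straightened hG, hP.commuting_straightened hG⟩
  · intro O V G hO hV hG hnat hcomm q₀ hq₀ w₀ hw₀
    exact hnat.exists_generatedFamily hO hV hG hcomm hq₀ hw₀
  · intro O V a₁ a₂ P G hP hG
    have hG' : ∀ x ∈ O ×ˢ V, stateDeriv P x (G x) = e₁ := fun x hx => hG x.1 hx.1 x.2 hx.2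
    exact ⟨hP.contDiffOn_straightened hG', hP.straightens hG',
      hP.isNaturalControl_straightened hG', hP.commuting_straightened hG'⟩
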